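/- Let $G$ be a simply connected compact semisimple Lie group with Lie algebra $\mathfrak g$, and let $X$ be a compact Kähler manifold on which $G$ acts smoothly and transitively by biholomorphisms (a generalized flag variety of $G$). Let $\pi: L\to X$ be a $G$-equivariant holomorphic line bundle: $G$ acts smoothly on $L$, covering its action on $X$, linearly on the fibres, and each $g\in G$ acts on $L$ by a biholomorphism. Let $h$ be a $G$-invariant Hermitian metric on $L$ and $M=\{q\in L: h(q,q)=1\}$ its unit circle bundle. Fix $q_0\in M$, put $p=\pi(q_0)$, let $R$ be the stabilizer of $p$ with Lie algebra $\mathfrak r$, and let $\mathfrak t\subset\mathfrak r$ be a Cartan subalgebra of $\mathfrak g$ (the Lie algebra of a maximal torus $T\subset R$). Let $\lambda:\mathfrak t\to\mathbb C$ be the weight of $L$, that is, the differential on $\mathfrak t$ of the character by which $R$ acts on the fibre $L_p$; write $L=L_\lambda$ and assume $\lambda\neq0$. Let $J$ denote the complex structures of $X$ and $L$. Let $D^+$ be the set of roots $\alpha$ of $(\mathfrak g^{\mathbb C},\mathfrak t^{\mathbb C})$ whose root space is not contained in $\mathfrak r^{\mathbb C}$ and maps to $T^{1,0}_pX$; for $\alpha\in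 D^+$ choose $X_\alpha,Y_\alpha\in\mathfrak g$ with $0\ne X_\alpha-iY_\alpha\in\mathfrak g_\alpha$, so that $JX_\alpha=Y_\alpha$ in $T_pX$. Let $X_0$ be the vector field on $M$ generating the circle action $q\mapsto e^{it}q$, and let $\mathcal T_M$ be the space of $G$-invariant smooth vector fields on $M$. Suppose that one of the following holds: (a) $\mathcal T_M=\mathbb R X_0$; (b) there is an $\alpha\in D^+$ such that $\mathcal T_M=\mathbb R\langle X_0,X_\alpha,Y_\alpha\rangle$, where $X_\alpha,Y_\alpha$ stand for $G$-invariant vector fields on $M$ whose values at $q_0$ are $\frac{d}{dt}\big|_{0}\exp(tX_\alpha)q_0$ and $\frac{d}{dt}\big|_{0}\exp(tY_\alpha)q_0$; and $\lambda=-l\alpha$ for some real $l>0$. Let $\omega$ be a $G$-invariant smooth closed real $(1,1)$-form on the total space of $L_\lambda$ which is exact, i.e. $\omega=d\theta$ for some smooth real $1$-form $\theta$ on $L_\lambda$. Then there exists a $G$-invariant function $\Phi\in C^\infty(L_\lambda,\mathbb R)$ with $\omega=dd^c\Phi$, where $d^c\Phi=-d\Phi\circ J$ (so $dd^c\Phi=2i\partial\bar\partial\Phi$).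 -/

import Mathlib

open Bundle Set
open scoped Manifold ContDiff TensorProduct

noncomputable section

namespace InvariantDDC

/-! ### The real manifold underlying a complex manifold -/

section RealStructure

/-- Complex charts with complex-smooth transition maps have real-smooth transition maps. -/
theorem isManifold_real_of_complex {V H M : Type*} [NormedAddCommGroup V] [NormedSpace ℂ V]
    [TopologicalSpace H] [TopologicalSpace M] [ChartedSpace H M] {n : ℕ∞ω}
    (IC : ModelWithCorners ℂ V H) (IR : ModelWithCorners ℝ V H)
    (h : (IC : H → V) = IR) (hs : (IC.symm : V → H) = IR.symm) [IsManifold IC n M] :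
    IsManifold IR n M := by
  refine isManifold_of_contDiffOn IR n M fun e e' he he' => ?_
  have hm := (contDiffGroupoid n IC).compatible he he'
  rw [contDiffGroupoid, mem_groupoid_of_pregroupoid] at hm
  have hc : ContDiffOn ℂ n (IC ∘ (e.symm.trans e') ∘ IC.symm)
      (IC.symm ⁻¹' (e.symm.trans e').source ∩ range IC) := hm.1
  have := hc.restrict_scalars ℝ
  rwa [h, hs] at this

variable {E X : Type*} [NormedAddCommGroup E] [NormedSpace ℂ E]
  [TopologicalSpace X] [ChartedSpace E X]

theorem isManifold_real_base {n : ℕ∞ω} [IsManifold 𝓘(ℂ, E) n X] : IsManifold 𝓘(ℝ, E) n X :=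
  isManifold_real_of_complex 𝓘(ℂ, E) 𝓘(ℝ, E) rfl rfl

instance isManifold_real_totalSpace [IsManifold 𝓘(ℂ, E) ω X] (L : X → Type*)
    [TopologicalSpace (TotalSpace ℂ L)] [∀ x, TopologicalSpace (L x)]
    [∀ x, AddCommGroup (L x)] [∀ x, Module ℂ (L x)]
    [FiberBundle ℂ L] [VectorBundle ℂ ℂ L] [ContMDiffVectorBundle ω ℂ L 𝓘(ℂ, E)] :
    IsManifold (𝓘(ℝ, E).prod 𝓘(ℝ, ℂ)) 1 (TotalSpace ℂ L) := by
  have : IsManifold (𝓘(ℂ, E).prod 𝓘(ℂ, ℂ)) 1 (TotalSpace ℂ L) :=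
    Bundle.TotalSpace.isManifold ℂ L
  exact isManifold_real_of_complex (𝓘(ℂ, E).prod 𝓘(ℂ, ℂ)) (𝓘(ℝ, E).prod 𝓘(ℝ, ℂ)) rfl rfl

/-- A smooth real Lie group has the regularity that the bracket on its Lie algebra needs. -/
instance leInfty_minSmoothness : ENat.LEInfty (minSmoothness ℝ 3) :=
  ⟨by rw [minSmoothness_of_isRCLikeNormedField]; exact ENat.LEInfty.out⟩

end RealStructure

/-! ### Real differential forms on a complex manifold

`I` is the model with corners of the underlying real manifold; its model vector space `V` is a
complex vector space and the charts are holomorphic. -/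

section Forms

variable {V H : Type*} [NormedAddCommGroup V] [NormedSpace ℂ V] [TopologicalSpace H]

/-- A (not necessarily smooth) real differential form of degree `k` on `M`. -/
abbrev DiffForm (I : ModelWithCorners ℝ V H) (M : Type*) [TopologicalSpace M] [ChartedSpace H M]
    (k : ℕ) : Type _ :=
  (x : M) → (TangentSpace I x) [⋀^Fin k]→L[ℝ] ℝ

variable {I : ModelWithCorners ℝ V H} {M : Type*} [TopologicalSpace M] [ChartedSpace H M]

/-- The form `η` written in the chart around `x₀`: its pull-back under the inverse chart. -/
def inChart {k : ℕ} (η : DiffForm I M k) (x₀ : M) (y : V) : V [⋀^Fin k]→L[ℝ] ℝ :=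
  (η ((extChartAt I x₀).symm y)).compContinuousLinearMap
    (mfderiv 𝓘(ℝ, V) I (extChartAt I x₀).symm y)

/-- The form `η` has smooth coefficients in every chart. -/
def IsSmoothForm {k : ℕ} (η : DiffForm I M k) : Prop :=
  ∀ x₀ : M, ContDiffOn ℝ ∞ (inChart η x₀) (extChartAt I x₀).target

/-- The exterior derivative, computed at `x` in the chart around `x`. -/
def extD {k : ℕ} (η : DiffForm I M k) : DiffForm I M (k + 1) := fun x =>
  (extDeriv (inChart η x) (extChartAt I x x)).compContinuousLinearMap
    (mfderiv I 𝓘(ℝ, V) (extChartAt I x) x)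

/-- The complex structure on the tangent space: multiplication by `i`. -/
def J (I : ModelWithCorners ℝ V H) (x : M) : TangentSpace I x →L[ℝ] TangentSpace I x :=
  (Complex.I • ContinuousLinearMap.id ℝ V : V →L[ℝ] V)

/-- A real 2-form is of type `(1,1)` if it is invariant under the complex structure. -/
def IsOneOne (η : DiffForm I M 2) : Prop :=
  ∀ (x : M) (v w : TangentSpace I x), η x ![J I x v, J I x w] = η x ![v, w]

/-- The 1-form `d^c Φ = - dΦ ∘ J = i (∂̄ - ∂) Φ`. -/
def dc (I : ModelWithCorners ℝ V H) (Φ : M → ℝ) : DiffForm I M 1 := fun x =>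
  ContinuousAlternatingMap.ofSubsingleton ℝ (TangentSpace I x) ℝ (0 : Fin 1)
    (-((mfderiv I 𝓘(ℝ, ℝ) Φ x : TangentSpace I x →L[ℝ] ℝ).comp (J I x)))

/-- The 2-form `dd^c Φ = 2 i ∂ ∂̄ Φ`. -/
def ddc (I : ModelWithCorners ℝ V H) (Φ : M → ℝ) : DiffForm I M 2 := extD (dc I Φ)

/-- A Kähler form: a smooth, closed, positive real `(1,1)`-form. -/
structure IsKahlerForm (η : DiffForm I M 2) : Prop where
  smooth : IsSmoothForm η
  closed : extD η = 0
  oneOne : IsOneOne η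
  pos : ∀ (x : M) (v : TangentSpace I x), v ≠ 0 → 0 < η x ![v, J I x v]

variable (G : Type*)

/-- Invariance of a form under an action: `g^* η = η` for all `g`. -/
def IsInvariantForm [SMul G M] {k : ℕ} (η : DiffForm I M k) : Prop :=
  ∀ (g : G) (x : M),
    (η (g • x)).compContinuousLinearMap (mfderiv I I (fun y : M => g • y) x) = η x

end Forms

/-! ### Group actions and equivariant line bundles -/

section Actions

variable {F : Type*} [NormedAddCommGroup F] [NormedSpace ℝ F]
  {G : Type*} [TopologicalSpace G] [ChartedSpace F G] [Group G]

/-- The value at `q` of the fundamental vector field of `A`, `d/dt exp(tA) q` at `t = 0`: the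
derivative of the orbit map `g ↦ g q` at the identity in the direction `A`. -/
def fundamentalVector {V H : Type*} [NormedAddCommGroup V] [NormedSpace ℝ V]
    [TopologicalSpace H] (I : ModelWithCorners ℝ V H) {M : Type*} [TopologicalSpace M]
    [ChartedSpace H M] [SMul G M] (A : GroupLieAlgebra 𝓘(ℝ, F) G) (q : M) : TangentSpace I q :=
  (mfderiv 𝓘(ℝ, F) I (fun g : G => g • q) (1 : G) A : V)

variable {E : Type*} [NormedAddCommGroup E] [NormedSpace ℂ E]
  {X : Type*} [TopologicalSpace X] [ChartedSpace E X]

variable (F G E X) in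
/-- A smooth transitive action of `G` on the complex manifold `X` by holomorphic maps. -/
structure IsHolomorphicTransitiveAction [MulAction G X] : Prop where
  smooth : ContMDiff (𝓘(ℝ, F).prod 𝓘(ℝ, E)) 𝓘(ℝ, E) ∞ (fun a : G × X => a.1 • a.2)
  holomorphic : ∀ g : G, MDifferentiable 𝓘(ℂ, E) 𝓘(ℂ, E) (fun x : X => g • x)
  transitive : ∀ x y : X, ∃ g : G, g • x = y

variable (L : X → Type*) [TopologicalSpace (TotalSpace ℂ L)] [∀ x, TopologicalSpace (L x)]
  [∀ x, AddCommGroup (L x)] [∀ x, Module ℂ (L x)] [FiberBundle ℂ L]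

/-- The action of `G` on the total space of the holomorphic line bundle `L` covers its action on
the base, is linear on the fibres, smooth, and holomorphic for each element of `G`. -/
structure IsEquivariantLineBundle (F G E : Type*) [NormedAddCommGroup F] [NormedSpace ℝ F]
    [TopologicalSpace G] [ChartedSpace F G] [Group G] [NormedAddCommGroup E] [NormedSpace ℂ E]
    {X : Type*} [TopologicalSpace X] [ChartedSpace E X] (L : X → Type*)
    [TopologicalSpace (TotalSpace ℂ L)] [∀ x, TopologicalSpace (L x)]
    [∀ x, AddCommGroup (L x)] [∀ x, Module ℂ (L x)] [FiberBundle ℂ L]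
    [MulAction G X] [MulAction G (TotalSpace ℂ L)] : Prop where
  linear : ∀ (g : G) (x : X), ∃ φ : L x →ₗ[ℂ] L (g • x), ∀ v : L x,
    g • (⟨x, v⟩ : TotalSpace ℂ L) = ⟨g • x, φ v⟩
  smooth : ContMDiff (𝓘(ℝ, F).prod (𝓘(ℝ, E).prod 𝓘(ℝ, ℂ))) (𝓘(ℝ, E).prod 𝓘(ℝ, ℂ)) ∞
    (fun a : G × TotalSpace ℂ L => a.1 • a.2)
  holomorphic : ∀ g : G, MDifferentiable (𝓘(ℂ, E).prod 𝓘(ℂ, ℂ)) (𝓘(ℂ, E).prod 𝓘(ℂ, ℂ))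
    (fun q : TotalSpace ℂ L => g • q)

variable {L}

/-- Multiplication by a complex number in the fibres of `L`. -/
def fiberSMul (z : ℂ) (q : TotalSpace ℂ L) : TotalSpace ℂ L := ⟨q.proj, z • q.snd⟩

/-- `N` is the squared norm `q ↦ h(q, q) = r(q)²` of a smooth Hermitian metric `h` on `L` that is
invariant under `G`. -/
structure IsInvariantHermitianNormSq (G E : Type*) [NormedAddCommGroup E] [NormedSpace ℂ E]
    {X : Type*} [TopologicalSpace X] [ChartedSpace E X] {L : X → Type*}
    [TopologicalSpace (TotalSpace ℂ L)] [∀ x, TopologicalSpace (L x)]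
    [∀ x, AddCommGroup (L x)] [∀ x, Module ℂ (L x)] [FiberBundle ℂ L]
    [SMul G (TotalSpace ℂ L)] (N : TotalSpace ℂ L → ℝ) : Prop where
  smooth : ContMDiff (𝓘(ℝ, E).prod 𝓘(ℝ, ℂ)) 𝓘(ℝ, ℝ) ∞ N
  pos : ∀ q : TotalSpace ℂ L, q.snd ≠ 0 → 0 < N q
  homogeneous : ∀ (z : ℂ) (q : TotalSpace ℂ L), N (fiberSMul z q) = ‖z‖ ^ 2 * N q
  invariant : ∀ (g : G) (q : TotalSpace ℂ L), N (g • q) = N q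

/-- The unit circle bundle. -/
def circleBundle (N : TotalSpace ℂ L → ℝ) : Set (TotalSpace ℂ L) := {q | N q = 1}

/-- The generator `X₀ = J ∂/∂r` of the circle action `q ↦ e^{it} q` on the circle bundle. -/
def circleField (E : Type*) [NormedAddCommGroup E] [NormedSpace ℂ E]
    {X : Type*} [TopologicalSpace X] [ChartedSpace E X] {L : X → Type*}
    [TopologicalSpace (TotalSpace ℂ L)] [∀ x, TopologicalSpace (L x)]
    [∀ x, AddCommGroup (L x)] [∀ x, Module ℂ (L x)] [FiberBundle ℂ L] (q : TotalSpace ℂ L) :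
    TangentSpace (𝓘(ℝ, E).prod 𝓘(ℝ, ℂ)) q :=
  (mfderiv 𝓘(ℝ, ℝ) (𝓘(ℝ, E).prod 𝓘(ℝ, ℂ))
    (fun t : ℝ => fiberSMul (Complex.exp (t * Complex.I)) q) 0 (1 : ℝ) : E × ℂ)

/-- A smooth `G`-invariant vector field on the unit circle bundle `N = 1`. Only the values of `v`
on the circle bundle matter. -/
structure IsInvariantField (G : Type*) {E : Type*} [NormedAddCommGroup E] [NormedSpace ℂ E]
    {X : Type*} [TopologicalSpace X] [ChartedSpace E X] [IsManifold 𝓘(ℂ, E) ω X] {L : X → Type*}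
    [TopologicalSpace (TotalSpace ℂ L)] [∀ x, TopologicalSpace (L x)]
    [∀ x, AddCommGroup (L x)] [∀ x, Module ℂ (L x)] [FiberBundle ℂ L] [VectorBundle ℂ ℂ L]
    [ContMDiffVectorBundle ω ℂ L 𝓘(ℂ, E)] [SMul G (TotalSpace ℂ L)] (N : TotalSpace ℂ L → ℝ)
    (v : (q : TotalSpace ℂ L) → TangentSpace (𝓘(ℝ, E).prod 𝓘(ℝ, ℂ)) q) : Prop where
  tangent : ∀ q ∈ circleBundle N,
    (mfderiv (𝓘(ℝ, E).prod 𝓘(ℝ, ℂ)) 𝓘(ℝ, ℝ) N q (v q) : ℝ) = 0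
  smooth : ContMDiffOn (𝓘(ℝ, E).prod 𝓘(ℝ, ℂ)) (𝓘(ℝ, E).prod 𝓘(ℝ, ℂ)).tangent ∞
    (fun q => (⟨q, v q⟩ : TangentBundle (𝓘(ℝ, E).prod 𝓘(ℝ, ℂ)) (TotalSpace ℂ L)))
    (circleBundle N)
  invariant : ∀ (g : G), ∀ q ∈ circleBundle N,
    mfderiv (𝓘(ℝ, E).prod 𝓘(ℝ, ℂ)) (𝓘(ℝ, E).prod 𝓘(ℝ, ℂ))
      (fun q' : TotalSpace ℂ L => g • q') q (v q) = v (g • q)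

/-! ### Weights and roots -/

/-- The fibre coordinate of `g q` in the trivialization of `L` around the base point of `q`. -/
def fiberCoord [SMul G (TotalSpace ℂ L)] (q : TotalSpace ℂ L) (g : G) : ℂ :=
  (trivializationAt ℂ L q.proj (g • q)).2

/-- The differential of `fiberCoord q` at the identity. -/
def fiberCoordDeriv [SMul G (TotalSpace ℂ L)] (q : TotalSpace ℂ L) :
    GroupLieAlgebra 𝓘(ℝ, F) G →L[ℝ] ℂ :=
  mfderiv 𝓘(ℝ, F) 𝓘(ℝ, ℂ) (fiberCoord q) (1 : G)

variable (E F G) in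
/-- The isotropy algebra `𝔯` of a point: the `A` whose fundamental vector field vanishes there. -/
def IsIsotropic [MulAction G X] (p : X) (A : GroupLieAlgebra 𝓘(ℝ, F) G) : Prop :=
  fundamentalVector 𝓘(ℝ, E) A p = 0

variable [CompleteSpace F] [LieGroup 𝓘(ℝ, F) ∞ G]

/-- The weight `λ` on `𝔱 ⊆ 𝔯` of the line bundle. For a nonzero `q` in the fibre over `p`, the
stabilizer `R` of `p` acts on that fibre by `g q = χ(g) q`, and `λ` is the differential of `χ`, that
is, `λ(A) = d/dt χ(exp(tA))` at `t = 0`. -/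
def weight [SMul G (TotalSpace ℂ L)] (𝔱 : LieSubalgebra ℝ (GroupLieAlgebra 𝓘(ℝ, F) G))
    (q : TotalSpace ℂ L) : 𝔱 →ₗ[ℝ] ℂ :=
  (fiberCoord q (1 : G))⁻¹ •
    ((fiberCoordDeriv q).toLinearMap ∘ₗ 𝔱.toSubmodule.subtype)

/-- `α` belongs to `D⁺` and `A - i B` is a root vector for it: `A - i B` in the complexified Lie
algebra is an eigenvector of `𝔱` with eigenvalue the root `α`, it does not lie in the complexified
isotropy algebra at `p`, and it gives a tangent vector of type `(1,0)` at `p`, i.e. `J A = B` in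
`T_p X`. -/
structure IsPositiveRootVector [MulAction G X]
    (𝔱 : LieSubalgebra ℝ (GroupLieAlgebra 𝓘(ℝ, F) G)) (p : X) (α : 𝔱 →ₗ[ℝ] ℂ)
    (A B : GroupLieAlgebra 𝓘(ℝ, F) G) : Prop where
  root_ne_zero : α ≠ 0
  eigenvector : ∀ T : 𝔱,
    ⁅(1 : ℂ) ⊗ₜ[ℝ] (T : GroupLieAlgebra 𝓘(ℝ, F) G), (1 : ℂ) ⊗ₜ[ℝ] A - Complex.I ⊗ₜ[ℝ] B⁆
      = α T • ((1 : ℂ) ⊗ₜ[ℝ] A - Complex.I ⊗ₜ[ℝ] B)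
  not_isotropic : ¬ IsIsotropic F G E p A
  holomorphic : J 𝓘(ℝ, E) p (fundamentalVector 𝓘(ℝ, E) A p) = fundamentalVector 𝓘(ℝ, E) B p

end Actions

/-! ### The two cases -/

section Cases

/-- Case (a): every invariant vector field on the circle bundle is a multiple of `X₀`. -/
def CaseA (G : Type*) (E : Type*) [NormedAddCommGroup E] [NormedSpace ℂ E]
    {X : Type*} [TopologicalSpace X] [ChartedSpace E X] [IsManifold 𝓘(ℂ, E) ω X] {L : X → Type*}
    [TopologicalSpace (TotalSpace ℂ L)] [∀ x, TopologicalSpace (L x)]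
    [∀ x, AddCommGroup (L x)] [∀ x, Module ℂ (L x)] [FiberBundle ℂ L] [VectorBundle ℂ ℂ L]
    [ContMDiffVectorBundle ω ℂ L 𝓘(ℂ, E)] [SMul G (TotalSpace ℂ L)] (N : TotalSpace ℂ L → ℝ) : Prop :=
  ∀ v : (q : TotalSpace ℂ L) → TangentSpace (𝓘(ℝ, E).prod 𝓘(ℝ, ℂ)) q,
    IsInvariantField G N v → ∃ c : ℝ, ∀ q ∈ circleBundle N, v q = c • circleField E q

/-- Case (b) for the root `α`: the invariant vector fields on the circle bundle are spanned by `X₀`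
and by two invariant fields whose values at `q₀` are `A` and `B`, where `A - i B` is a root vector
for `α ∈ D⁺`. (The span does not depend on how the root vector is scaled.) -/
def CaseB (E : Type*) [NormedAddCommGroup E] [NormedSpace ℂ E]
    {X : Type*} [TopologicalSpace X] [ChartedSpace E X] [IsManifold 𝓘(ℂ, E) ω X] {L : X → Type*}
    [TopologicalSpace (TotalSpace ℂ L)] [∀ x, TopologicalSpace (L x)]
    [∀ x, AddCommGroup (L x)] [∀ x, Module ℂ (L x)] [FiberBundle ℂ L] [VectorBundle ℂ ℂ L]
    [ContMDiffVectorBundle ω ℂ L 𝓘(ℂ, E)]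
    {G : Type*} {F : Type*} [NormedAddCommGroup F] [NormedSpace ℝ F] [CompleteSpace F]
    [TopologicalSpace G] [ChartedSpace F G] [Group G] [LieGroup 𝓘(ℝ, F) ∞ G]
    [MulAction G X] [MulAction G (TotalSpace ℂ L)] (N : TotalSpace ℂ L → ℝ)
    (𝔱 : LieSubalgebra ℝ (GroupLieAlgebra 𝓘(ℝ, F) G)) (q₀ : TotalSpace ℂ L)
    (α : 𝔱 →ₗ[ℝ] ℂ) : Prop :=
  ∃ A B : GroupLieAlgebra 𝓘(ℝ, F) G, IsPositiveRootVector (E := E) 𝔱 q₀.proj α A B ∧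
    ∃ vA vB : (q : TotalSpace ℂ L) → TangentSpace (𝓘(ℝ, E).prod 𝓘(ℝ, ℂ)) q,
      IsInvariantField G (E := E) N vA ∧ IsInvariantField G (E := E) N vB ∧
      vA q₀ = fundamentalVector (𝓘(ℝ, E).prod 𝓘(ℝ, ℂ)) A q₀ ∧
      vB q₀ = fundamentalVector (𝓘(ℝ, E).prod 𝓘(ℝ, ℂ)) B q₀ ∧
      ∀ v : (q : TotalSpace ℂ L) → TangentSpace (𝓘(ℝ, E).prod 𝓘(ℝ, ℂ)) q,
        IsInvariantField G (E := E) N v → ∃ a b c : ℝ, ∀ q ∈ circleBundle N,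
          v q = a • circleField E q + b • vA q + c • vB q

end Cases

end InvariantDDC

end

open Bundle Set
open scoped Manifold ContDiff TensorProduct

noncomputable section

namespace InvariantDDC

open Filter Topology MeasureTheory

set_option linter.unusedSectionVars false

/-! ### Charts and their derivatives at the centre -/

section Charts

variable {V H : Type*} [NormedAddCommGroup V] [NormedSpace ℝ V] [TopologicalSpace H]
  {I : ModelWithCorners ℝ V H} [I.Boundaryless]
  {M : Type*} [TopologicalSpace M] [ChartedSpace H M] [IsManifold I 1 M]

/-! Write `R` for the Euler field on `L` (the vertical vector `q` at the point `q`), so that `J R =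
X₀` generates the circle action. The plan is to choose a primitive of `ω` so well normalized that,
after a term `d^c Φ` is removed, what is left is closed.

Normalization. Averaging a primitive over the compact group `G` gives an invariant `θ` with `dθ = ω`
(`exists_invariant_primitive`). Put `Φ(q) = ∫₀¹ θ_{sq}(iq) ds`. Then `dΦ(R) = θ(X₀)`, that is, `d^c
Φ(X₀) = θ(X₀)`, and `Φ` is smooth and invariant. Replacing `θ` by `θ - d^c Φ` gives an invariant
form with `θ(X₀) = 0` whose differential `ω - dd^c Φ` is still of type `(1,1)`
(`exists_primitive_sub_dc`). It remains to prove `dθ = 0`.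

The moment map `q ↦ (A ↦ θ(A^#))`, with `A^#` the fundamental field of `A`, is equivariant. An
invariant inner product on the Lie algebra turns its value at `zq` into an element `C(q)`, and `q ↦
C(q)^#` is an invariant vector field on the circle bundle, so the hypothesis on `𝒯_M` applies to it.
Multiplication by `z` commutes with `G`, so relations between fundamental and vertical vectors at
`q` persist at `zq`. In case (a), `C(q)^#` is a multiple of `X₀`; hence `|C(q)|² = θ_{zq}(C(q)^#) =
0`.

In case (b) it must also be shown that `θ` vanishes on `A = X_α` and `B = Y_α`. As `λ ≠ 0`, some `T
∈ 𝔱` has `λ(T) = i`, so that `T^# = X₀` along the fibre. Invariance gives `dθ(R, A) = r ∂_r θ(A)`,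
while type `(1,1)` gives `dθ(R, A) = dθ(X₀, JA) = dθ(T, B) = -θ([T, B])`. From `λ = -lα` one gets
`[T, B] = l⁻¹ A`, so `f(r) = θ_{rq}(A)` satisfies `r f' = -l⁻¹ f`. Its solutions `c r^{-1/l}` blow
up at the zero section unless `c = 0`, whereas `f` is smooth there (`momentMap_rootVector_eq_zero`).
The sign of `l` is what makes this work.

Conclusion. The moment map vanishes off the zero section, where `R` and the fundamental vectors span
the tangent spaces. Since `dθ(A, B) = -θ([A, B])` and `dθ(R, A) = r ∂_r θ(A)`, the form `dθ`
vanishes there, and by continuity everywhere. -/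

theorem mdifferentiableAt_extChartAt_symm {x : M} {y : V} (hy : y ∈ (extChartAt I x).target) :
    MDifferentiableAt 𝓘(ℝ, V) I (extChartAt I x).symm y := by
  have := mdifferentiableWithinAt_extChartAt_symm (I := I) hy
  rwa [I.range_eq_univ, mdifferentiableWithinAt_univ] at this

theorem mfderiv_symm_mfderiv_extChartAt {x z : M} (hz : z ∈ (extChartAt I x).source)
    (v : TangentSpace I z) :
    (mfderiv 𝓘(ℝ, V) I (extChartAt I x).symm (extChartAt I x z)
      (mfderiv I 𝓘(ℝ, V) (extChartAt I x) z v) : V) = v := by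
  have := mfderivWithin_extChartAt_symm_comp_mfderiv_extChartAt' (I := I) hz
  rw [I.range_eq_univ, mfderivWithin_univ] at this
  exact DFunLike.congr_fun this v

theorem mfderiv_extChartAt_self_apply {x : M} (v : TangentSpace I x) :
    (mfderiv I 𝓘(ℝ, V) (extChartAt I x) x v : V) = v := by
  rw [mfderiv_extChartAt_self]; rfl

theorem mfderiv_extChartAt_symm_self_apply {x : M} (v : V) :
    (mfderiv 𝓘(ℝ, V) I (extChartAt I x).symm (extChartAt I x x) v : V) = v := by
  have h := mfderiv_symm_mfderiv_extChartAt (I := I) (mem_extChartAt_source x) v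
  have h2 : mfderiv I 𝓘(ℝ, V) (extChartAt I x) x v = v := mfderiv_extChartAt_self_apply v
  exact (congrArg (mfderiv 𝓘(ℝ, V) I (extChartAt I x).symm (extChartAt I x x)) h2).symm.trans h

end Charts

/-! ### Pull-backs of forms and naturality of the exterior derivative -/

section Pullback

variable {V H : Type*} [NormedAddCommGroup V] [NormedSpace ℂ V] [TopologicalSpace H]
  {I : ModelWithCorners ℝ V H} [I.Boundaryless]
  {M : Type*} [TopologicalSpace M] [ChartedSpace H M] [IsManifold I ∞ M]
  {W : Type*} [NormedAddCommGroup W] [NormedSpace ℝ W]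

/-- The pull-back of a form under a map from a vector space. -/
def pull {k : ℕ} (η : DiffForm I M k) (γ : W → M) (y : W) : W [⋀^Fin k]→L[ℝ] ℝ :=
  (η (γ y)).compContinuousLinearMap (mfderiv 𝓘(ℝ, W) I γ y)

theorem inChart_contDiffAt {k : ℕ} {η : DiffForm I M k} (hη : IsSmoothForm η) {x : M} {y : V}
    (hy : y ∈ (extChartAt I x).target) : ContDiffAt ℝ ∞ (inChart η x) y :=
  (hη x).contDiffAt ((isOpen_extChartAt_target x).mem_nhds hy)

theorem inChart_mfderiv_extChartAt {k : ℕ} (η : DiffForm I M k) {x z : M}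
    (hz : z ∈ (extChartAt I x).source) (v : Fin k → TangentSpace I z) :
    inChart η x (extChartAt I x z) (fun i => mfderiv I 𝓘(ℝ, V) (extChartAt I x) z (v i))
      = η z v := by
  have : IsManifold I 1 M := .of_le (n := ∞) (by norm_num)
  -- The two sides live over `e.symm (e z)` and `z`, which are equal but not by definition. Since
  -- every tangent space is the model space `V`, the base point can be generalized and substituted.
  have key : ∀ z', (extChartAt I x).symm (extChartAt I x z) = z' → z = z' →
      ∀ w : Fin k → V, (∀ i, w i = v i) →
      (η z' : V [⋀^Fin k]→L[ℝ] ℝ) w = (η z : V [⋀^Fin k]→L[ℝ] ℝ) v := by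
    rintro z' - rfl w hw
    congr 1; funext i; exact hw i
  refine key _ rfl ((extChartAt I x).left_inv hz).symm _ fun i => ?_
  exact mfderiv_symm_mfderiv_extChartAt hz (v i)

theorem fderiv_extChartAt_comp {γ : W → M} {x : M} {y : W} (hy : γ y ∈ (extChartAt I x).source)
    (hγ : MDifferentiableAt 𝓘(ℝ, W) I γ y) (w : W) :
    fderiv ℝ (fun y => extChartAt I x (γ y)) y w =
      (mfderiv I 𝓘(ℝ, V) (extChartAt I x) (γ y) (mfderiv 𝓘(ℝ, W) I γ y w) : V) := by
  have : IsManifold I 1 M := .of_le (n := ∞) (by norm_num)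
  have h := mfderiv_comp_apply y (mdifferentiableAt_extChartAt (I := I)
    (by rwa [extChartAt_source] at hy)) hγ w
  exact (DFunLike.congr_fun mfderiv_eq_fderiv w).symm.trans h

/-- Near `y₀` the map factors through one fixed chart, which makes `pull η γ` a pull-back between
vector spaces. -/
theorem pull_eventuallyEq {k : ℕ} (η : DiffForm I M k) {γ : W → M} {y₀ : W}
    (hγ : ContMDiffAt 𝓘(ℝ, W) I ∞ γ y₀) :
    pull η γ =ᶠ[𝓝 y₀] fun y => (inChart η (γ y₀) (extChartAt I (γ y₀) (γ y))).compContinuousLinearMap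
      (fderiv ℝ (fun y => extChartAt I (γ y₀) (γ y)) y) := by
  have : IsManifold I 1 M := .of_le (n := ∞) (by norm_num)
  have h1 : ∀ᶠ y in 𝓝 y₀, γ y ∈ (extChartAt I (γ y₀)).source :=
    hγ.continuousAt.preimage_mem_nhds (extChartAt_source_mem_nhds (γ y₀))
  have h2 : ∀ᶠ y in 𝓝 y₀, ContMDiffAt 𝓘(ℝ, W) I 1 γ y :=
    (contMDiffAt_iff_contMDiffAt_nhds (by norm_num)).1 (hγ.of_le (by norm_num))
  filter_upwards [h1, h2] with y hy hy2
  have hd := hy2.mdifferentiableAt (by norm_num)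
  ext w
  change η (γ y) (fun i => mfderiv 𝓘(ℝ, W) I γ y (w i)) = _
  rw [← inChart_mfderiv_extChartAt η hy]
  change _ = (inChart η (γ y₀) _) (fun i => fderiv ℝ (fun y => extChartAt I (γ y₀) (γ y)) y (w i))
  congr 1; funext i
  exact (fderiv_extChartAt_comp hy hd (w i)).symm

theorem contDiffAt_extChartAt_comp {γ : W → M} {y₀ : W} (hγ : ContMDiffAt 𝓘(ℝ, W) I ∞ γ y₀) :
    ContDiffAt ℝ ∞ (fun y => extChartAt I (γ y₀) (γ y)) y₀ := by
  rw [← contMDiffAt_iff_contDiffAt]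
  exact (contMDiffAt_extChartAt).comp y₀ hγ

theorem pull_differentiableAt {k : ℕ} {η : DiffForm I M k} (hη : IsSmoothForm η) {γ : W → M} {y₀ : W}
    (hγ : ContMDiffAt 𝓘(ℝ, W) I ∞ γ y₀) : DifferentiableAt ℝ (pull η γ) y₀ := by
  refine DifferentiableAt.congr_of_eventuallyEq ?_ (pull_eventuallyEq η hγ)
  have hc := contDiffAt_extChartAt_comp hγ
  have h0 : DifferentiableAt ℝ (inChart η (γ y₀)) (extChartAt I (γ y₀) (γ y₀)) :=
    (inChart_contDiffAt hη (mem_extChartAt_target (γ y₀))).differentiableAt (by norm_num)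
  have h1 : DifferentiableAt ℝ (fun y => inChart η (γ y₀) (extChartAt I (γ y₀) (γ y))) y₀ :=
    DifferentiableAt.comp (g := inChart η (γ y₀)) y₀ h0 (hc.differentiableAt (by norm_num))
  have h2 := (hc.fderiv_right (m := ∞) (by norm_num)).differentiableAt (by norm_num)
  exact (h1.hasFDerivAt.continuousAlternatingMapCompContinuousLinearMap
    h2.hasFDerivAt).differentiableAt

/-- Naturality of `d`. As `extD` uses a different chart at each point, this is also what makes it
independent of charts. -/
theorem extDeriv_pull {k : ℕ} {η : DiffForm I M k} (hη : IsSmoothForm η) {γ : W → M} {y₀ : W}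
    (hγ : ContMDiffAt 𝓘(ℝ, W) I ∞ γ y₀) : extDeriv (pull η γ) y₀ = pull (extD η) γ y₀ := by
  have : IsManifold I 1 M := .of_le (n := ∞) (by norm_num)
  have hc := contDiffAt_extChartAt_comp hγ
  have h0 : DifferentiableAt ℝ (inChart η (γ y₀)) (extChartAt I (γ y₀) (γ y₀)) :=
    (inChart_contDiffAt hη (mem_extChartAt_target (γ y₀))).differentiableAt (by norm_num)
  rw [(pull_eventuallyEq η hγ).extDeriv_eq,
    extDeriv_pullback (f := fun y => extChartAt I (γ y₀) (γ y)) (r := ∞) h0 hc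
      (by rw [minSmoothness_of_isRCLikeNormedField]; exact ENat.LEInfty.out)]
  have hd := hγ.mdifferentiableAt (by norm_num)
  ext w
  change (extDeriv (inChart η (γ y₀)) (extChartAt I (γ y₀) (γ y₀)))
    (fun i => fderiv ℝ (fun y => extChartAt I (γ y₀) (γ y)) y₀ (w i)) =
    (extDeriv (inChart η (γ y₀)) (extChartAt I (γ y₀) (γ y₀)))
    (fun i => mfderiv I 𝓘(ℝ, V) (extChartAt I (γ y₀)) (γ y₀) (mfderiv 𝓘(ℝ, W) I γ y₀ (w i)))
  congr 1; funext i
  exact fderiv_extChartAt_comp (mem_extChartAt_source _) hd (w i)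

/-- Evaluation of a 1-form on tangent vectors. -/
def form1 (θ : DiffForm I M 1) (p : TangentBundle I M) : ℝ := θ p.1 (fun _ => p.2)

/-- Constant vector fields commute, so no bracket term appears. -/
theorem extDeriv_oneForm_apply {ϑ : W → W [⋀^Fin 1]→L[ℝ] ℝ} {y : W} (hϑ : DifferentiableAt ℝ ϑ y)
    (u w : W) : extDeriv ϑ y ![u, w] =
      fderiv ℝ (fun z => ϑ z (fun _ => w)) y u - fderiv ℝ (fun z => ϑ z (fun _ => u)) y w := by
  have e0 : (Fin.removeNth 0 ![u, w] : Fin 1 → W) = fun _ => w := by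
    funext i; fin_cases i; rfl
  have e1 : (Fin.removeNth 1 ![u, w] : Fin 1 → W) = fun _ => u := by
    funext i; fin_cases i; rfl
  rw [extDeriv_apply hϑ, Fin.sum_univ_two, e0, e1]
  simp [sub_eq_add_neg]

/-- The formula for `dθ` on the coordinate vectors of a parametrized surface. -/
theorem extD_apply_tangentMap {θ : DiffForm I M 1} (hθ : IsSmoothForm θ) {γ : W → M} {y₀ : W}
    (hγ : ContMDiffAt 𝓘(ℝ, W) I ∞ γ y₀) (u w : W) :
    extD θ (γ y₀) ![mfderiv 𝓘(ℝ, W) I γ y₀ u, mfderiv 𝓘(ℝ, W) I γ y₀ w] =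
      fderiv ℝ (fun y => form1 θ (tangentMap 𝓘(ℝ, W) I γ ⟨y, w⟩)) y₀ u -
      fderiv ℝ (fun y => form1 θ (tangentMap 𝓘(ℝ, W) I γ ⟨y, u⟩)) y₀ w := by
  have h := extDeriv_pull hθ hγ
  have h2 := extDeriv_oneForm_apply
    (pull_differentiableAt hθ hγ) u w
  rw [h] at h2
  refine Eq.trans ?_ h2
  change _ = extD θ (γ y₀) (fun i => mfderiv 𝓘(ℝ, W) I γ y₀ (![u, w] i))
  congr 1; funext i; fin_cases i <;> rfl

end Pullback

/-! ### Smooth dependence of integrals on parameters -/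

section ParametricIntegral

variable {F K : Type*} [NormedAddCommGroup F] [NormedSpace ℝ F] [TopologicalSpace K]
  [ChartedSpace F K] [IsManifold 𝓘(ℝ, F) ∞ K]
  {W : Type*} [NormedAddCommGroup W] [NormedSpace ℝ W]

theorem contMDiffOn_fderiv_snd {f : K × W → ℝ} {U : Set W} (hU : IsOpen U)
    (hf : ContMDiffOn (𝓘(ℝ, F).prod 𝓘(ℝ, W)) 𝓘(ℝ, ℝ) ∞ f (univ ×ˢ U)) :
    ContMDiffOn (𝓘(ℝ, F).prod 𝓘(ℝ, W)) 𝓘(ℝ, W →L[ℝ] ℝ) ∞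
      (fun p => fderiv ℝ (fun y => f (p.1, y)) p.2) (univ ×ˢ U) := by
  rintro ⟨k, y⟩ ⟨-, hy⟩
  have hnhds : (univ ×ˢ U : Set (K × W)) ∈ 𝓝 (k, y) :=
    (isOpen_univ.prod hU).mem_nhds ⟨mem_univ _, hy⟩
  have hfa : ContMDiffAt (𝓘(ℝ, F).prod 𝓘(ℝ, W)) 𝓘(ℝ, ℝ) ∞ f (k, y) :=
    hf.contMDiffAt hnhds
  have h2 : ContMDiffAt ((𝓘(ℝ, F).prod 𝓘(ℝ, W)).prod 𝓘(ℝ, W)) 𝓘(ℝ, ℝ) ∞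
      (Function.uncurry fun (p : K × W) (y : W) => f (p.1, y)) ((k, y), y) := by
    have hg : ContMDiffAt ((𝓘(ℝ, F).prod 𝓘(ℝ, W)).prod 𝓘(ℝ, W)) (𝓘(ℝ, F).prod 𝓘(ℝ, W)) ∞
        (fun q : (K × W) × W => (q.1.1, q.2)) ((k, y), y) :=
      (contMDiffAt_fst.comp _ contMDiffAt_fst).prodMk contMDiffAt_snd
    exact ContMDiffAt.comp ((k, y), y) (g := f) hfa hg
  have h3 := ContMDiffAt.mfderiv (x₀ := (k, y)) (fun (p : K × W) (y : W) => f (p.1, y))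
    (fun p => p.2) h2 (contMDiffAt_snd (n := ∞)) (m := ∞) (by norm_num)
  -- Between vector spaces the tangent coordinate changes are trivial, so the derivative in
  -- coordinates is `fderiv` itself.
  have e := inTangentCoordinates_model_space (I := 𝓘(ℝ, W)) (I' := 𝓘(ℝ, ℝ))
    (fun p : K × W => p.2) (fun p => f (p.1, p.2))
    (fun p => fderiv ℝ (fun y => f (p.1, y)) p.2) (k, y)
  have h4 := h3.contMDiffWithinAt (s := univ ×ˢ U)
  simp only [mfderiv_eq_fderiv] at h4
  exact e ▸ h4

variable [MeasurableSpace K] [BorelSpace K] [T2Space K] {μ : Measure K} {S : Set K}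

theorem hasFDerivAt_setIntegral [FiniteDimensional ℝ W] (hS : IsCompact S) (hμ : μ S < ⊤)
    {f : K × W → ℝ} {U : Set W} (hU : IsOpen U)
    (hf : ContMDiffOn (𝓘(ℝ, F).prod 𝓘(ℝ, W)) 𝓘(ℝ, ℝ) ∞ f (univ ×ˢ U)) {y : W} (hy : y ∈ U) :
    IntegrableOn (fun k => fderiv ℝ (fun y => f (k, y)) y) S μ ∧
    HasFDerivAt (fun y => ∫ k in S, f (k, y) ∂μ)
      (∫ k in S, fderiv ℝ (fun y => f (k, y)) y ∂μ) y := by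
  have hfin : IsFiniteMeasure (μ.restrict S) := ⟨by rwa [Measure.restrict_apply_univ]⟩
  have hD := contMDiffOn_fderiv_snd hU hf
  obtain ⟨ε, hε, hball⟩ := Metric.nhds_basis_closedBall.mem_iff.1 (hU.mem_nhds hy)
  have hcomp : IsCompact (S ×ˢ Metric.closedBall y ε) :=
    hS.prod (isCompact_closedBall y ε)
  have hc1 : ∀ z ∈ U, Continuous fun k => f (k, z) := fun z hz =>
    hf.continuousOn.comp_continuous (by fun_prop) fun k => ⟨mem_univ _, hz⟩
  have hc2 : ∀ z ∈ U, Continuous fun k => fderiv ℝ (fun y => f (k, y)) z := fun z hz =>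
    hD.continuousOn.comp_continuous (f := fun k => (k, z)) (by fun_prop)
      fun k => ⟨mem_univ _, hz⟩
  -- The partial derivative is continuous on the compact set `S × closedBall y ε`, so a constant
  -- serves as the dominating function.
  obtain ⟨b, hb⟩ := (hcomp.image_of_continuousOn (hD.continuousOn.mono
    (prod_mono (subset_univ _) hball)).norm).bddAbove
  have hb' : ∀ k ∈ S, ∀ z ∈ Metric.closedBall y ε, ‖fderiv ℝ (fun y => f (k, y)) z‖ ≤ b :=
    fun k hk z hz => hb ⟨(k, z), ⟨hk, hz⟩, rfl⟩
  have hi1 : IntegrableOn (fun k => f (k, y)) S μ :=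
    (hc1 y hy).continuousOn.integrableOn_of_subset_isCompact hS hS.measurableSet subset_rfl hμ.ne
  have hi2 : IntegrableOn (fun k => fderiv ℝ (fun y => f (k, y)) y) S μ :=
    (hc2 y hy).continuousOn.integrableOn_of_subset_isCompact hS hS.measurableSet subset_rfl hμ.ne
  refine ⟨hi2, ?_⟩
  refine hasFDerivAt_integral_of_dominated_of_fderiv_le (μ := μ.restrict S)
    (F := fun y k => f (k, y)) (F' := fun y k => fderiv ℝ (fun y => f (k, y)) y)
    (bound := fun _ => b)
    (Metric.ball_mem_nhds y hε) ?_ hi1 (hc2 y hy).aestronglyMeasurable ?_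
    (integrable_const b) ?_
  · filter_upwards [hU.mem_nhds hy] with z hz using (hc1 z hz).aestronglyMeasurable
  · exact ae_restrict_of_forall_mem hS.measurableSet fun k hk z hz =>
      hb' k hk z (Metric.ball_subset_closedBall hz)
  · refine Eventually.of_forall fun k z hz => ?_
    have hzU := hball (Metric.ball_subset_closedBall hz)
    have h1 : ContMDiffAt (𝓘(ℝ, F).prod 𝓘(ℝ, W)) 𝓘(ℝ, ℝ) ∞ f (k, z) :=
      hf.contMDiffAt ((isOpen_univ.prod hU).mem_nhds ⟨mem_univ _, hzU⟩)
    have h2 : ContMDiffAt 𝓘(ℝ, W) 𝓘(ℝ, ℝ) ∞ (fun y => f (k, y)) z :=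
      ContMDiffAt.comp z (g := f) h1 (contMDiffAt_const.prodMk contMDiffAt_id)
    exact (h2.contDiffAt.differentiableAt (by norm_num)).hasFDerivAt

/-- Induction on the order of differentiability: a directional derivative of the integral is an
integral of the same kind, with the partial derivative as integrand. -/
theorem contDiffOn_setIntegral [FiniteDimensional ℝ W] (hS : IsCompact S) (hμ : μ S < ⊤)
    {f : K × W → ℝ} {U : Set W} (hU : IsOpen U)
    (hf : ContMDiffOn (𝓘(ℝ, F).prod 𝓘(ℝ, W)) 𝓘(ℝ, ℝ) ∞ f (univ ×ˢ U)) :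
    ContDiffOn ℝ ∞ (fun y => ∫ k in S, f (k, y) ∂μ) U := by
  rw [contDiffOn_infty]
  intro n
  induction n generalizing f with
  | zero =>
    exact contDiffOn_zero.2 fun y hy =>
      (hasFDerivAt_setIntegral hS hμ hU hf hy).2.continuousAt.continuousWithinAt
  | succ n ih =>
    rw [Nat.cast_succ, contDiffOn_succ_iff_fderiv_apply hU.uniqueDiffOn]
    refine ⟨fun y hy => (hasFDerivAt_setIntegral hS hμ hU hf
      hy).2.differentiableAt.differentiableWithinAt, by simp, fun w => ?_⟩
    have hD : ContMDiffOn (𝓘(ℝ, F).prod 𝓘(ℝ, W)) 𝓘(ℝ, ℝ) ∞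
        (fun p => fderiv ℝ (fun y => f (p.1, y)) p.2 w) (univ ×ˢ U) :=
      (contMDiffOn_fderiv_snd hU hf).clm_apply contMDiffOn_const
    refine (ih hD).congr fun y hy => ?_
    have h := hasFDerivAt_setIntegral hS hμ hU hf hy
    rw [fderivWithin_of_isOpen hU hy, h.2.fderiv, ContinuousLinearMap.integral_apply h.1]

theorem contMDiff_setIntegral {V H : Type*} [NormedAddCommGroup V] [NormedSpace ℝ V]
    [FiniteDimensional ℝ V] [TopologicalSpace H] {I : ModelWithCorners ℝ V H} [I.Boundaryless]
    {M : Type*} [TopologicalSpace M] [ChartedSpace H M] [IsManifold I ∞ M]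
    (hS : IsCompact S) (hμ : μ S < ⊤) {f : K × M → ℝ}
    (hf : ContMDiff (𝓘(ℝ, F).prod I) 𝓘(ℝ, ℝ) ∞ f) :
    ContMDiff I 𝓘(ℝ, ℝ) ∞ (fun x => ∫ k in S, f (k, x) ∂μ) := by
  intro x
  set e := extChartAt I x
  have ht : IsOpen e.target := isOpen_extChartAt_target x
  have h1 : ContMDiffOn (𝓘(ℝ, F).prod 𝓘(ℝ, V)) 𝓘(ℝ, ℝ) ∞ (fun p : K × V => f (p.1, e.symm p.2))
      (univ ×ˢ e.target) := by
    refine hf.comp_contMDiffOn (contMDiffOn_fst.prodMk ?_)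
    exact (contMDiffOn_extChartAt_symm x).comp contMDiffOn_snd fun p hp => hp.2
  have h2 := contDiffOn_setIntegral hS hμ ht h1
  have h3 : ContMDiffAt 𝓘(ℝ, V) 𝓘(ℝ, ℝ) ∞ (fun y => ∫ k in S, f (k, e.symm y) ∂μ) (e x) :=
    (h2.contDiffAt (ht.mem_nhds (mem_extChartAt_target x))).contMDiffAt
  have h4 := ContMDiffAt.comp x h3 (contMDiffAt_extChartAt (I := I) (n := ∞))
  refine h4.congr_of_eventuallyEq ?_
  filter_upwards [extChartAt_source_mem_nhds (I := I) x] with z hz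
  simp only [Function.comp, e, (extChartAt I x).left_inv hz]

end ParametricIntegral

/-! ### Smoothness of tangent maps -/

section TangentMaps

variable {V H : Type*} [NormedAddCommGroup V] [NormedSpace ℝ V] [TopologicalSpace H]
  {I : ModelWithCorners ℝ V H}
  {M : Type*} [TopologicalSpace M] [ChartedSpace H M] [IsManifold I ∞ M]
  {V' H' : Type*} [NormedAddCommGroup V'] [NormedSpace ℝ V'] [TopologicalSpace H']
  {I' : ModelWithCorners ℝ V' H'}
  {M' : Type*} [TopologicalSpace M'] [ChartedSpace H' M'] [IsManifold I' ∞ M']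

theorem contMDiffOn_tangentMap {f : M → M'} {s : Set M} (hs : IsOpen s)
    (hf : ContMDiffOn I I' ∞ f s) :
    ContMDiffOn I.tangent I'.tangent ∞ (tangentMap I I' f) (π V (TangentSpace I) ⁻¹' s) := by
  refine (hf.contMDiffOn_tangentMapWithin (m := ∞) (by norm_num) hs.uniqueMDiffOn).congr
    fun p hp => ?_
  simp only [tangentMap, tangentMapWithin, mfderivWithin_of_isOpen hs hp]

theorem contMDiff_tangentMap {f : M → M'} (hf : ContMDiff I I' ∞ f) :
    ContMDiff I.tangent I'.tangent ∞ (tangentMap I I' f) :=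
  hf.contMDiff_tangentMap (by norm_num)

variable {V₁ H₁ : Type*} [NormedAddCommGroup V₁] [NormedSpace ℝ V₁] [TopologicalSpace H₁]
  {I₁ : ModelWithCorners ℝ V₁ H₁} {N : Type*} [TopologicalSpace N] [ChartedSpace H₁ N]

theorem contMDiffOn_tangentBundleProd {a : N → TangentBundle I M} {b : N → TangentBundle I' M'}
    {s : Set N} (ha : ContMDiffOn I₁ I.tangent ∞ a s) (hb : ContMDiffOn I₁ I'.tangent ∞ b s) :
    ContMDiffOn I₁ (I.prod I').tangent ∞
      (fun n => (⟨((a n).1, (b n).1), ((a n).2, (b n).2)⟩ : TangentBundle (I.prod I') (M × M'))) s :=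
  (contMDiff_equivTangentBundleProd_symm (I := I) (I' := I') (M := M) (M' := M')).comp_contMDiffOn
    (ha.prodMk hb)

theorem contMDiff_constField {W : Type*} [NormedAddCommGroup W] [NormedSpace ℝ W] (w : W) :
    ContMDiff 𝓘(ℝ, W) 𝓘(ℝ, W).tangent ∞ (fun y => (⟨y, w⟩ : TangentBundle 𝓘(ℝ, W) W)) :=
  contMDiff_vectorSpace_iff_contDiff.2 contDiff_const

end TangentMaps

/-! ### One-forms as smooth functions on the tangent bundle -/

section OneForms

variable {V H : Type*} [NormedAddCommGroup V] [NormedSpace ℂ V] [TopologicalSpace H]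
  {I : ModelWithCorners ℝ V H} [I.Boundaryless]
  {M : Type*} [TopologicalSpace M] [ChartedSpace H M] [IsManifold I ∞ M]

/-- In a chart, `form1 θ` pairs the coefficient covector with the coordinates of the tangent vector,
and both are smooth. Smoothness of expressions in `θ` is thereby reduced to composition of smooth
maps. -/
theorem form1_contMDiff {θ : DiffForm I M 1} (hθ : IsSmoothForm θ) :
    ContMDiff I.tangent 𝓘(ℝ, ℝ) ∞ (form1 θ) := by
  intro p₀
  set x₀ := p₀.1
  set e := extChartAt I x₀
  have hs : IsOpen e.source := isOpen_extChartAt_source x₀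
  have he : ContMDiffOn I 𝓘(ℝ, V) ∞ e e.source := by
    have := contMDiffOn_extChartAt (I := I) (n := ∞) (x := x₀)
    rwa [← extChartAt_source (I := I)] at this
  have hpre : (π V (TangentSpace I) ⁻¹' e.source) ∈ 𝓝 p₀ :=
    (hs.preimage (FiberBundle.continuous_proj V (TangentSpace I))).mem_nhds
      (mem_extChartAt_source (I := I) x₀)
  have h1 : ContMDiffAt I.tangent 𝓘(ℝ, V) ∞ (fun p => (tangentMap I 𝓘(ℝ, V) e p).2) p₀ :=
    (contMDiff_snd_tangentBundle_modelSpace V 𝓘(ℝ, V)).contMDiffAt.comp p₀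
      ((contMDiffOn_tangentMap hs he).contMDiffAt hpre)
  have h2 : ContMDiffAt I.tangent 𝓘(ℝ, V →L[ℝ] ℝ) ∞
      (fun p => (ContinuousAlternatingMap.ofSubsingletonLIE (𝕜 := ℝ) (E := V) (F := ℝ)
        (0 : Fin 1)).symm (inChart θ x₀ (e p.1))) p₀ := by
    have hc := inChart_contDiffAt hθ (mem_extChartAt_target (I := I) x₀)
    have hb : ContMDiffAt I.tangent 𝓘(ℝ, V) ∞ (fun p : TangentBundle I M => e p.1) p₀ :=
      (contMDiffAt_extChartAt (I := I) (n := ∞) (x := x₀)).comp p₀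
        (contMDiff_proj (TangentSpace I)).contMDiffAt
    have h3 := ((ContinuousAlternatingMap.ofSubsingletonLIE (𝕜 := ℝ) (E := V) (F := ℝ)
        (0 : Fin 1)).symm.contDiff.contDiffAt.comp (e x₀) hc).contMDiffAt
    exact ContMDiffAt.comp (g := fun y => (ContinuousAlternatingMap.ofSubsingletonLIE (𝕜 := ℝ)
      (E := V) (F := ℝ) (0 : Fin 1)).symm (inChart θ x₀ y)) p₀ h3 hb
  refine (h2.clm_apply h1).congr_of_eventuallyEq ?_
  filter_upwards [hpre] with p hp
  exact (inChart_mfderiv_extChartAt θ hp (fun _ => p.2)).symm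

theorem form1_tangentMap_symm (θ : DiffForm I M 1) (x : M) (y w : V) :
    form1 θ (tangentMap 𝓘(ℝ, V) I (extChartAt I x).symm ⟨y, w⟩) = inChart θ x y (fun _ => w) :=
  rfl

/-- In finite dimension a covector-valued function is smooth once its value on each constant vector
is. -/
theorem isSmoothForm_of_form1 [FiniteDimensional ℝ V] {θ : DiffForm I M 1}
    (hθ : ContMDiff I.tangent 𝓘(ℝ, ℝ) ∞ (form1 θ)) : IsSmoothForm θ := by
  intro x
  set e := extChartAt I x
  have ht : IsOpen e.target := isOpen_extChartAt_target x
  have h : ContDiffOn ℝ ∞ (fun y => (ContinuousAlternatingMap.ofSubsingletonLIE (𝕜 := ℝ) (E := V)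
      (F := ℝ) (0 : Fin 1)).symm (inChart θ x y)) e.target := by
    rw [contDiffOn_clm_apply]
    intro w
    have h1 := (contMDiffOn_tangentMap ht (contMDiffOn_extChartAt_symm (I := I) (n := ∞) x)).comp
      (contMDiff_constField w).contMDiffOn (s := e.target) (fun y hy => hy)
    exact (hθ.comp_contMDiffOn h1).contDiffOn
  have h2 := (ContinuousAlternatingMap.ofSubsingletonLIE (𝕜 := ℝ) (E := V)
      (F := ℝ) (0 : Fin 1)).contDiff.comp_contDiffOn h
  refine h2.congr fun y _ => ?_
  simp

/-- The averaged form is built as a function on the tangent bundle; this recovers the form. -/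
theorem exists_form_of_contMDiff [FiniteDimensional ℝ V] {φ : TangentBundle I M → ℝ}
    (hφ : ContMDiff I.tangent 𝓘(ℝ, ℝ) ∞ φ)
    (hadd : ∀ (x : M) (v w : TangentSpace I x), φ ⟨x, v + w⟩ = φ ⟨x, v⟩ + φ ⟨x, w⟩)
    (hsmul : ∀ (x : M) (c : ℝ) (v : TangentSpace I x), φ ⟨x, c • v⟩ = c * φ ⟨x, v⟩) :
    ∃ θ : DiffForm I M 1, IsSmoothForm θ ∧ ∀ p, form1 θ p = φ p := by
  let l (x : M) : V →ₗ[ℝ] ℝ :=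
    { toFun := fun v => φ ⟨x, v⟩
      map_add' := hadd x
      map_smul' := hsmul x }
  let θ : DiffForm I M 1 := fun x =>
    (ContinuousAlternatingMap.ofSubsingleton ℝ V ℝ (0 : Fin 1)
      (LinearMap.toContinuousLinearMap (l x)) : V [⋀^Fin 1]→L[ℝ] ℝ)
  have h : form1 θ = φ := rfl
  exact ⟨θ, isSmoothForm_of_form1 (h ▸ hφ), fun p => rfl⟩

/-- One chart computes `d` on its whole target, not only at its centre. -/
theorem inChart_extD {k : ℕ} {η : DiffForm I M k} (hη : IsSmoothForm η) {x : M} {y : V}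
    (hy : y ∈ (extChartAt I x).target) :
    inChart (extD η) x y = extDeriv (inChart η x) y :=
  (extDeriv_pull hη ((contMDiffOn_extChartAt_symm (I := I) (n := ∞) x).contMDiffAt
    ((isOpen_extChartAt_target x).mem_nhds hy))).symm

theorem form_eq_of_inChart {k : ℕ} {η η' : DiffForm I M k} {x : M}
    (h : inChart η x (extChartAt I x x) = inChart η' x (extChartAt I x x)) : η x = η' x := by
  ext v
  rw [← inChart_mfderiv_extChartAt η (mem_extChartAt_source x), h,
    inChart_mfderiv_extChartAt η' (mem_extChartAt_source x)]

theorem twoForm_ext {W : Type*} [NormedAddCommGroup W] [NormedSpace ℝ W]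
    {a b : W [⋀^Fin 2]→L[ℝ] ℝ} (h : ∀ u w, a ![u, w] = b ![u, w]) : a = b := by
  ext v
  have : v = ![v 0, v 1] := by funext i; fin_cases i <;> rfl
  rw [this, h]

end OneForms

/-! ### Fibrewise linearity and invariance of one-forms -/

section Linearity

variable {V H : Type*} [NormedAddCommGroup V] [NormedSpace ℂ V] [TopologicalSpace H]
  {I : ModelWithCorners ℝ V H} {M : Type*} [TopologicalSpace M] [ChartedSpace H M]

theorem form1_add (θ : DiffForm I M 1) (x : M) (v w : TangentSpace I x) :
    form1 θ ⟨x, v + w⟩ = form1 θ ⟨x, v⟩ + form1 θ ⟨x, w⟩ :=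
  ((ContinuousAlternatingMap.ofSubsingleton ℝ (TangentSpace I x) ℝ (0 : Fin 1)).symm
    (θ x)).map_add v w

theorem form1_smul (θ : DiffForm I M 1) (x : M) (c : ℝ) (v : TangentSpace I x) :
    form1 θ ⟨x, c • v⟩ = c * form1 θ ⟨x, v⟩ :=
  ((ContinuousAlternatingMap.ofSubsingleton ℝ (TangentSpace I x) ℝ (0 : Fin 1)).symm
    (θ x)).map_smul c v

theorem isInvariantForm_iff {G : Type*} [SMul G M] (θ : DiffForm I M 1) : IsInvariantForm G θ ↔
    ∀ (g : G) (p : TangentBundle I M), form1 θ (tangentMap I I (fun x : M => g • x) p) =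
      form1 θ p := by
  constructor
  · intro h g p
    exact DFunLike.congr_fun (h g p.1) (fun _ => p.2)
  · intro h g x
    ext v
    have : v = fun _ => v 0 := by funext i; fin_cases i; rfl
    rw [this]
    exact h g ⟨x, v 0⟩

end Linearity

/-! ### Smooth actions and averaging over the group -/

section Actions

variable {F : Type*} [NormedAddCommGroup F] [NormedSpace ℝ F]
  {G : Type*} [TopologicalSpace G] [ChartedSpace F G] [Group G] [LieGroup 𝓘(ℝ, F) ∞ G]
  {V H : Type*} [NormedAddCommGroup V] [NormedSpace ℂ V] [TopologicalSpace H]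
  {I : ModelWithCorners ℝ V H} [I.Boundaryless]
  {M : Type*} [TopologicalSpace M] [ChartedSpace H M] [IsManifold I ∞ M] [MulAction G M]

theorem contMDiff_smul_left
    (hact : ContMDiff (𝓘(ℝ, F).prod I) I ∞ (fun a : G × M => a.1 • a.2)) (g : G) :
    ContMDiff I I ∞ (fun x : M => g • x) :=
  hact.comp (contMDiff_const.prodMk contMDiff_id)

theorem contMDiff_orbit
    (hact : ContMDiff (𝓘(ℝ, F).prod I) I ∞ (fun a : G × M => a.1 • a.2)) (x : M) :
    ContMDiff 𝓘(ℝ, F) I ∞ (fun g : G => g • x) :=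
  hact.comp (contMDiff_id.prodMk contMDiff_const)

theorem tangentMap_act
    (hact : ContMDiff (𝓘(ℝ, F).prod I) I ∞ (fun a : G × M => a.1 • a.2)) (g : G) (x : M)
    (A : TangentSpace 𝓘(ℝ, F) g) (v : TangentSpace I x) :
    tangentMap (𝓘(ℝ, F).prod I) I (fun a : G × M => a.1 • a.2) ⟨(g, x), (A, v)⟩ =
      ⟨g • x, mfderiv 𝓘(ℝ, F) I (fun g : G => g • x) g A + mfderiv I I (fun x : M => g • x) x v⟩ := by
  have h := mfderiv_prod_eq_add_apply (p := (g, x)) (v := ((A, v) : F × V))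
    (hact.mdifferentiableAt (by norm_num) (x := (g, x)))
  exact congrArg (fun w => (⟨g • x, w⟩ : TangentBundle I M)) h

theorem tangentMap_smul_comp
    (hact : ContMDiff (𝓘(ℝ, F).prod I) I ∞ (fun a : G × M => a.1 • a.2)) (g g' : G)
    (p : TangentBundle I M) :
    tangentMap I I (fun x : M => g • x) (tangentMap I I (fun x : M => g' • x) p) =
      tangentMap I I (fun x : M => (g * g') • x) p := by
  have h1 := (contMDiff_smul_left hact g).mdifferentiable (by norm_num)
  have h2 := (contMDiff_smul_left hact g').mdifferentiable (by norm_num)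
  have := tangentMap_comp_at p (h1 _) (h2 _)
  rw [← this]
  congr 1
  funext x
  exact (mul_smul g g' x).symm

/-- The induced action on the tangent bundle is the tangent map of `G × M → M` restricted to zero
vectors on `G`. -/
theorem contMDiff_tangentMap_smul
    (hact : ContMDiff (𝓘(ℝ, F).prod I) I ∞ (fun a : G × M => a.1 • a.2)) :
    ContMDiff (𝓘(ℝ, F).prod I.tangent) I.tangent ∞
      (fun a : G × TangentBundle I M => tangentMap I I (fun x : M => a.1 • x) a.2) := by
  have h0 : ContMDiff (𝓘(ℝ, F).prod I.tangent) 𝓘(ℝ, F).tangent ∞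
      (fun a : G × TangentBundle I M => (⟨a.1, 0⟩ : TangentBundle 𝓘(ℝ, F) G)) :=
    (contMDiff_zeroSection ℝ (TangentSpace 𝓘(ℝ, F) (M := G))).comp contMDiff_fst
  have h1 := contMDiffOn_tangentBundleProd (s := univ) h0.contMDiffOn
    (contMDiff_snd (I := 𝓘(ℝ, F)) (J := I.tangent) (M := G) (N := TangentBundle I M)).contMDiffOn
  have h2 := (contMDiff_tangentMap hact).comp (contMDiffOn_univ.1 h1)
  refine h2.congr fun a => ?_
  have h3 := tangentMap_act hact a.1 a.2.1 0 a.2.2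
  refine Eq.trans ?_ h3.symm
  refine congrArg (fun w => (⟨a.1 • a.2.1, w⟩ : TangentBundle I M)) ?_
  simp

/-- The Haar average of the translates of `θ` is invariant. Since `d` passes under the integral and
every translate has the same differential, the average is again a primitive. -/
theorem exists_invariant_primitive [CompactSpace G] [T2Space G] [FiniteDimensional ℝ F]
    [FiniteDimensional ℝ V]
    (hact : ContMDiff (𝓘(ℝ, F).prod I) I ∞ (fun a : G × M => a.1 • a.2))
    {θ : DiffForm I M 1} (hθ : IsSmoothForm θ) (hinv : IsInvariantForm G (extD θ)) :
    ∃ θ' : DiffForm I M 1, IsSmoothForm θ' ∧ IsInvariantForm G θ' ∧ extD θ' = extD θ := by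
  have : IsManifold I 1 M := .of_le (n := ∞) (by norm_num)
  have : IsTopologicalGroup G := topologicalGroup_of_lieGroup 𝓘(ℝ, F) ∞
  let _ : MeasurableSpace G := borel G
  have : BorelSpace G := ⟨rfl⟩
  let μ : Measure G := Measure.haarMeasure ⊤
  have hμ1 : μ univ = 1 := Measure.haarMeasure_self (K₀ := ⊤)
  have hμ : μ univ < ⊤ := hμ1 ▸ ENNReal.one_lt_top
  have : IsProbabilityMeasure μ := ⟨hμ1⟩
  -- Translating by `h⁻¹` lets left invariance of the measure give invariance of the average,
  -- through the substitution `h ↦ g * h`.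
  let f : G × TangentBundle I M → ℝ := fun a =>
    form1 θ (tangentMap I I (fun x : M => a.1⁻¹ • x) a.2)
  have hf : ContMDiff (𝓘(ℝ, F).prod I.tangent) 𝓘(ℝ, ℝ) ∞ f :=
    (form1_contMDiff hθ).comp ((contMDiff_tangentMap_smul hact).comp
      (((contMDiff_inv 𝓘(ℝ, F) ∞).comp contMDiff_fst).prodMk contMDiff_snd))
  have hint : ∀ p, Integrable (fun h => f (h, p)) μ := fun p =>
    (hf.continuous.comp (by fun_prop : Continuous fun h : G => (h, p))).integrable_of_hasCompactSupport
      (HasCompactSupport.of_compactSpace _)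
  have hφ : ContMDiff I.tangent 𝓘(ℝ, ℝ) ∞ (fun p => ∫ h in univ, f (h, p) ∂μ) :=
    contMDiff_setIntegral isCompact_univ hμ hf
  simp only [Measure.restrict_univ] at hφ
  obtain ⟨θ', hθ', hval⟩ := exists_form_of_contMDiff hφ
    (fun x v w => by
      rw [← integral_add (hint _) (hint _)]
      refine integral_congr_ae (Eventually.of_forall fun h => ?_)
      refine Eq.trans ?_ (form1_add θ _ _ _)
      exact congrArg (fun w => form1 θ ⟨h⁻¹ • x, w⟩) (map_add _ v w))
    (fun x c v => by
      rw [← integral_const_mul]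
      refine integral_congr_ae (Eventually.of_forall fun h => ?_)
      refine Eq.trans ?_ (form1_smul θ _ _ _)
      exact congrArg (fun w => form1 θ ⟨h⁻¹ • x, w⟩) (map_smul _ c v))
  refine ⟨θ', hθ', ?_, ?_⟩
  · rw [isInvariantForm_iff]
    intro g p
    rw [hval, hval, ← integral_mul_left_eq_self _ g]
    refine integral_congr_ae (Eventually.of_forall fun h => ?_)
    simp only [f]
    rw [tangentMap_smul_comp hact]
    simp
  · funext x
    refine form_eq_of_inChart ?_
    set e := extChartAt I x
    have hy : e x ∈ e.target := mem_extChartAt_target x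
    have ht : IsOpen e.target := isOpen_extChartAt_target x
    have hsymm := contMDiffOn_extChartAt_symm (I := I) (n := ∞) x
    rw [inChart_extD hθ' hy]
    refine twoForm_ext fun u w => ?_
    rw [extDeriv_oneForm_apply ((inChart_contDiffAt hθ' hy).differentiableAt (by norm_num))]
    have hfw : ∀ w : V, ContMDiffOn (𝓘(ℝ, F).prod 𝓘(ℝ, V)) 𝓘(ℝ, ℝ) ∞
        (fun a : G × V => f (a.1, tangentMap 𝓘(ℝ, V) I e.symm ⟨a.2, w⟩)) (univ ×ˢ e.target) := by
      intro w
      refine hf.comp_contMDiffOn (contMDiffOn_fst.prodMk ?_)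
      exact ((contMDiffOn_tangentMap ht hsymm).comp (contMDiff_constField w).contMDiffOn
        (s := e.target) (fun y hy => hy)).comp contMDiffOn_snd (fun a ha => ha.2)
    have hder : ∀ u w : V, Integrable (fun h => fderiv ℝ
          (fun y => f (h, tangentMap 𝓘(ℝ, V) I e.symm ⟨y, w⟩)) (e x) u) μ ∧
        fderiv ℝ (fun z => inChart θ' x z (fun _ => w)) (e x) u =
        ∫ h, fderiv ℝ (fun y => f (h, tangentMap 𝓘(ℝ, V) I e.symm ⟨y, w⟩)) (e x) u ∂μ := by
      intro u w
      obtain ⟨h1, h2⟩ := hasFDerivAt_setIntegral isCompact_univ hμ ht (hfw w) hy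
      have h3 : (fun z => inChart θ' x z (fun _ => w)) = fun z =>
          ∫ h in univ, f (h, tangentMap 𝓘(ℝ, V) I e.symm ⟨z, w⟩) ∂μ := by
        funext z
        rw [← form1_tangentMap_symm, hval, Measure.restrict_univ]
      rw [IntegrableOn, Measure.restrict_univ] at h1
      refine ⟨h1.apply_continuousLinearMap u, ?_⟩
      rw [h3, h2.fderiv, Measure.restrict_univ, ContinuousLinearMap.integral_apply h1]
    rw [(hder u w).2, (hder w u).2, ← integral_sub (hder u w).1 (hder w u).1]
    -- The integrand is the translate of `dθ` by `h⁻¹`, which by invariance does not depend on `h`;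
    -- the total mass is `1`.
    have hconst : ∀ h : G, fderiv ℝ (fun y => f (h, tangentMap 𝓘(ℝ, V) I e.symm ⟨y, w⟩)) (e x) u -
        fderiv ℝ (fun y => f (h, tangentMap 𝓘(ℝ, V) I e.symm ⟨y, u⟩)) (e x) w =
        inChart (extD θ) x (e x) ![u, w] := by
      intro h
      have hγ : ContMDiffAt 𝓘(ℝ, V) I ∞ (fun y => h⁻¹ • e.symm y) (e x) :=
        (contMDiff_smul_left hact h⁻¹).contMDiffAt.comp (e x)
          (hsymm.contMDiffAt (ht.mem_nhds hy))
      have hd : ∀ y ∈ e.target, MDifferentiableAt 𝓘(ℝ, V) I e.symm y := fun y hy =>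
        mdifferentiableAt_extChartAt_symm hy
      have hdg := (contMDiff_smul_left hact h⁻¹).mdifferentiable (by norm_num)
      have hfeq : ∀ w : V, (fun y => f (h, tangentMap 𝓘(ℝ, V) I e.symm ⟨y, w⟩)) =ᶠ[𝓝 (e x)]
          fun y => form1 θ (tangentMap 𝓘(ℝ, V) I (fun y => h⁻¹ • e.symm y) ⟨y, w⟩) := by
        intro w
        filter_upwards [ht.mem_nhds hy] with y hy'
        exact congrArg (form1 θ) (tangentMap_comp_at (I' := I) (⟨y, w⟩ : TangentBundle 𝓘(ℝ, V) V)
          (hdg _) (hd y hy')).symm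
      rw [(hfeq w).fderiv_eq, (hfeq u).fderiv_eq, ← extD_apply_tangentMap hθ hγ]
      have hc : ∀ w : V, mfderiv 𝓘(ℝ, V) I (fun y => h⁻¹ • e.symm y) (e x) w =
          mfderiv I I (fun x : M => h⁻¹ • x) (e.symm (e x))
            (mfderiv 𝓘(ℝ, V) I e.symm (e x) w) := fun w =>
        mfderiv_comp_apply (I' := I) (e x) (hdg _) (hd _ hy) w
      have := DFunLike.congr_fun (hinv h⁻¹ (e.symm (e x)))
        (fun i => mfderiv 𝓘(ℝ, V) I e.symm (e x) (![u, w] i))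
      refine Eq.trans ?_ this
      change _ = extD θ (h⁻¹ • e.symm (e x)) (fun i => mfderiv I I (fun x : M => h⁻¹ • x)
        (e.symm (e x)) (mfderiv 𝓘(ℝ, V) I e.symm (e x) (![u, w] i)))
      congr 1
      funext i
      fin_cases i
      · exact hc u
      · exact hc w
    simp only [hconst, integral_const, probReal_univ, one_smul]

end Actions

/-! ### The complex structure and the operators `d^c` and `dd^c` -/

section ComplexStructure

variable {V H : Type*} [NormedAddCommGroup V] [NormedSpace ℂ V] [TopologicalSpace H]
  {IC : ModelWithCorners ℂ V H} {I : ModelWithCorners ℝ V H}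
  {M : Type*} [TopologicalSpace M] [ChartedSpace H M]
  {V' H' : Type*} [NormedAddCommGroup V'] [NormedSpace ℂ V'] [TopologicalSpace H']
  {IC' : ModelWithCorners ℂ V' H'} {I' : ModelWithCorners ℝ V' H'}
  {M' : Type*} [TopologicalSpace M'] [ChartedSpace H' M']

theorem extChartAt_complex_eq (h : (IC : H → V) = I) (hs : (IC.symm : V → H) = I.symm) (x : M) :
    (extChartAt IC x : M → V) = extChartAt I x ∧
    ((extChartAt IC x).symm : V → M) = (extChartAt I x).symm := by
  constructor
  · funext z; simp [extChartAt, h]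
  · funext z; simp [extChartAt, hs]

/-- The real derivative of a complex differentiable map commutes with the complex structures. -/
theorem mfderiv_J (h : (IC : H → V) = I) (hs : (IC.symm : V → H) = I.symm)
    (h' : (IC' : H' → V') = I') (hs' : (IC'.symm : V' → H') = I'.symm)
    {f : M → M'} {x : M} (hf : MDifferentiableAt IC IC' f x) (v : TangentSpace I x) :
    MDifferentiableAt I I' f x ∧
    mfderiv I I' f x (J I x v) = J I' (f x) (mfderiv I I' f x v) := by
  have hw : writtenInExtChartAt IC IC' x f = writtenInExtChartAt I I' x f := by
    simp only [writtenInExtChartAt, (extChartAt_complex_eq h hs x).2,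
      (extChartAt_complex_eq h' hs' (f x)).1]
  have hr : range IC = range I := by rw [h]
  have hd := hf.differentiableWithinAt_writtenInExtChartAt
  rw [hw, hr, (extChartAt_complex_eq h hs x).1] at hd
  have hIx : UniqueDiffWithinAt ℝ (range I) (extChartAt I x x) := I.uniqueDiffWithinAt_image
  have hdR : MDifferentiableAt I I' f x := by
    rw [mdifferentiableAt_iff]
    exact ⟨hf.continuousAt, hd.restrictScalars ℝ⟩
  refine ⟨hdR, ?_⟩
  have he : mfderiv I I' f x =
      ((fderivWithin ℂ (writtenInExtChartAt I I' x f) (range I) (extChartAt I x x)).restrictScalars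
        ℝ : V →L[ℝ] V') := by
    rw [hdR.mfderiv]
    exact (hd.hasFDerivWithinAt.restrictScalars ℝ).fderivWithin hIx
  rw [he]
  exact (fderivWithin ℂ (writtenInExtChartAt I I' x f) (range I) (extChartAt I x x)).map_smul
    Complex.I v

variable [I.Boundaryless] [IsManifold I ∞ M]

theorem form1_dc (Φ : M → ℝ) (x : M) (v : TangentSpace I x) :
    form1 (dc I Φ) ⟨x, v⟩ = -(mfderiv I 𝓘(ℝ, ℝ) Φ x (J I x v) : ℝ) := rfl

/-- The inverse chart is holomorphic, so its derivative intertwines `J` with multiplication by `i`;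
in coordinates `d^c Φ = -dφ ∘ i`. -/
theorem inChart_dc (h : (IC : H → V) = I) (hs : (IC.symm : V → H) = I.symm) [IsManifold IC 1 M]
    {Φ : M → ℝ} (hΦ : ContMDiff I 𝓘(ℝ, ℝ) ∞ Φ) {x : M} {y : V} (hy : y ∈ (extChartAt I x).target) :
    inChart (dc I Φ) x y = ContinuousAlternatingMap.ofSubsingletonLIE (𝕜 := ℝ) (E := V)
      (F := ℝ) (0 : Fin 1) (-((fderiv ℝ (Φ ∘ (extChartAt I x).symm) y).comp
        (Complex.I • ContinuousLinearMap.id ℝ V))) := by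
  have : IsManifold I 1 M := .of_le (n := ∞) (by norm_num)
  have hyC : y ∈ (extChartAt IC x).target := by
    have : (extChartAt IC x).target = (extChartAt I x).target := by
      simp [extChartAt, h, hs, PartialEquiv.trans_target, ModelWithCorners.target_eq]
    rwa [this]
  have hCd : MDifferentiableAt 𝓘(ℂ, V) IC (extChartAt I x).symm y := by
    have h1 := mdifferentiableWithinAt_extChartAt_symm hyC
    rw [h, I.range_eq_univ, mdifferentiableWithinAt_univ, (extChartAt_complex_eq h hs x).2] at h1
    exact h1
  ext w
  set u : V := w 0 with hu
  have hw : w = fun _ => u := by funext i; fin_cases i; rfl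
  rw [hw, ← form1_tangentMap_symm]
  obtain ⟨hd, hJ⟩ := mfderiv_J (I := 𝓘(ℝ, V)) (I' := I) rfl rfl h hs hCd u
  have hΦd := (hΦ.mdifferentiable (by norm_num)) ((extChartAt I x).symm y)
  refine Eq.trans (form1_dc Φ _ _) ?_
  have hcomp := mfderiv_comp_apply y hΦd hd (J 𝓘(ℝ, V) y u)
  rw [hJ] at hcomp
  refine congrArg Neg.neg (hcomp.symm.trans ?_)
  exact DFunLike.congr_fun mfderiv_eq_fderiv _

theorem contDiffOn_comp_symm {Φ : M → ℝ} (hΦ : ContMDiff I 𝓘(ℝ, ℝ) ∞ Φ) (x : M) :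
    ContDiffOn ℝ ∞ (Φ ∘ (extChartAt I x).symm) (extChartAt I x).target :=
  (hΦ.comp_contMDiffOn (contMDiffOn_extChartAt_symm x)).contDiffOn

theorem isSmoothForm_dc (h : (IC : H → V) = I) (hs : (IC.symm : V → H) = I.symm)
    [IsManifold IC 1 M] {Φ : M → ℝ} (hΦ : ContMDiff I 𝓘(ℝ, ℝ) ∞ Φ) : IsSmoothForm (dc I Φ) := by
  intro x
  have ht : IsOpen (extChartAt I x).target := isOpen_extChartAt_target x
  refine ContDiffOn.congr ?_ fun y hy => inChart_dc h hs hΦ hy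
  refine (ContinuousAlternatingMap.ofSubsingletonLIE (𝕜 := ℝ) (E := V) (F := ℝ)
    (0 : Fin 1)).contDiff.comp_contDiffOn ?_
  exact (((contDiffOn_comp_symm hΦ x).fderiv_of_isOpen ht (m := ∞) (by norm_num)).clm_comp
    contDiffOn_const).neg

theorem extD_apply {k : ℕ} (η : DiffForm I M k) (x : M) (v : Fin (k + 1) → TangentSpace I x) :
    extD η x v = extDeriv (inChart η x) (extChartAt I x x) v := by
  have : IsManifold I 1 M := .of_le (n := ∞) (by norm_num)
  change extDeriv (inChart η x) (extChartAt I x x)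
    (fun i => mfderiv I 𝓘(ℝ, V) (extChartAt I x) x (v i)) = _
  congr 1
  funext i
  exact mfderiv_extChartAt_self_apply (v i)

/-- In a chart `dd^c φ(u, w) = D²φ(w, iu) - D²φ(u, iw)`. By symmetry of `D²φ` this is unchanged
under `(u, w) ↦ (iu, iw)`. -/
theorem isOneOne_ddc (h : (IC : H → V) = I) (hs : (IC.symm : V → H) = I.symm)
    [IsManifold IC 1 M] {Φ : M → ℝ} (hΦ : ContMDiff I 𝓘(ℝ, ℝ) ∞ Φ) : IsOneOne (ddc I Φ) := by
  intro x
  have ht : IsOpen (extChartAt I x).target := isOpen_extChartAt_target x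
  have hx : extChartAt I x x ∈ (extChartAt I x).target := mem_extChartAt_target x
  set φ := Φ ∘ (extChartAt I x).symm with hφ
  have hφd : ContDiffAt ℝ ∞ φ (extChartAt I x x) :=
    (contDiffOn_comp_symm hΦ x).contDiffAt (ht.mem_nhds hx)
  have hsymm : IsSymmSndFDerivAt ℝ φ (extChartAt I x x) := hφd.isSymmSndFDerivAt (by
    rw [minSmoothness_of_isRCLikeNormedField]; exact ENat.LEInfty.out)
  have hd2 : DifferentiableAt ℝ (fderiv ℝ φ) (extChartAt I x x) :=
    (hφd.fderiv_right (m := ∞) (by norm_num)).differentiableAt (by norm_num)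
  have key : ∀ u w : V, extDeriv (inChart (dc I Φ) x) (extChartAt I x x) ![u, w] =
      -(fderiv ℝ (fderiv ℝ φ) (extChartAt I x x) u (Complex.I • w)) +
        fderiv ℝ (fderiv ℝ φ) (extChartAt I x x) w (Complex.I • u) := by
    intro u w
    have hw : ∀ u w : V, fderiv ℝ (fun z => inChart (dc I Φ) x z (fun _ => w)) (extChartAt I x x) u =
        -(fderiv ℝ (fderiv ℝ φ) (extChartAt I x x) u (Complex.I • w)) := by
      intro u w
      have he : (fun z => inChart (dc I Φ) x z (fun _ => w)) =ᶠ[𝓝 (extChartAt I x x)]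
          fun z => -(fderiv ℝ φ z (Complex.I • w)) := by
        filter_upwards [ht.mem_nhds hx] with z hz
        rw [inChart_dc h hs hΦ hz]
        rfl
      rw [he.fderiv_eq, fderiv_fun_neg, fderiv_clm_apply hd2 (differentiableAt_const _)]
      simp
    rw [extDeriv_oneForm_apply ((inChart_contDiffAt (isSmoothForm_dc h hs hΦ) hx).differentiableAt
      (by norm_num)), hw, hw]
    ring
  have key2 : ∀ u w : V, extDeriv (inChart (dc I Φ) x) (extChartAt I x x)
      ![Complex.I • u, Complex.I • w] =
      extDeriv (inChart (dc I Φ) x) (extChartAt I x x) ![u, w] := by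
    intro u w
    rw [key, key, smul_smul, smul_smul, Complex.I_mul_I, hsymm.eq, hsymm.eq (Complex.I • w)]
    simp only [neg_smul, one_smul, map_neg, _root_.neg_apply]
    ring
  intro v w
  rw [ddc, extD_apply, extD_apply]
  exact key2 v w

theorem extD_sub {k : ℕ} {η η' : DiffForm I M k} (hη : IsSmoothForm η) (hη' : IsSmoothForm η') :
    IsSmoothForm (fun x => η x - η' x : DiffForm I M k) ∧
    extD (fun x => η x - η' x : DiffForm I M k) = fun x => extD η x - extD η' x := by
  have e : ∀ x, inChart (fun x => η x - η' x : DiffForm I M k) x = inChart η x - inChart η' x := by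
    intro x; funext y; rfl
  refine ⟨fun x => by rw [e]; exact (hη x).sub (hη' x), ?_⟩
  funext x
  have hx : extChartAt I x x ∈ (extChartAt I x).target := mem_extChartAt_target x
  have h1 := (inChart_contDiffAt hη hx).differentiableAt (by norm_num)
  have h2 := (inChart_contDiffAt hη' hx).differentiableAt (by norm_num)
  have h3 : extDeriv (inChart η x - inChart η' x) (extChartAt I x x) =
      extDeriv (inChart η x) (extChartAt I x x) - extDeriv (inChart η' x) (extChartAt I x x) := by
    rw [sub_eq_add_neg, ← neg_one_smul ℝ (inChart η' x), extDeriv_add h1 (h2.const_smul _),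
      extDeriv_smul, neg_one_smul, ← sub_eq_add_neg]
  ext v
  change _ = extD η x v - extD η' x v
  rw [extD_apply, extD_apply, extD_apply, e, h3]
  rfl

/-- Holomorphy of `g` makes its derivative commute with `J`, so `d^c` commutes with translation. -/
theorem isInvariantForm_dc (h : (IC : H → V) = I) (hs : (IC.symm : V → H) = I.symm)
    {G : Type*} [Group G] [MulAction G M]
    (hG : ∀ g : G, MDifferentiable IC IC (fun x : M => g • x)) {Φ : M → ℝ}
    (hΦ : ContMDiff I 𝓘(ℝ, ℝ) ∞ Φ) (hinv : ∀ (g : G) (x : M), Φ (g • x) = Φ x) :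
    IsInvariantForm G (dc I Φ) := by
  rw [isInvariantForm_iff]
  intro g p
  obtain ⟨hd, hJ⟩ := mfderiv_J (I := I) (I' := I) h hs h hs (hG g p.1) p.2
  have hΦd := hΦ.mdifferentiable (by norm_num) (g • p.1)
  have hc := mfderiv_comp_apply p.1 hΦd hd (J I p.1 p.2)
  have he : Φ ∘ (fun x : M => g • x) = Φ := funext (hinv g)
  rw [he, hJ] at hc
  exact congrArg Neg.neg hc.symm

end ComplexStructure

/-! ### Tangent vectors over equal base points -/

section Transport

variable {V H : Type*} [NormedAddCommGroup V] [NormedSpace ℝ V] [TopologicalSpace H]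
  {I : ModelWithCorners ℝ V H} {M : Type*} [TopologicalSpace M] [ChartedSpace H M]

/-- Equalities such as `1 • x = x` hold only propositionally. Stating identities of tangent vectors
in the total space, where this lemma applies, avoids casts between tangent spaces. -/
theorem mk_eq_mk {x y : M} (h : x = y) (v : V) :
    (⟨x, v⟩ : TangentBundle I M) = ⟨y, v⟩ := by subst h; rfl

theorem snd_eq_of_eq {x y : M} {v : TangentSpace I x} {w : TangentSpace I y}
    (h : (⟨x, v⟩ : TangentBundle I M) = ⟨y, w⟩) : (v : V) = w := by cases h; rfl

end Transport

/-! ### Fundamental vector fields and the adjoint action -/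

section Fundamental

variable {F : Type*} [NormedAddCommGroup F] [NormedSpace ℝ F]
  {G : Type*} [TopologicalSpace G] [ChartedSpace F G] [Group G] [LieGroup 𝓘(ℝ, F) ∞ G]
  {V H : Type*} [NormedAddCommGroup V] [NormedSpace ℂ V] [TopologicalSpace H]
  {I : ModelWithCorners ℝ V H} [I.Boundaryless]
  {M : Type*} [TopologicalSpace M] [ChartedSpace H M] [IsManifold I ∞ M] [MulAction G M]

variable (I) in
/-- The fundamental vector as an element of the tangent bundle. -/
def fundT (A : GroupLieAlgebra 𝓘(ℝ, F) G) (x : M) : TangentBundle I M :=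
  ⟨x, fundamentalVector I A x⟩

theorem tangentMap_orbit_one (A : GroupLieAlgebra 𝓘(ℝ, F) G) (x : M) :
    tangentMap 𝓘(ℝ, F) I (fun g : G => g • x) ⟨1, A⟩ = fundT I A x :=
  mk_eq_mk (one_smul G x) _

/-- Differentiate `(g h) x = g (h x)` in `h` at the identity. -/
theorem tangentMap_orbit (hact : ContMDiff (𝓘(ℝ, F).prod I) I ∞ (fun a : G × M => a.1 • a.2))
    (A : GroupLieAlgebra 𝓘(ℝ, F) G) (g : G) (x : M) :
    tangentMap 𝓘(ℝ, F) I (fun g : G => g • x) ⟨g, mulInvariantVectorField A g⟩ =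
      tangentMap I I (fun y : M => g • y) (fundT I A x) := by
  have h1 := (contMDiff_smul_left hact g).mdifferentiable (by norm_num)
  have h2 := (contMDiff_orbit hact x).mdifferentiable (by norm_num)
  have h3 : MDifferentiable 𝓘(ℝ, F) 𝓘(ℝ, F) (fun h : G => g * h) :=
    (contMDiff_mul_left (I := 𝓘(ℝ, F)) (n := ∞)).mdifferentiable (by norm_num)
  have e : (fun h : G => h • x) ∘ (fun h : G => g * h) =
      (fun y : M => g • y) ∘ (fun h : G => h • x) := by
    funext h; exact mul_smul g h x
  have e1 := tangentMap_comp_at (I' := 𝓘(ℝ, F)) (I'' := I)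
    (⟨1, A⟩ : TangentBundle 𝓘(ℝ, F) G) (h2 _) (h3 _)
  have e2 := tangentMap_comp_at (I' := I) (I'' := I)
    (⟨1, A⟩ : TangentBundle 𝓘(ℝ, F) G) (h1 _) (h2 _)
  rw [e, e2, tangentMap_orbit_one] at e1
  rw [e1]
  exact congrArg _ (mk_eq_mk (I := 𝓘(ℝ, F)) (mul_one g).symm _)

/-- The adjoint action. -/
def Ad (g : G) : GroupLieAlgebra 𝓘(ℝ, F) G →L[ℝ] GroupLieAlgebra 𝓘(ℝ, F) G :=
  (mfderiv 𝓘(ℝ, F) 𝓘(ℝ, F) (fun h : G => g * h * g⁻¹) 1 : F →L[ℝ] F)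

theorem contMDiff_conj (g : G) :
    ContMDiff 𝓘(ℝ, F) 𝓘(ℝ, F) ∞ (fun h : G => g * h * g⁻¹) :=
  (contMDiff_mul_right (I := 𝓘(ℝ, F)) (n := ∞) (a := g⁻¹)).comp
    (contMDiff_mul_left (I := 𝓘(ℝ, F)) (n := ∞) (a := g))

theorem tangentMap_conj (g : G) (A : GroupLieAlgebra 𝓘(ℝ, F) G) :
    tangentMap 𝓘(ℝ, F) 𝓘(ℝ, F) (fun h : G => g * h * g⁻¹) ⟨1, A⟩ = ⟨1, Ad g A⟩ :=
  mk_eq_mk (I := 𝓘(ℝ, F)) (by group) _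

/-- Differentiate `(g h g⁻¹)(g x) = g (h x)` in `h` at the identity. -/
theorem tangentMap_smul_fundT
    (hact : ContMDiff (𝓘(ℝ, F).prod I) I ∞ (fun a : G × M => a.1 • a.2))
    (g : G) (A : GroupLieAlgebra 𝓘(ℝ, F) G) (x : M) :
    tangentMap I I (fun y : M => g • y) (fundT I A x) = fundT I (Ad g A) (g • x) := by
  have h1 := (contMDiff_smul_left hact g).mdifferentiable (by norm_num)
  have h2 := (contMDiff_orbit hact x).mdifferentiable (by norm_num)
  have h2' := (contMDiff_orbit hact (g • x)).mdifferentiable (by norm_num)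
  have h3 := (contMDiff_conj (F := F) g).mdifferentiable (by norm_num)
  have e : (fun h : G => h • (g • x)) ∘ (fun h : G => g * h * g⁻¹) =
      (fun y : M => g • y) ∘ (fun h : G => h • x) := by
    funext h; simp [mul_smul]
  have e1 := tangentMap_comp_at (I' := 𝓘(ℝ, F)) (I'' := I)
    (⟨1, A⟩ : TangentBundle 𝓘(ℝ, F) G) (h2' _) (h3 _)
  have e2 := tangentMap_comp_at (I' := I) (I'' := I)
    (⟨1, A⟩ : TangentBundle 𝓘(ℝ, F) G) (h1 _) (h2 _)
  rw [e, e2, tangentMap_orbit_one, tangentMap_conj, tangentMap_orbit_one] at e1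
  exact e1

theorem fundamentalVector_add (A B : GroupLieAlgebra 𝓘(ℝ, F) G) (x : M) :
    fundamentalVector I (A + B) x = fundamentalVector I A x + fundamentalVector I B x :=
  (mfderiv 𝓘(ℝ, F) I (fun g : G => g • x) (1 : G)).map_add A B

theorem fundamentalVector_smul (c : ℝ) (A : GroupLieAlgebra 𝓘(ℝ, F) G) (x : M) :
    fundamentalVector I (c • A) x = c • fundamentalVector I A x :=
  (mfderiv 𝓘(ℝ, F) I (fun g : G => g • x) (1 : G)).map_smul c A

theorem contMDiff_fundT {V₁ H₁ : Type*} [NormedAddCommGroup V₁] [NormedSpace ℝ V₁]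
    [TopologicalSpace H₁] {I₁ : ModelWithCorners ℝ V₁ H₁} {N : Type*} [TopologicalSpace N]
    [ChartedSpace H₁ N]
    (hact : ContMDiff (𝓘(ℝ, F).prod I) I ∞ (fun a : G × M => a.1 • a.2))
    {C : N → F} (hC : ContMDiff I₁ 𝓘(ℝ, F) ∞ C) {x : N → M} (hx : ContMDiff I₁ I ∞ x) :
    ContMDiff I₁ I.tangent ∞ (fun n => fundT I (G := G) (C n) (x n)) := by
  have h0 : ContMDiff I₁ 𝓘(ℝ, F).tangent ∞
      (fun n => (⟨1, C n⟩ : TangentBundle 𝓘(ℝ, F) G)) := by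
    intro n
    rw [contMDiffAt_totalSpace]
    refine ⟨contMDiffAt_const, ?_⟩
    refine (hC n).congr_of_eventuallyEq (Eventually.of_forall fun m => ?_)
    -- In the trivialization centred at `1`, the coordinate of a vector at `1` is the vector itself.
    simp only [TangentBundle.trivializationAt_apply]
    exact (tangentBundleCore 𝓘(ℝ, F) G).coordChange_self (achart F (1 : G)) 1
      (mem_chart_source F 1) (C m)
  have h1 : ContMDiff I₁ I.tangent ∞ (fun n => (⟨x n, (0 : V)⟩ : TangentBundle I M)) :=
    (contMDiff_zeroSection ℝ (TangentSpace I (M := M))).comp hx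
  have h2 := (contMDiff_tangentMap hact).comp
    (contMDiffOn_univ.1 (contMDiffOn_tangentBundleProd h0.contMDiffOn h1.contMDiffOn))
  refine h2.congr fun n => ?_
  refine Eq.trans ?_ (tangentMap_act hact 1 (x n) (C n) 0).symm
  refine (tangentMap_orbit_one (C n) (x n)).symm.trans ?_
  exact congrArg (fun w => (⟨(1 : G) • x n, w⟩ : TangentBundle I M)) (by simp)

theorem form2_congr (η : DiffForm I M 2) {x x' : M} {v w : TangentSpace I x}
    {v' w' : TangentSpace I x'} (hv : (⟨x, v⟩ : TangentBundle I M) = ⟨x', v'⟩)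
    (hw : (⟨x, w⟩ : TangentBundle I M) = ⟨x', w'⟩) : η x ![v, w] = η x' ![v', w'] := by
  cases hv; cases hw; rfl

theorem tangentMap_one_smul (p : TangentBundle I M) :
    tangentMap I I (fun y : M => (1 : G) • y) p = p := by
  have : (fun y : M => (1 : G) • y) = id := funext fun y => one_smul G y
  rw [this, tangentMap_id]; rfl

theorem tangentMap_chart_orbit
    (hact : ContMDiff (𝓘(ℝ, F).prod I) I ∞ (fun a : G × M => a.1 • a.2)) (x : M) {y : F}
    (hy : y ∈ (extChartAt 𝓘(ℝ, F) (1 : G)).target) (u : F) :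
    tangentMap 𝓘(ℝ, F) I (fun y => (extChartAt 𝓘(ℝ, F) (1 : G)).symm y • x) ⟨y, u⟩ =
      tangentMap 𝓘(ℝ, F) I (fun g : G => g • x)
        (tangentMap 𝓘(ℝ, F) 𝓘(ℝ, F) (extChartAt 𝓘(ℝ, F) (1 : G)).symm ⟨y, u⟩) :=
  tangentMap_comp_at (I' := 𝓘(ℝ, F)) (I'' := I) (⟨y, u⟩ : TangentBundle 𝓘(ℝ, F) F)
    ((contMDiff_orbit hact x).mdifferentiable (by norm_num) _) (mdifferentiableAt_extChartAt_symm hy)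

theorem tangentMap_chart_orbit_one
    (hact : ContMDiff (𝓘(ℝ, F).prod I) I ∞ (fun a : G × M => a.1 • a.2)) (x : M)
    (A : GroupLieAlgebra 𝓘(ℝ, F) G) :
    tangentMap 𝓘(ℝ, F) I (fun y => (extChartAt 𝓘(ℝ, F) (1 : G)).symm y • x)
      ⟨extChartAt 𝓘(ℝ, F) (1 : G) 1, A⟩ = fundT I A x := by
  refine (tangentMap_chart_orbit hact x (mem_extChartAt_target (1 : G)) A).trans ?_
  refine Eq.trans (congrArg _ ?_) (tangentMap_orbit_one A x)
  have h1 : (extChartAt 𝓘(ℝ, F) (1 : G)).symm (extChartAt 𝓘(ℝ, F) (1 : G) 1) = 1 :=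
    extChartAt_to_inv _
  refine (mk_eq_mk (I := 𝓘(ℝ, F)) h1 _).trans ?_
  exact congrArg (fun w => (⟨1, w⟩ : TangentBundle 𝓘(ℝ, F) G))
    (mfderiv_extChartAt_symm_self_apply (I := 𝓘(ℝ, F)) (x := (1 : G)) A)

theorem contMDiffAt_chart_symm_one :
    ContMDiffAt 𝓘(ℝ, F) 𝓘(ℝ, F) ∞ (extChartAt 𝓘(ℝ, F) (1 : G)).symm
      (extChartAt 𝓘(ℝ, F) (1 : G) 1) :=
  (contMDiffOn_extChartAt_symm (1 : G)).contMDiffAt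
    ((isOpen_extChartAt_target (1 : G)).mem_nhds (mem_extChartAt_target (1 : G)))

/-- For an invariant 1-form `θ`, `dθ(σ', A)` is the derivative of `θ(A)` along `σ`. -/
theorem extD_curve_fundamentalVector
    (hact : ContMDiff (𝓘(ℝ, F).prod I) I ∞ (fun a : G × M => a.1 • a.2))
    {θ : DiffForm I M 1} (hθ : IsSmoothForm θ) (hinv : IsInvariantForm G θ)
    {σ : ℝ → M} {s₀ : ℝ} (hσ : ContMDiffAt 𝓘(ℝ, ℝ) I ∞ σ s₀) (A : GroupLieAlgebra 𝓘(ℝ, F) G) :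
    extD θ (σ s₀) ![mfderiv 𝓘(ℝ, ℝ) I σ s₀ (1 : ℝ), fundamentalVector I A (σ s₀)] =
      deriv (fun s => form1 θ (fundT I A (σ s))) s₀ := by
  rw [isInvariantForm_iff] at hinv
  set e := extChartAt 𝓘(ℝ, F) (1 : G)
  have ht : e.target ∈ 𝓝 (e 1) :=
    (isOpen_extChartAt_target (1 : G)).mem_nhds (mem_extChartAt_target (1 : G))
  -- The curve is swept out by the group. On this family `dθ(∂_s, ∂_y) = ∂_s θ(∂_y) - ∂_y θ(∂_s)`;
  -- at `y = e 1` the vector `∂_y` is `A^#`, and the second term vanishes by invariance.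
  let γ : ℝ × F → M := fun a => e.symm a.2 • σ a.1
  have hpair : ContMDiffAt 𝓘(ℝ, ℝ × F) (𝓘(ℝ, F).prod I) ∞
      (fun a : ℝ × F => (e.symm a.2, σ a.1)) (s₀, e 1) := by
    refine ContMDiffAt.prodMk ?_ ?_
    · exact ContMDiffAt.comp (s₀, e 1) contMDiffAt_chart_symm_one
        contDiffAt_snd.contMDiffAt
    · exact ContMDiffAt.comp (s₀, e 1) hσ contDiffAt_fst.contMDiffAt
  have hγ : ContMDiffAt 𝓘(ℝ, ℝ × F) I ∞ γ (s₀, e 1) :=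
    hact.contMDiffAt.comp (s₀, e 1) hpair
  have hγ1 : ∀ᶠ a in 𝓝 (s₀, e 1), MDifferentiableAt 𝓘(ℝ, ℝ × F) I γ a := by
    filter_upwards [(contMDiffAt_iff_contMDiffAt_nhds (n := 1) (by norm_num)).1
      (hγ.of_le (by norm_num))] with a ha using ha.mdifferentiableAt (by norm_num)
  have hpart2 : ∀ s y, MDifferentiableAt 𝓘(ℝ, ℝ × F) I γ (s, y) → ∀ u : F,
      tangentMap 𝓘(ℝ, ℝ × F) I γ ⟨(s, y), ((0 : ℝ), u)⟩ =
        tangentMap 𝓘(ℝ, F) I (fun y => e.symm y • σ s) ⟨y, u⟩ := by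
    intro s y h u
    have hl : HasFDerivAt (fun y : F => (s, y)) (ContinuousLinearMap.inr ℝ ℝ F) y :=
      hasFDerivAt_prodMk_right s y
    have h2 := tangentMap_comp_at (I := 𝓘(ℝ, F)) (I' := 𝓘(ℝ, ℝ × F)) (I'' := I)
      (⟨y, u⟩ : TangentBundle 𝓘(ℝ, F) F) (f := fun y : F => (s, y)) h
      hl.differentiableAt.mdifferentiableAt
    refine Eq.trans ?_ h2.symm
    refine congrArg (tangentMap 𝓘(ℝ, ℝ × F) I γ) ?_
    refine congrArg (fun w => (⟨(s, y), w⟩ : TangentBundle 𝓘(ℝ, ℝ × F) (ℝ × F))) ?_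
    exact (DFunLike.congr_fun (mfderiv_eq_fderiv.trans hl.fderiv) u).symm
  have hpart1 : ∀ s y, MDifferentiableAt 𝓘(ℝ, ℝ × F) I γ (s, y) →
      tangentMap 𝓘(ℝ, ℝ × F) I γ ⟨(s, y), ((1 : ℝ), (0 : F))⟩ =
        tangentMap 𝓘(ℝ, ℝ) I (fun s => e.symm y • σ s) ⟨s, (1 : ℝ)⟩ := by
    intro s y h
    have hl : HasFDerivAt (fun s : ℝ => (s, y)) (ContinuousLinearMap.inl ℝ ℝ F) s :=
      hasFDerivAt_prodMk_left s y
    have h2 := tangentMap_comp_at (I := 𝓘(ℝ, ℝ)) (I' := 𝓘(ℝ, ℝ × F)) (I'' := I)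
      (⟨s, (1 : ℝ)⟩ : TangentBundle 𝓘(ℝ, ℝ) ℝ) (f := fun s : ℝ => (s, y)) h
      hl.differentiableAt.mdifferentiableAt
    refine Eq.trans ?_ h2.symm
    refine congrArg (tangentMap 𝓘(ℝ, ℝ × F) I γ) ?_
    refine congrArg (fun w => (⟨(s, y), w⟩ : TangentBundle 𝓘(ℝ, ℝ × F) (ℝ × F))) ?_
    exact (DFunLike.congr_fun (mfderiv_eq_fderiv.trans hl.fderiv) (1 : ℝ)).symm
  have hσd := hσ.mdifferentiableAt (by norm_num)
  have hT1 : ∀ y, MDifferentiableAt 𝓘(ℝ, ℝ × F) I γ (s₀, y) →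
      tangentMap 𝓘(ℝ, ℝ × F) I γ ⟨(s₀, y), ((1 : ℝ), (0 : F))⟩ =
        tangentMap I I (fun x : M => e.symm y • x) (tangentMap 𝓘(ℝ, ℝ) I σ ⟨s₀, (1 : ℝ)⟩) := by
    intro y h
    rw [hpart1 s₀ y h]
    exact tangentMap_comp_at (I' := I) (I'' := I) (⟨s₀, (1 : ℝ)⟩ : TangentBundle 𝓘(ℝ, ℝ) ℝ)
      ((contMDiff_smul_left hact _).mdifferentiable (by norm_num) _) hσd
  have he1 : e.symm (e 1) = 1 := extChartAt_to_inv _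
  have hd0 := hγ.mdifferentiableAt (by norm_num)
  have hmain := extD_apply_tangentMap hθ hγ ((1 : ℝ), (0 : F)) ((0 : ℝ), A)
  have hdf : ∀ w : ℝ × F, DifferentiableAt ℝ
      (fun a => form1 θ (tangentMap 𝓘(ℝ, ℝ × F) I γ ⟨a, w⟩)) (s₀, e 1) := fun w =>
    (pull_differentiableAt hθ hγ).continuousAlternatingMap_apply_const (fun _ => w)
  have hfirst : fderiv ℝ (fun a => form1 θ (tangentMap 𝓘(ℝ, ℝ × F) I γ ⟨a, ((0 : ℝ), A)⟩))
      (s₀, e 1) ((1 : ℝ), (0 : F)) = deriv (fun s => form1 θ (fundT I A (σ s))) s₀ := by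
    have h1 := (hdf ((0 : ℝ), A)).hasFDerivAt.comp_hasDerivAt s₀
      (hasFDerivAt_prodMk_left s₀ (e 1)).hasDerivAt
    have h2 : (fun s => form1 θ (fundT I A (σ s))) =ᶠ[𝓝 s₀]
        (fun a => form1 θ (tangentMap 𝓘(ℝ, ℝ × F) I γ ⟨a, ((0 : ℝ), A)⟩)) ∘ fun s => (s, e 1) := by
      have : Tendsto (fun s : ℝ => (s, e 1)) (𝓝 s₀) (𝓝 (s₀, e 1)) :=
        Continuous.tendsto (by fun_prop) s₀
      filter_upwards [this.eventually hγ1] with s hs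
      exact congrArg (form1 θ)
        ((hpart2 s (e 1) hs A).trans (tangentMap_chart_orbit_one hact (σ s) A)).symm
    rw [h2.deriv_eq, h1.deriv]
    simp
  -- The vector `∂_s` at parameter `y` is the translate of the velocity of `σ` by `e.symm y`, so
  -- `θ(∂_s)` is constant in `y`.
  have hsecond : fderiv ℝ
      (fun a => form1 θ (tangentMap 𝓘(ℝ, ℝ × F) I γ ⟨a, ((1 : ℝ), (0 : F))⟩))
      (s₀, e 1) ((0 : ℝ), A) = 0 := by
    have h1 := (hdf ((1 : ℝ), (0 : F))).hasFDerivAt.comp (e 1) (hasFDerivAt_prodMk_right s₀ (e 1))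
    have h2 : (fun a => form1 θ (tangentMap 𝓘(ℝ, ℝ × F) I γ ⟨a, ((1 : ℝ), (0 : F))⟩)) ∘
        (fun y => (s₀, y)) =ᶠ[𝓝 (e 1)] fun _ => form1 θ (tangentMap 𝓘(ℝ, ℝ) I σ ⟨s₀, (1 : ℝ)⟩) := by
      have : Tendsto (fun y : F => (s₀, y)) (𝓝 (e 1)) (𝓝 (s₀, e 1)) :=
        Continuous.tendsto (by fun_prop) _
      filter_upwards [this.eventually hγ1] with y hy
      exact (congrArg (form1 θ) (hT1 y hy)).trans (hinv _ _)
    have h3 := DFunLike.congr_fun (h1.fderiv.symm.trans (h2.fderiv_eq.trans (hasFDerivAt_const _ _).fderiv)) A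
    exact h3
  rw [hfirst, hsecond, sub_zero] at hmain
  rw [← hmain]
  refine form2_congr _ ?_ ?_
  · have h := hT1 (e 1) hd0
    rw [he1, tangentMap_one_smul] at h
    exact h.symm
  · exact ((hpart2 s₀ (e 1) hd0 A).trans (tangentMap_chart_orbit_one hact (σ s₀) A)).symm

end Fundamental

/-! ### Lie brackets and the Maurer–Cartan formula -/

section BracketFormula

variable {F : Type*} [NormedAddCommGroup F] [NormedSpace ℝ F] [CompleteSpace F]
  {G : Type*} [TopologicalSpace G] [ChartedSpace F G] [Group G] [LieGroup 𝓘(ℝ, F) ∞ G]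
  {V H : Type*} [NormedAddCommGroup V] [NormedSpace ℂ V] [TopologicalSpace H]
  {I : ModelWithCorners ℝ V H} [I.Boundaryless]
  {M : Type*} [TopologicalSpace M] [ChartedSpace H M] [IsManifold I ∞ M] [MulAction G M]

/-- A left-invariant vector field in the chart around the identity. -/
def invariantFieldInChart (A : GroupLieAlgebra 𝓘(ℝ, F) G) : F → F :=
  VectorField.mpullbackWithin 𝓘(ℝ, F) 𝓘(ℝ, F) (extChartAt 𝓘(ℝ, F) (1 : G)).symm
    (mulInvariantVectorField A) univ

theorem differentiableAt_invariantFieldInChart (A : GroupLieAlgebra 𝓘(ℝ, F) G) :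
    DifferentiableAt ℝ (invariantFieldInChart A) (extChartAt 𝓘(ℝ, F) (1 : G) 1) := by
  have := (mdifferentiableAt_mulInvariantVectorField (I := 𝓘(ℝ, F)) A
    (g := (1 : G))).mdifferentiableWithinAt (s := univ)
  have h2 := this.differentiableWithinAt_mpullbackWithin_vectorField
  simp only [preimage_univ, modelWithCornersSelf_coe, range_id, univ_inter] at h2
  exact h2.differentiableAt univ_mem

theorem tangentMap_invariantFieldInChart (A : GroupLieAlgebra 𝓘(ℝ, F) G) {y : F}
    (hy : y ∈ (extChartAt 𝓘(ℝ, F) (1 : G)).target) :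
    tangentMap 𝓘(ℝ, F) 𝓘(ℝ, F) (extChartAt 𝓘(ℝ, F) (1 : G)).symm
      ⟨y, (invariantFieldInChart A y : F)⟩ =
      ⟨(extChartAt 𝓘(ℝ, F) (1 : G)).symm y, mulInvariantVectorField A _⟩ := by
  have h := isInvertible_mfderivWithin_extChartAt_symm (I := 𝓘(ℝ, F)) hy
  simp only [modelWithCornersSelf_coe, range_id] at h
  have key : ∀ {f : F →L[ℝ] F}, f.IsInvertible → ∀ v, f (f.inverse v) = v :=
    fun hf v => ContinuousLinearMap.IsInvertible.self_apply_inverse hf v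
  have h2 := key h (mulInvariantVectorField A ((extChartAt 𝓘(ℝ, F) (1 : G)).symm y))
  rw [mfderivWithin_univ] at h2
  refine congrArg (fun w => (⟨_, w⟩ : TangentBundle 𝓘(ℝ, F) G)) ?_
  refine Eq.trans ?_ h2
  refine congrArg (mfderiv 𝓘(ℝ, F) 𝓘(ℝ, F) (extChartAt 𝓘(ℝ, F) (1 : G)).symm y) ?_
  unfold invariantFieldInChart
  rw [VectorField.mpullbackWithin_apply, mfderivWithin_univ]
  rfl

/-- The bracket of the Lie algebra is that of left-invariant fields at `1`; the chart has identity
derivative at its centre, so it can be computed in coordinates. -/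
theorem bracket_eq_lieBracket (A B : GroupLieAlgebra 𝓘(ℝ, F) G) :
    (⁅A, B⁆ : GroupLieAlgebra 𝓘(ℝ, F) G) =
      VectorField.lieBracket ℝ (invariantFieldInChart A) (invariantFieldInChart B)
        (extChartAt 𝓘(ℝ, F) (1 : G) 1) := by
  have key : ∀ {f : F →L[ℝ] F} (v : F), f = ContinuousLinearMap.id ℝ F → f.inverse v = v := by
    rintro f v rfl; simp
  have h := key (VectorField.lieBracketWithin ℝ (invariantFieldInChart A)
    (invariantFieldInChart B) univ (extChartAt 𝓘(ℝ, F) (1 : G) 1))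
    (mfderiv_extChartAt_self (I := 𝓘(ℝ, F)) (x := (1 : G)))
  rw [← VectorField.lieBracketWithin_univ]
  refine Eq.trans ?_ h
  rw [GroupLieAlgebra.bracket_def, ← VectorField.mlieBracketWithin_univ,
    VectorField.mlieBracketWithin_apply]
  simp only [preimage_univ, modelWithCornersSelf_coe, range_id, univ_inter]
  rfl

/-- For an invariant 1-form `θ`, `dθ(A, B) = -θ([A, B])`. -/
theorem extD_fundamentalVector_fundamentalVector
    (hact : ContMDiff (𝓘(ℝ, F).prod I) I ∞ (fun a : G × M => a.1 • a.2))
    {θ : DiffForm I M 1} (hθ : IsSmoothForm θ) (hinv : IsInvariantForm G θ) (x : M)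
    (A B : GroupLieAlgebra 𝓘(ℝ, F) G) :
    extD θ x ![fundamentalVector I A x, fundamentalVector I B x] =
      -form1 θ (fundT I ⁅A, B⁆ x) := by
  rw [isInvariantForm_iff] at hinv
  set e := extChartAt 𝓘(ℝ, F) (1 : G) with he
  have ht : e.target ∈ 𝓝 (e 1) :=
    (isOpen_extChartAt_target (1 : G)).mem_nhds (mem_extChartAt_target (1 : G))
  let γ : F → M := fun y => e.symm y • x
  have hγ : ContMDiffAt 𝓘(ℝ, F) I ∞ γ (e 1) :=
    ContMDiffAt.comp (e 1) (contMDiff_orbit hact x).contMDiffAt contMDiffAt_chart_symm_one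
  -- The orbit map sends a left-invariant field to translates of one fundamental vector, on which an
  -- invariant `θ` is constant. Hence in `dθ(A, B) = A θ(B) - B θ(A) - θ([A, B])` only the bracket
  -- term survives.
  have hconst : ∀ C : GroupLieAlgebra 𝓘(ℝ, F) G, ∀ y ∈ e.target,
      form1 θ (tangentMap 𝓘(ℝ, F) I γ ⟨y, (invariantFieldInChart C y : F)⟩) = form1 θ (fundT I C x) := by
    intro C y hy
    refine Eq.trans (congrArg (form1 θ) ?_) (hinv (e.symm y) (fundT I C x))
    refine (tangentMap_chart_orbit hact x hy _).trans ?_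
    refine (congrArg _ (tangentMap_invariantFieldInChart C hy)).trans ?_
    exact tangentMap_orbit hact C _ x
  have hone : ∀ C : GroupLieAlgebra 𝓘(ℝ, F) G,
      invariantFieldInChart C (e 1) = C := by
    intro C
    have h1 := tangentMap_invariantFieldInChart C (mem_extChartAt_target (I := 𝓘(ℝ, F)) (1 : G))
    have h2 : (⟨e.symm (e 1), mulInvariantVectorField C (e.symm (e 1))⟩ :
        TangentBundle 𝓘(ℝ, F) G) = ⟨1, C⟩ := by
      rw [show e.symm (e 1) = 1 from extChartAt_to_inv _]
      refine congrArg (fun w => (⟨1, w⟩ : TangentBundle 𝓘(ℝ, F) G)) ?_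
      have key : ∀ f : G → G, f = id → mfderiv 𝓘(ℝ, F) 𝓘(ℝ, F) f 1 C = C := by
        rintro f rfl; rw [mfderiv_id]; rfl
      exact key _ (funext fun g => one_mul g)
    have h3 := snd_eq_of_eq (h1.trans h2)
    refine Eq.trans ?_ h3
    exact (mfderiv_extChartAt_symm_self_apply (I := 𝓘(ℝ, F)) (x := (1 : G)) _).symm
  have hω := pull_differentiableAt hθ hγ
  have hmain := extDeriv_apply_vectorField hω
    (V := ![invariantFieldInChart A, invariantFieldInChart B]) (by
      intro i; fin_cases i
      · exact differentiableAt_invariantFieldInChart A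
      · exact differentiableAt_invariantFieldInChart B)
  have hz : ∀ (C : GroupLieAlgebra 𝓘(ℝ, F) G) (v : F),
      fderiv ℝ (fun y => pull θ γ y (fun _ => invariantFieldInChart C y)) (e 1) v = 0 := by
    intro C v
    have : (fun y => pull θ γ y (fun _ => invariantFieldInChart C y)) =ᶠ[𝓝 (e 1)]
        fun _ => form1 θ (fundT I C x) := by
      filter_upwards [ht] with y hy using hconst C y hy
    rw [this.fderiv_eq]; simp
  have r0 : (fun y => pull θ γ y (Fin.removeNth 0
      fun i => ![invariantFieldInChart A, invariantFieldInChart B] i y)) =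
      fun y => pull θ γ y (fun _ => invariantFieldInChart B y) := by
    funext y; congr 1; funext i; fin_cases i; rfl
  have r1 : (fun y => pull θ γ y (Fin.removeNth 1
      fun i => ![invariantFieldInChart A, invariantFieldInChart B] i y)) =
      fun y => pull θ γ y (fun _ => invariantFieldInChart A y) := by
    funext y; congr 1; funext i; fin_cases i; rfl
  have rl : pull θ γ (e 1) ![VectorField.lieBracket ℝ (invariantFieldInChart A)
      (invariantFieldInChart B) (e 1)] = form1 θ (fundT I ⁅A, B⁆ x) := by
    rw [← bracket_eq_lieBracket]
    rw [← hconst ⁅A, B⁆ (e 1) (mem_extChartAt_target (1 : G)), hone]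
    refine congrArg (pull θ γ (e 1)) ?_
    funext i; fin_cases i; rfl
  have hl : extDeriv (pull θ γ) (e 1)
      (fun i => ![invariantFieldInChart A, invariantFieldInChart B] i (e 1)) =
      -form1 θ (fundT I ⁅A, B⁆ x) := by
    rw [hmain, ← rl, Fin.sum_univ_two, r0, r1, hz, hz]
    simp
    exact congrArg _ (congrArg _ (Subsingleton.elim _ _))
  have hT : ∀ C : GroupLieAlgebra 𝓘(ℝ, F) G, fundT I C x =
      tangentMap 𝓘(ℝ, F) I γ ⟨e 1, (invariantFieldInChart C (e 1) : F)⟩ := fun C =>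
    ((congrArg (fun w => tangentMap 𝓘(ℝ, F) I γ ⟨e 1, w⟩) (hone C)).trans
      (tangentMap_chart_orbit_one hact x C)).symm
  rw [← hl, extDeriv_pull hθ hγ]
  refine (form2_congr (extD θ) (hT A) (hT B)).trans ?_
  refine congrArg (extD θ (γ (e 1))) ?_
  funext i; fin_cases i <;> rfl

end BracketFormula

/-! ### Derivatives read in the chart of the target -/

section ChartDerivative

variable {V H : Type*} [NormedAddCommGroup V] [NormedSpace ℝ V] [TopologicalSpace H]
  {I : ModelWithCorners ℝ V H} {M : Type*} [TopologicalSpace M] [ChartedSpace H M]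
  {V' H' : Type*} [NormedAddCommGroup V'] [NormedSpace ℝ V'] [TopologicalSpace H']
  {I' : ModelWithCorners ℝ V' H'} {M' : Type*} [TopologicalSpace M'] [ChartedSpace H' M']
  [IsManifold I' 1 M']

theorem mfderiv_eq_mfderiv_extChartAt_comp {f : M → M'} {x : M} (hf : MDifferentiableAt I I' f x)
    (v : TangentSpace I x) : (mfderiv I I' f x v : V') =
      mfderiv I 𝓘(ℝ, V') (fun y => extChartAt I' (f x) (f y)) x v := by
  have h := mfderiv_comp_apply (I := I) (I' := I') (I'' := 𝓘(ℝ, V')) x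
    (mdifferentiableAt_extChartAt (mem_chart_source H' (f x))) hf v
  refine Eq.trans ?_ h.symm
  rw [mfderiv_extChartAt_self]; rfl

end ChartDerivative

/-! ### Fibre multiplication and vertical vectors on a line bundle -/

section LineBundle

variable {E : Type*} [NormedAddCommGroup E] [NormedSpace ℂ E]
  {X : Type*} [TopologicalSpace X] [ChartedSpace E X] [IsManifold 𝓘(ℂ, E) ω X]
  {L : X → Type*} [TopologicalSpace (TotalSpace ℂ L)] [∀ x, TopologicalSpace (L x)]
  [∀ x, AddCommGroup (L x)] [∀ x, Module ℂ (L x)] [FiberBundle ℂ L] [VectorBundle ℂ ℂ L]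
  [ContMDiffVectorBundle ω ℂ L 𝓘(ℂ, E)]

local notation "𝓛" => ModelWithCorners.prod 𝓘(ℝ, E) 𝓘(ℝ, ℂ)

instance isManifold_complex_totalSpace :
    IsManifold (𝓘(ℂ, E).prod 𝓘(ℂ, ℂ)) ω (TotalSpace ℂ L) :=
  Bundle.TotalSpace.isManifold ℂ L

instance isManifold_real_totalSpace_infty : IsManifold 𝓛 ∞ (TotalSpace ℂ L) := by
  have : IsManifold (𝓘(ℂ, E).prod 𝓘(ℂ, ℂ)) ∞ (TotalSpace ℂ L) := IsManifold.of_le (n := ω) le_top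
  exact isManifold_real_of_complex (𝓘(ℂ, E).prod 𝓘(ℂ, ℂ)) 𝓛 rfl rfl

instance isManifold_real_base_infty : IsManifold 𝓘(ℝ, E) ∞ X :=
  have : IsManifold 𝓘(ℂ, E) ∞ X := IsManifold.of_le (n := ω) le_top
  isManifold_real_base

/-- The coordinate of a point of `L` in the trivialization around its own base point. -/
def ownCoord (q : TotalSpace ℂ L) : ℂ := (trivializationAt ℂ L q.proj q).2

theorem trivializationAt_fiberSMul {x : X} {q : TotalSpace ℂ L}
    (hq : q.proj ∈ (trivializationAt ℂ L x).baseSet) (z : ℂ) :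
    (trivializationAt ℂ L x (fiberSMul z q)).2 = z * (trivializationAt ℂ L x q).2 :=
  ((trivializationAt ℂ L x).linear ℂ hq).map_smul z q.2

theorem ownCoord_fiberSMul (z : ℂ) (q : TotalSpace ℂ L) :
    ownCoord (fiberSMul z q) = z * ownCoord q :=
  trivializationAt_fiberSMul (FiberBundle.mem_baseSet_trivializationAt' q.proj) z

theorem fiberSMul_one (q : TotalSpace ℂ L) : fiberSMul 1 q = q := by
  simp [fiberSMul]

theorem fiberSMul_fiberSMul (z w : ℂ) (q : TotalSpace ℂ L) :
    fiberSMul z (fiberSMul w q) = fiberSMul (z * w) q := by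
  simp only [fiberSMul, mul_smul]
  rfl

theorem contMDiff_proj_real : ContMDiff 𝓛 𝓘(ℝ, E) ∞ (fun q : TotalSpace ℂ L => q.proj) := fun q =>
  (contMDiffAt_totalSpace.1 (contMDiffAt_id (I := 𝓛) (x := q))).1

theorem contMDiff_fiberSMul :
    ContMDiff (𝓘(ℝ, ℂ).prod 𝓛) 𝓛 ∞ (fun a : ℂ × TotalSpace ℂ L => fiberSMul a.1 a.2) := by
  rintro ⟨w, q⟩
  have h2 : ContMDiffAt (𝓘(ℝ, ℂ).prod 𝓛) 𝓛 ∞ (fun a : ℂ × TotalSpace ℂ L => a.2) (w, q) :=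
    contMDiffAt_snd
  have h := contMDiffAt_totalSpace.1 h2
  rw [contMDiffAt_totalSpace]
  refine ⟨h.1, ?_⟩
  have h3 : ContMDiffAt (𝓘(ℝ, ℂ).prod 𝓛) 𝓘(ℝ, ℂ) ∞
      (fun a : ℂ × TotalSpace ℂ L => a.1 * (trivializationAt ℂ L q.proj a.2).2) (w, q) := by
    have := (contDiff_mul (𝕜 := ℝ) (𝔸 := ℂ) (n := ∞)).contMDiff.contMDiffAt.comp (w, q)
      ((contMDiffAt_fst (I := 𝓘(ℝ, ℂ)) (J := 𝓛)).prodMk_space h.2)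
    exact this
  refine h3.congr_of_eventuallyEq ?_
  have : (trivializationAt ℂ L q.proj).baseSet ∈ 𝓝 q.proj :=
    (trivializationAt ℂ L q.proj).open_baseSet.mem_nhds (FiberBundle.mem_baseSet_trivializationAt' _)
  have hc : ContinuousAt (fun a : ℂ × TotalSpace ℂ L => a.2.proj) (w, q) := h.1.continuousAt
  filter_upwards [hc.preimage_mem_nhds this] with a ha
  exact trivializationAt_fiberSMul ha a.1

theorem extChartAt_totalSpace_apply {q q' : TotalSpace ℂ L}
    (hq : q'.proj ∈ (trivializationAt ℂ L q.proj).baseSet) : (extChartAt 𝓛 q q' : E × ℂ) =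
      (extChartAt 𝓘(ℝ, E) q.proj q'.proj, (trivializationAt ℂ L q.proj q').2) := by
  rw [FiberBundle.extChartAt]
  change (extChartAt 𝓘(ℝ, E) q.proj (trivializationAt ℂ L q.proj q').1,
    (trivializationAt ℂ L q.proj q').2) = _
  rw [Trivialization.coe_fst' _ hq]

/-- In the chart of `L` centred at `q` the projection is the first coordinate. -/
theorem mfderiv_proj (q : TotalSpace ℂ L) (v : TangentSpace 𝓛 q) :
    (mfderiv 𝓛 𝓘(ℝ, E) (fun q : TotalSpace ℂ L => q.proj) q v : E) = (v : E × ℂ).1 := by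
  have hb : IsManifold 𝓘(ℝ, E) 1 X := .of_le (n := ∞) (by norm_num)
  refine (mfderiv_eq_mfderiv_extChartAt_comp
    ((contMDiff_proj_real (E := E) q).mdifferentiableAt (by norm_num)) v).trans ?_
  have hev : (fun q' : TotalSpace ℂ L => extChartAt 𝓘(ℝ, E) q.proj q'.proj) =ᶠ[𝓝 q]
      fun q' => (ContinuousLinearMap.fst ℝ E ℂ) (extChartAt 𝓛 q q') := by
    have : (trivializationAt ℂ L q.proj).baseSet ∈ 𝓝 q.proj :=
      (trivializationAt ℂ L q.proj).open_baseSet.mem_nhds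
        (FiberBundle.mem_baseSet_trivializationAt' _)
    filter_upwards [(contMDiff_proj_real (E := E) q).continuousAt.preimage_mem_nhds this] with q' hq'
    exact (congrArg Prod.fst (extChartAt_totalSpace_apply (E := E) hq')).symm
  rw [hev.mfderiv_eq]
  have h := mfderiv_comp_apply (I := 𝓛) (I' := 𝓘(ℝ, E × ℂ)) (I'' := 𝓘(ℝ, E)) q
    (g := fun p : E × ℂ => ContinuousLinearMap.fst ℝ E ℂ p) (f := extChartAt 𝓛 q)
    (ContinuousLinearMap.fst ℝ E ℂ).differentiableAt.mdifferentiableAt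
    (mdifferentiableAt_extChartAt (mem_chart_source _ q)) v
  refine h.trans ?_
  rw [mfderiv_extChartAt_self, mfderiv_eq_fderiv, ContinuousLinearMap.fderiv]
  rfl

theorem contMDiff_fiberSMul_left (q : TotalSpace ℂ L) :
    ContMDiff 𝓘(ℝ, ℂ) 𝓛 ∞ (fun w : ℂ => fiberSMul w q) :=
  contMDiff_fiberSMul.comp (contMDiff_id.prodMk contMDiff_const)

theorem contMDiff_fiberSMul_right (w : ℂ) :
    ContMDiff 𝓛 𝓛 ∞ (fun q : TotalSpace ℂ L => fiberSMul w q) :=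
  contMDiff_fiberSMul.comp (contMDiff_const.prodMk contMDiff_id)

theorem mfderiv_fiberSMul_left (q : TotalSpace ℂ L) (w c : ℂ) :
    (mfderiv 𝓘(ℝ, ℂ) 𝓛 (fun w : ℂ => fiberSMul w q) w c : E × ℂ) = ((0 : E), c * ownCoord q) := by
  refine (mfderiv_eq_mfderiv_extChartAt_comp
    ((contMDiff_fiberSMul_left q w).mdifferentiableAt (by norm_num)) c).trans ?_
  have hev : ∀ y : ℂ, (extChartAt 𝓛 (fiberSMul w q) (fiberSMul y q) : E × ℂ) =
      (extChartAt 𝓘(ℝ, E) q.proj q.proj, y * ownCoord q) := by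
    intro y
    refine (extChartAt_totalSpace_apply (q := fiberSMul w q) (q' := fiberSMul y q)
      (FiberBundle.mem_baseSet_trivializationAt' q.proj)).trans ?_
    exact congrArg (Prod.mk (extChartAt 𝓘(ℝ, E) q.proj q.proj))
      (trivializationAt_fiberSMul (q := q) (FiberBundle.mem_baseSet_trivializationAt' _) y)
  have key : ∀ (f : ℂ → E × ℂ) (a : E) (b : ℂ), (∀ y, f y = (a, y * b)) →
      (mfderiv 𝓘(ℝ, ℂ) 𝓘(ℝ, E × ℂ) f w c : E × ℂ) = ((0 : E), c * b) := by
    intro f a b hf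
    have hd : HasFDerivAt (𝕜 := ℝ) f
        ((0 : ℂ →L[ℝ] E).prod ((ContinuousLinearMap.mul ℝ ℂ).flip b)) w := by
      rw [show f = fun y => (a, y * b) from funext hf]
      exact (hasFDerivAt_const a w).prodMk ((ContinuousLinearMap.mul ℝ ℂ).flip b).hasFDerivAt
    exact DFunLike.congr_fun (mfderiv_eq_fderiv.trans hd.fderiv) c
  exact key _ _ _ hev

/-- The vertical vector `c q` at the point `q`. -/
def vertical (E : Type*) [NormedAddCommGroup E] {X : Type*} {L : X → Type*}
    [NormedSpace ℂ E] [TopologicalSpace X] [ChartedSpace E X]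
    [TopologicalSpace (TotalSpace ℂ L)] [∀ x, TopologicalSpace (L x)]
    [∀ x, AddCommGroup (L x)] [∀ x, Module ℂ (L x)] [FiberBundle ℂ L]
    (q : TotalSpace ℂ L) (c : ℂ) : TangentSpace (𝓘(ℝ, E).prod 𝓘(ℝ, ℂ)) q :=
  (((0 : E), c * ownCoord q) : E × ℂ)

theorem vertical_add (q : TotalSpace ℂ L) (c d : ℂ) :
    vertical E q (c + d) = vertical E q c + vertical E q d := by
  refine Prod.ext ?_ ?_
  · exact (add_zero (0 : E)).symm
  · exact add_mul c d _

theorem vertical_smul (q : TotalSpace ℂ L) (r : ℝ) (c : ℂ) :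
    vertical E q (r * c) = r • vertical E q c := by
  refine Prod.ext ?_ ?_
  · exact (smul_zero (M := ℝ) (A := E) r).symm
  · refine (mul_assoc (r : ℂ) c _).trans ?_
    exact (Complex.real_smul (x := r) (z := c * ownCoord q)).symm

theorem J_vertical (q : TotalSpace ℂ L) (c : ℂ) :
    J 𝓛 q (vertical E q c) = vertical E q (Complex.I * c) := by
  refine Prod.ext ?_ ?_
  · exact smul_zero (M := ℂ) (A := E) Complex.I
  · exact (mul_assoc Complex.I c _).symm

theorem tangentMap_fiberSMul_left (q : TotalSpace ℂ L) (w c : ℂ) :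
    tangentMap 𝓘(ℝ, ℂ) 𝓛 (fun w : ℂ => fiberSMul w q) ⟨w, c⟩ =
      ⟨fiberSMul w q, (((0 : E), c * ownCoord q) : E × ℂ)⟩ :=
  congrArg (fun v => (⟨fiberSMul w q, v⟩ : TangentBundle 𝓛 (TotalSpace ℂ L)))
    (mfderiv_fiberSMul_left q w c)

theorem tangentMap_fiberSMul_left_one (q : TotalSpace ℂ L) (c : ℂ) :
    tangentMap 𝓘(ℝ, ℂ) 𝓛 (fun w : ℂ => fiberSMul w q) ⟨1, c⟩ = ⟨q, vertical E q c⟩ :=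
  (tangentMap_fiberSMul_left q 1 c).trans (mk_eq_mk (I := 𝓛) (fiberSMul_one q) _)

/-- `vertical` measures a vector relative to its own base point: `c q`, attached at `w q`, is `(c /
w)` times `w q`. -/
theorem tangentMap_fiberSMul_left' (q : TotalSpace ℂ L) {w : ℂ} (hw : w ≠ 0) (c : ℂ) :
    tangentMap 𝓘(ℝ, ℂ) 𝓛 (fun w : ℂ => fiberSMul w q) ⟨w, c⟩ =
      ⟨fiberSMul w q, vertical E (fiberSMul w q) (c / w)⟩ := by
  refine (tangentMap_fiberSMul_left q w c).trans ?_
  refine congrArg (fun v => (⟨fiberSMul w q, v⟩ : TangentBundle 𝓛 (TotalSpace ℂ L))) ?_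
  refine Prod.ext rfl ?_
  change c * ownCoord q = c / w * ownCoord (fiberSMul w q)
  rw [ownCoord_fiberSMul]
  field_simp

theorem circleField_eq (q : TotalSpace ℂ L) : circleField E q = vertical E q Complex.I := by
  have he : HasDerivAt (fun t : ℝ => Complex.exp (t * Complex.I)) Complex.I 0 := by
    have h1 : HasDerivAt (fun t : ℝ => (t : ℂ) * Complex.I) Complex.I 0 := by
      simpa using (Complex.ofRealCLM.hasDerivAt (x := (0 : ℝ))).mul_const Complex.I
    simpa using h1.cexp
  have h := mfderiv_comp_apply (I := 𝓘(ℝ, ℝ)) (I' := 𝓘(ℝ, ℂ)) (I'' := 𝓛) (0 : ℝ)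
    (g := fun w : ℂ => fiberSMul w q) (f := fun t : ℝ => Complex.exp (t * Complex.I))
    ((contMDiff_fiberSMul_left q _).mdifferentiableAt (by norm_num))
    he.differentiableAt.mdifferentiableAt (1 : ℝ)
  refine h.trans ?_
  refine (mfderiv_fiberSMul_left q _ _).trans ?_
  refine Prod.ext rfl (congrArg (fun c : ℂ => c * ownCoord q) ?_)
  refine (DFunLike.congr_fun mfderiv_eq_fderiv (1 : ℝ)).trans ?_
  exact he.deriv

theorem ownCoord_ne_zero {q : TotalSpace ℂ L} (hq : q.snd ≠ 0) : ownCoord q ≠ 0 := by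
  intro h
  apply hq
  have := (((trivializationAt ℂ L q.proj).continuousLinearEquivAt ℂ q.proj
    (FiberBundle.mem_baseSet_trivializationAt' _)).map_eq_zero_iff (x := q.2))
  exact this.1 h

theorem eq_vertical {q : TotalSpace ℂ L} (hq : q.snd ≠ 0) {v : TangentSpace 𝓛 q}
    (hv : (v : E × ℂ).1 = 0) : v = vertical E q ((v : E × ℂ).2 / ownCoord q) := by
  refine Prod.ext hv ?_
  exact (div_mul_cancel₀ _ (ownCoord_ne_zero hq)).symm

end LineBundle

/-! ### Equivariance of the fibre structure -/

section EquivariantLineBundle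

variable {F : Type*} [NormedAddCommGroup F] [NormedSpace ℝ F]
  {G : Type*} [TopologicalSpace G] [ChartedSpace F G] [Group G] [LieGroup 𝓘(ℝ, F) ∞ G]
  {E : Type*} [NormedAddCommGroup E] [NormedSpace ℂ E]
  {X : Type*} [TopologicalSpace X] [ChartedSpace E X] [IsManifold 𝓘(ℂ, E) ω X] [MulAction G X]
  {L : X → Type*} [TopologicalSpace (TotalSpace ℂ L)] [∀ x, TopologicalSpace (L x)]
  [∀ x, AddCommGroup (L x)] [∀ x, Module ℂ (L x)] [FiberBundle ℂ L] [VectorBundle ℂ ℂ L]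
  [ContMDiffVectorBundle ω ℂ L 𝓘(ℂ, E)] [MulAction G (TotalSpace ℂ L)]

local notation "𝓛" => ModelWithCorners.prod 𝓘(ℝ, E) 𝓘(ℝ, ℂ)

theorem IsEquivariantLineBundle.proj_smul (hL : IsEquivariantLineBundle F G E L) (g : G)
    (q : TotalSpace ℂ L) : (g • q).proj = g • q.proj := by
  obtain ⟨φ, hφ⟩ := hL.linear g q.proj
  exact congrArg TotalSpace.proj (hφ q.2)

theorem IsEquivariantLineBundle.smul_fiberSMul (hL : IsEquivariantLineBundle F G E L) (g : G)
    (z : ℂ) (q : TotalSpace ℂ L) : g • fiberSMul z q = fiberSMul z (g • q) := by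
  obtain ⟨φ, hφ⟩ := hL.linear g q.proj
  have h1 : g • q = ⟨g • q.proj, φ q.2⟩ := hφ q.2
  have h2 : g • fiberSMul z q = ⟨g • q.proj, φ (z • q.2)⟩ := hφ (z • q.2)
  rw [h1, h2, map_smul]
  rfl

/-- If `g q` lies in the zero section, then `g q = 0 · (g q) = g (0 · q)`, hence `q = 0 · q`. -/
theorem IsEquivariantLineBundle.smul_snd_ne_zero (hL : IsEquivariantLineBundle F G E L) (g : G)
    {q : TotalSpace ℂ L} (hq : q.snd ≠ 0) : (g • q).snd ≠ 0 := by
  intro h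
  have h0 : g • q = fiberSMul 0 (g • q) := by
    refine TotalSpace.ext rfl (heq_of_eq ?_)
    exact h.trans (zero_smul ℂ _).symm
  rw [← hL.smul_fiberSMul, smul_left_cancel_iff] at h0
  apply hq
  rw [h0]
  exact zero_smul ℂ _

theorem IsEquivariantLineBundle.tangentMap_smul_vertical (hL : IsEquivariantLineBundle F G E L)
    (g : G) (q : TotalSpace ℂ L) (w c : ℂ) :
    tangentMap 𝓛 𝓛 (fun q : TotalSpace ℂ L => g • q)
        (tangentMap 𝓘(ℝ, ℂ) 𝓛 (fun w : ℂ => fiberSMul w q) ⟨w, c⟩) =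
      tangentMap 𝓘(ℝ, ℂ) 𝓛 (fun w : ℂ => fiberSMul w (g • q)) ⟨w, c⟩ := by
  have h := tangentMap_comp_at (I := 𝓘(ℝ, ℂ)) (I' := 𝓛) (I'' := 𝓛)
    (⟨w, c⟩ : TangentBundle 𝓘(ℝ, ℂ) ℂ) (g := fun q : TotalSpace ℂ L => g • q)
    (f := fun w : ℂ => fiberSMul w q)
    ((contMDiff_smul_left hL.smooth g).mdifferentiable (by norm_num) _)
    ((contMDiff_fiberSMul_left q w).mdifferentiableAt (by norm_num))
  rw [← h]
  congr 1
  funext w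
  exact hL.smul_fiberSMul g w q

theorem IsEquivariantLineBundle.fundamentalVector_fst (hL : IsEquivariantLineBundle F G E L)
    (A : GroupLieAlgebra 𝓘(ℝ, F) G) (q : TotalSpace ℂ L) :
    (fundamentalVector 𝓛 A q : E × ℂ).1 = fundamentalVector 𝓘(ℝ, E) A q.proj := by
  have h1 := tangentMap_comp_at (I := 𝓘(ℝ, F)) (I' := 𝓛) (I'' := 𝓘(ℝ, E))
    (⟨1, A⟩ : TangentBundle 𝓘(ℝ, F) G) (g := fun q : TotalSpace ℂ L => q.proj)
    (f := fun g : G => g • q) (contMDiff_proj_real.mdifferentiable (by norm_num) _)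
    ((contMDiff_orbit hL.smooth q).mdifferentiable (by norm_num) _)
  have h2 : (fun q : TotalSpace ℂ L => q.proj) ∘ (fun g : G => g • q) =
      fun g : G => g • q.proj := funext fun g => hL.proj_smul g q
  rw [h2, tangentMap_orbit_one, tangentMap_orbit_one] at h1
  exact (mfderiv_proj q _).symm.trans (snd_eq_of_eq h1).symm

end EquivariantLineBundle

/-! ### The radial potential -/

section Potential

variable {E : Type*} [NormedAddCommGroup E] [NormedSpace ℂ E]
  {X : Type*} [TopologicalSpace X] [ChartedSpace E X] [IsManifold 𝓘(ℂ, E) ω X]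
  {L : X → Type*} [TopologicalSpace (TotalSpace ℂ L)] [∀ x, TopologicalSpace (L x)]
  [∀ x, AddCommGroup (L x)] [∀ x, Module ℂ (L x)] [FiberBundle ℂ L] [VectorBundle ℂ ℂ L]
  [ContMDiffVectorBundle ω ℂ L 𝓘(ℂ, E)]

local notation "𝓛" => ModelWithCorners.prod 𝓘(ℝ, E) 𝓘(ℝ, ℂ)

theorem contMDiff_tangentMap_fiberSMul {V₁ H₁ : Type*} [NormedAddCommGroup V₁] [NormedSpace ℝ V₁]
    [TopologicalSpace H₁] {I₁ : ModelWithCorners ℝ V₁ H₁} {N : Type*} [TopologicalSpace N]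
    [ChartedSpace H₁ N] {w : N → ℂ} (hw : ContMDiff I₁ 𝓘(ℝ, ℂ) ∞ w) {x : N → TotalSpace ℂ L}
    (hx : ContMDiff I₁ 𝓛 ∞ x) (c : ℂ) :
    ContMDiff I₁ (ModelWithCorners.tangent 𝓛) ∞
      (fun n => tangentMap 𝓘(ℝ, ℂ) 𝓛 (fun w : ℂ => fiberSMul w (x n)) ⟨w n, c⟩) := by
  have h0 := (contMDiff_constField c).comp hw
  have h1 : ContMDiff I₁ (ModelWithCorners.tangent 𝓛) ∞
      (fun n => (⟨x n, (0 : E × ℂ)⟩ : TangentBundle 𝓛 (TotalSpace ℂ L))) :=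
    (contMDiff_zeroSection ℝ (TangentSpace 𝓛 (M := TotalSpace ℂ L))).comp hx
  have h2 := (contMDiff_tangentMap (contMDiff_fiberSMul (E := E) (L := L))).comp
    (contMDiffOn_univ.1 (contMDiffOn_tangentBundleProd h0.contMDiffOn h1.contMDiffOn))
  refine h2.congr fun n => ?_
  have h := mfderiv_prod_eq_add_apply (p := (w n, x n)) (v := ((c, 0) : ℂ × (E × ℂ)))
    ((contMDiff_fiberSMul (E := E) (L := L)).mdifferentiableAt (by norm_num) (x := (w n, x n)))
  refine congrArg (fun v => (⟨fiberSMul (w n) (x n), v⟩ :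
    TangentBundle 𝓛 (TotalSpace ℂ L))) (Eq.trans ?_ h.symm)
  refine (add_eq_left.2 ?_).symm
  exact ((mfderiv 𝓛 𝓛 (fun z => fiberSMul (w n) z) (x n)).map_zero)

theorem tangentMap_fiberSMul_fiberSMul (q : TotalSpace ℂ L) (w t c : ℂ) :
    tangentMap 𝓘(ℝ, ℂ) 𝓛 (fun w : ℂ => fiberSMul w (fiberSMul t q)) ⟨w, c⟩ =
      tangentMap 𝓘(ℝ, ℂ) 𝓛 (fun w : ℂ => fiberSMul w q) ⟨w * t, (c * t : ℂ)⟩ := by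
  refine (tangentMap_fiberSMul_left (fiberSMul t q) w c).trans
    (Eq.trans ?_ (tangentMap_fiberSMul_left q (w * t) (c * t)).symm)
  rw [fiberSMul_fiberSMul, ownCoord_fiberSMul, mul_assoc]

theorem form1_tangentMap_fiberSMul_smul (θ : DiffForm 𝓛 (TotalSpace ℂ L) 1) (q : TotalSpace ℂ L)
    (w c : ℂ) (r : ℝ) :
    form1 θ (tangentMap 𝓘(ℝ, ℂ) 𝓛 (fun w : ℂ => fiberSMul w q) ⟨w, (c * (r : ℂ) : ℂ)⟩) =
      r * form1 θ (tangentMap 𝓘(ℝ, ℂ) 𝓛 (fun w : ℂ => fiberSMul w q) ⟨w, c⟩) := by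
  have h := (mfderiv 𝓘(ℝ, ℂ) 𝓛 (fun w : ℂ => fiberSMul w q) w).map_smul r c
  have h2 : (r • c : ℂ) = c * r := by simp [mul_comm]
  rw [← form1_smul]
  refine congrArg (fun v => form1 θ ⟨fiberSMul w q, v⟩) (Eq.trans ?_ h)
  exact congrArg (mfderiv 𝓘(ℝ, ℂ) 𝓛 (fun w : ℂ => fiberSMul w q) w) h2.symm

/-- The integral of a 1-form over the circle directions along the segment from the zero section. -/
def radialPotential (θ : DiffForm 𝓛 (TotalSpace ℂ L) 1) (q : TotalSpace ℂ L) : ℝ :=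
  ∫ s in Icc (0 : ℝ) 1,
    form1 θ (tangentMap 𝓘(ℝ, ℂ) 𝓛 (fun w : ℂ => fiberSMul w q) ⟨(s : ℂ), Complex.I⟩)

/-- The integrand evaluates `θ` on `iq` at the point `sq`. For `s ≠ 0` this is `s⁻¹ X₀`, but as the
derivative of `w ↦ wq` it is smooth at `s = 0` as well, so the potential is smooth across the zero
section. -/
theorem contMDiff_radialPotential [FiniteDimensional ℂ E] {θ : DiffForm 𝓛 (TotalSpace ℂ L) 1}
    (hθ : IsSmoothForm θ) : ContMDiff 𝓛 𝓘(ℝ, ℝ) ∞ (radialPotential θ) := by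
  have : FiniteDimensional ℝ E := FiniteDimensional.complexToReal E
  refine contMDiff_setIntegral (K := ℝ) (F := ℝ) isCompact_Icc (by simp) (f := fun a =>
    form1 θ (tangentMap 𝓘(ℝ, ℂ) 𝓛 (fun w : ℂ => fiberSMul w a.2) ⟨(a.1 : ℂ), Complex.I⟩)) ?_
  refine (form1_contMDiff hθ).comp (contMDiff_tangentMap_fiberSMul ?_ contMDiff_snd Complex.I)
  exact Complex.ofRealCLM.contDiff.contMDiff.comp contMDiff_fst

/-- The substitution `s ↦ st` turns scaling of the point into a variable upper limit, ready for the
fundamental theorem of calculus. -/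
theorem radialPotential_fiberSMul (θ : DiffForm 𝓛 (TotalSpace ℂ L) 1) (q : TotalSpace ℂ L)
    (t : ℝ) : radialPotential θ (fiberSMul (t : ℂ) q) = ∫ s in (0 : ℝ)..t,
      form1 θ (tangentMap 𝓘(ℝ, ℂ) 𝓛 (fun w : ℂ => fiberSMul w q) ⟨(s : ℂ), Complex.I⟩) := by
  unfold radialPotential
  rw [integral_Icc_eq_integral_Ioc, ← intervalIntegral.integral_of_le zero_le_one]
  have := intervalIntegral.smul_integral_comp_mul_right (a := 0) (b := 1) (fun s : ℝ =>
    form1 θ (tangentMap 𝓘(ℝ, ℂ) 𝓛 (fun w : ℂ => fiberSMul w q) ⟨(s : ℂ), Complex.I⟩)) t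
  rw [zero_mul, one_mul] at this
  rw [← this, ← intervalIntegral.integral_smul]
  refine intervalIntegral.integral_congr fun s _ => ?_
  rw [tangentMap_fiberSMul_fiberSMul, form1_tangentMap_fiberSMul_smul, smul_eq_mul,
    Complex.ofReal_mul]

/-- Differentiating `Φ(tq)` at `t = 1` gives `dΦ(R) = θ(X₀)`, and `d^c Φ(X₀) = -dΦ(J X₀) = dΦ(R)`
because `J X₀ = -R`. -/
theorem form1_dc_radialPotential [FiniteDimensional ℂ E] {θ : DiffForm 𝓛 (TotalSpace ℂ L) 1}
    (hθ : IsSmoothForm θ) (q : TotalSpace ℂ L) :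
    form1 (dc 𝓛 (radialPotential θ)) ⟨q, vertical E q Complex.I⟩ =
      form1 θ ⟨q, vertical E q Complex.I⟩ := by
  set k : ℝ → ℝ := fun s =>
    form1 θ (tangentMap 𝓘(ℝ, ℂ) 𝓛 (fun w : ℂ => fiberSMul w q) ⟨(s : ℂ), Complex.I⟩) with hk
  have hkc : Continuous k := by
    have := (form1_contMDiff hθ).comp (contMDiff_tangentMap_fiberSMul (I₁ := 𝓘(ℝ, ℝ))
      (Complex.ofRealCLM.contDiff.contMDiff) (x := fun _ => q) contMDiff_const Complex.I)
    exact this.continuous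
  have h1 : HasDerivAt (fun t : ℝ => radialPotential θ (fiberSMul (t : ℂ) q)) (k 1) 1 := by
    refine (intervalIntegral.integral_hasDerivAt_right (hkc.intervalIntegrable 0 1)
      (hkc.stronglyMeasurableAtFilter _ _) hkc.continuousAt).congr_of_eventuallyEq ?_
    exact Eventually.of_forall fun t => radialPotential_fiberSMul θ q t
  have hΦ := (contMDiff_radialPotential hθ).mdifferentiableAt (x := q) (by norm_num)
  have hk1 : k 1 = form1 θ ⟨q, vertical E q Complex.I⟩ := by
    refine Eq.trans ?_ (congrArg (form1 θ) (tangentMap_fiberSMul_left_one (E := E) q Complex.I))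
    simp [hk]
  have h2 : mfderiv 𝓛 𝓘(ℝ, ℝ) (radialPotential θ) q (vertical E q 1) = k 1 := by
    have e1 := tangentMap_comp_at (I := 𝓘(ℝ, ℝ)) (I' := 𝓘(ℝ, ℂ)) (I'' := 𝓛)
      (⟨(1 : ℝ), (1 : ℝ)⟩ : TangentBundle 𝓘(ℝ, ℝ) ℝ) (g := fun w : ℂ => fiberSMul w q)
      (f := fun t : ℝ => (t : ℂ)) ((contMDiff_fiberSMul_left q _).mdifferentiableAt (by norm_num))
      (Complex.ofRealCLM.differentiableAt.mdifferentiableAt)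
    have e2 := tangentMap_comp_at (I := 𝓘(ℝ, ℝ)) (I' := 𝓛) (I'' := 𝓘(ℝ, ℝ))
      (⟨(1 : ℝ), (1 : ℝ)⟩ : TangentBundle 𝓘(ℝ, ℝ) ℝ) (g := radialPotential θ)
      (f := (fun w : ℂ => fiberSMul w q) ∘ fun t : ℝ => (t : ℂ))
      ((contMDiff_radialPotential hθ).mdifferentiableAt (by norm_num))
      ((ContMDiff.comp (contMDiff_fiberSMul_left q)
        (Complex.ofRealCLM.contDiff (n := ∞)).contMDiff).mdifferentiableAt (by norm_num))
    have e3 : tangentMap 𝓘(ℝ, ℝ) 𝓘(ℝ, ℂ) (fun t : ℝ => (t : ℂ))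
        (⟨(1 : ℝ), (1 : ℝ)⟩ : TangentBundle 𝓘(ℝ, ℝ) ℝ) = ⟨(1 : ℂ), (1 : ℂ)⟩ := by
      refine Eq.trans (congrArg (fun v : ℂ => (⟨((1 : ℝ) : ℂ), v⟩ : TangentBundle 𝓘(ℝ, ℂ) ℂ))
        (?_ : _ = (1 : ℂ))) (mk_eq_mk (I := 𝓘(ℝ, ℂ)) Complex.ofReal_one (1 : ℂ))
      refine (DFunLike.congr_fun mfderiv_eq_fderiv (1 : ℝ)).trans ?_
      exact (DFunLike.congr_fun (Complex.ofRealCLM.hasFDerivAt (x := (1 : ℝ))).fderiv 1).trans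
        (by simp)
    rw [e1, e3, tangentMap_fiberSMul_left_one (E := E)] at e2
    refine (snd_eq_of_eq e2).symm.trans ?_
    refine (DFunLike.congr_fun mfderiv_eq_fderiv (1 : ℝ)).trans ?_
    exact h1.deriv
  rw [form1_dc, J_vertical, ← hk1, ← h2]
  have h3 := vertical_smul (E := E) q (-1) 1
  have h4 : (((-1 : ℝ) : ℂ) * 1) = Complex.I * Complex.I := by simp
  rw [h4] at h3
  rw [h3]
  have h5 := (mfderiv 𝓛 𝓘(ℝ, ℝ) (radialPotential θ) q).map_smul (-1 : ℝ) (vertical E q 1)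
  refine (congrArg (fun r : ℝ => -r) h5).trans ?_
  exact neg_eq_iff_eq_neg.2 (neg_one_smul ℝ (_ : ℝ))

end Potential

/-! ### Normalizing the primitive along the circle direction -/

section Invariant

variable {F : Type*} [NormedAddCommGroup F] [NormedSpace ℝ F]
  {G : Type*} [TopologicalSpace G] [ChartedSpace F G] [Group G] [LieGroup 𝓘(ℝ, F) ∞ G]
  {E : Type*} [NormedAddCommGroup E] [NormedSpace ℂ E]
  {X : Type*} [TopologicalSpace X] [ChartedSpace E X] [IsManifold 𝓘(ℂ, E) ω X] [MulAction G X]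
  {L : X → Type*} [TopologicalSpace (TotalSpace ℂ L)] [∀ x, TopologicalSpace (L x)]
  [∀ x, AddCommGroup (L x)] [∀ x, Module ℂ (L x)] [FiberBundle ℂ L] [VectorBundle ℂ ℂ L]
  [ContMDiffVectorBundle ω ℂ L 𝓘(ℂ, E)] [MulAction G (TotalSpace ℂ L)]

local notation "𝓛" => ModelWithCorners.prod 𝓘(ℝ, E) 𝓘(ℝ, ℂ)

theorem radialPotential_smul (hL : IsEquivariantLineBundle F G E L)
    {θ : DiffForm 𝓛 (TotalSpace ℂ L) 1} (hinv : IsInvariantForm G θ) (g : G)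
    (q : TotalSpace ℂ L) : radialPotential θ (g • q) = radialPotential θ q := by
  rw [isInvariantForm_iff] at hinv
  unfold radialPotential
  congr 1
  funext s
  rw [← hL.tangentMap_smul_vertical, hinv]

theorem exists_primitive_sub_dc [FiniteDimensional ℂ E] (hL : IsEquivariantLineBundle F G E L)
    {θ : DiffForm 𝓛 (TotalSpace ℂ L) 1} (hθ : IsSmoothForm θ) (hinv : IsInvariantForm G θ) :
    ∃ (Φ : TotalSpace ℂ L → ℝ) (θ' : DiffForm 𝓛 (TotalSpace ℂ L) 1), ContMDiff 𝓛 𝓘(ℝ, ℝ) ∞ Φ ∧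
      (∀ (g : G) (q : TotalSpace ℂ L), Φ (g • q) = Φ q) ∧ IsSmoothForm θ' ∧
      IsInvariantForm G θ' ∧ (∀ q, form1 θ' ⟨q, vertical E q Complex.I⟩ = 0) ∧
      extD θ' = fun q => extD θ q - ddc 𝓛 Φ q := by
  have : IsManifold (𝓘(ℂ, E).prod 𝓘(ℂ, ℂ)) 1 (TotalSpace ℂ L) := .of_le (n := ω) le_top
  have hΦ := contMDiff_radialPotential hθ
  have hd := isSmoothForm_dc (IC := 𝓘(ℂ, E).prod 𝓘(ℂ, ℂ)) rfl rfl hΦ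
  have hs := extD_sub hθ hd
  refine ⟨radialPotential θ, _, hΦ, radialPotential_smul hL hinv, hs.1, ?_, fun q => ?_, hs.2⟩
  · have hi := isInvariantForm_dc (IC := 𝓘(ℂ, E).prod 𝓘(ℂ, ℂ)) (I := 𝓛) rfl rfl hL.holomorphic hΦ
      (radialPotential_smul hL hinv)
    rw [isInvariantForm_iff] at hinv hi ⊢
    intro g p
    exact congrArg₂ (· - ·) (hinv g p) (hi g p)
  · exact sub_eq_zero.2 (form1_dc_radialPotential hθ q).symm

end Invariant

/-! ### The weight and the circle direction -/

section Weight

variable {F : Type*} [NormedAddCommGroup F] [NormedSpace ℝ F]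
  {G : Type*} [TopologicalSpace G] [ChartedSpace F G] [Group G] [LieGroup 𝓘(ℝ, F) ∞ G]
  {E : Type*} [NormedAddCommGroup E] [NormedSpace ℂ E]
  {X : Type*} [TopologicalSpace X] [ChartedSpace E X] [IsManifold 𝓘(ℂ, E) ω X] [MulAction G X]
  {L : X → Type*} [TopologicalSpace (TotalSpace ℂ L)] [∀ x, TopologicalSpace (L x)]
  [∀ x, AddCommGroup (L x)] [∀ x, Module ℂ (L x)] [FiberBundle ℂ L] [VectorBundle ℂ ℂ L]
  [ContMDiffVectorBundle ω ℂ L 𝓘(ℂ, E)] [MulAction G (TotalSpace ℂ L)]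

local notation "𝓛" => ModelWithCorners.prod 𝓘(ℝ, E) 𝓘(ℝ, ℂ)

theorem IsEquivariantLineBundle.tangentMap_fiberSMul_fundT (hL : IsEquivariantLineBundle F G E L)
    (z : ℂ) (A : GroupLieAlgebra 𝓘(ℝ, F) G) (q : TotalSpace ℂ L) :
    tangentMap 𝓛 𝓛 (fun q : TotalSpace ℂ L => fiberSMul z q) (fundT 𝓛 A q) =
      fundT 𝓛 A (fiberSMul z q) := by
  have h := tangentMap_comp_at (I := 𝓘(ℝ, F)) (I' := 𝓛) (I'' := 𝓛)
    (⟨1, A⟩ : TangentBundle 𝓘(ℝ, F) G) (g := fun q : TotalSpace ℂ L => fiberSMul z q)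
    (f := fun g : G => g • q)
    ((contMDiff_fiberSMul_right z).mdifferentiable (by norm_num) _)
    ((contMDiff_orbit hL.smooth q).mdifferentiable (by norm_num) _)
  have h2 : (fun q : TotalSpace ℂ L => fiberSMul z q) ∘ (fun g : G => g • q) =
      fun g : G => g • fiberSMul z q := funext fun g => (hL.smul_fiberSMul g z q).symm
  rw [h2, tangentMap_orbit_one, tangentMap_orbit_one] at h
  exact h.symm

theorem tangentMap_fiberSMul_vertical (z : ℂ) (q : TotalSpace ℂ L) (c : ℂ) :
    tangentMap 𝓛 𝓛 (fun q : TotalSpace ℂ L => fiberSMul z q) ⟨q, vertical E q c⟩ =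
      ⟨fiberSMul z q, vertical E (fiberSMul z q) c⟩ := by
  have h := tangentMap_comp_at (I := 𝓘(ℝ, ℂ)) (I' := 𝓛) (I'' := 𝓛)
    (⟨1, c⟩ : TangentBundle 𝓘(ℝ, ℂ) ℂ) (g := fun q : TotalSpace ℂ L => fiberSMul z q)
    (f := fun w : ℂ => fiberSMul w q)
    ((contMDiff_fiberSMul_right z).mdifferentiable (by norm_num) _)
    ((contMDiff_fiberSMul_left q 1).mdifferentiableAt (by norm_num))
  have h2 : (fun q : TotalSpace ℂ L => fiberSMul z q) ∘ (fun w : ℂ => fiberSMul w q) =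
      fun w : ℂ => fiberSMul w (fiberSMul z q) := by
    funext w
    change fiberSMul z (fiberSMul w q) = _
    rw [fiberSMul_fiberSMul, fiberSMul_fiberSMul, mul_comm]
  rw [h2, tangentMap_fiberSMul_left_one, tangentMap_fiberSMul_left_one] at h
  exact h.symm

theorem IsEquivariantLineBundle.fundamentalVector_snd (hL : IsEquivariantLineBundle F G E L)
    (A : GroupLieAlgebra 𝓘(ℝ, F) G) (q : TotalSpace ℂ L) :
    (fundamentalVector 𝓛 A q : E × ℂ).2 = fiberCoordDeriv q A := by
  have hd := (contMDiff_orbit hL.smooth q).mdifferentiable (by norm_num) (1 : G)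
  have h1 : (fundamentalVector 𝓛 A q : E × ℂ) =
      mfderiv 𝓘(ℝ, F) 𝓘(ℝ, E × ℂ) (fun g : G => extChartAt 𝓛 q (g • q)) 1 A :=
    (mfderiv_eq_mfderiv_extChartAt_comp hd A).trans
      (congrArg (fun q' => (mfderiv 𝓘(ℝ, F) 𝓘(ℝ, E × ℂ)
        (fun g : G => extChartAt 𝓛 q' (g • q)) 1 A : E × ℂ)) (one_smul G q))
  have hc : MDifferentiableAt 𝓘(ℝ, F) 𝓘(ℝ, E × ℂ) (fun g : G => extChartAt 𝓛 q (g • q)) 1 := by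
    have hq : MDifferentiableAt 𝓛 𝓘(ℝ, E × ℂ) (extChartAt 𝓛 q) ((1 : G) • q) := by
      rw [one_smul]; exact mdifferentiableAt_extChartAt (mem_chart_source _ q)
    exact hq.comp (1 : G) hd
  have h2 := mfderiv_comp_apply (I := 𝓘(ℝ, F)) (I' := 𝓘(ℝ, E × ℂ)) (I'' := 𝓘(ℝ, ℂ)) (1 : G)
    (g := fun p : E × ℂ => ContinuousLinearMap.snd ℝ E ℂ p)
    (f := fun g : G => extChartAt 𝓛 q (g • q))
    (ContinuousLinearMap.snd ℝ E ℂ).differentiableAt.mdifferentiableAt hc A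
  rw [mfderiv_eq_fderiv, ContinuousLinearMap.fderiv] at h2
  have h3 : ((fun p : E × ℂ => ContinuousLinearMap.snd ℝ E ℂ p) ∘
      fun g : G => extChartAt 𝓛 q (g • q)) = fiberCoord q := by
    funext g
    simp only [FiberBundle.extChartAt]
    rfl
  rw [h3] at h2
  exact (congrArg Prod.snd h1).trans h2.symm

theorem fiberCoord_one (q : TotalSpace ℂ L) : fiberCoord q (1 : G) = ownCoord q := by
  simp [fiberCoord, ownCoord]

theorem IsInvariantHermitianNormSq.mfderiv_fundamentalVector
    (hL : IsEquivariantLineBundle F G E L) {N : TotalSpace ℂ L → ℝ}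
    (hN : IsInvariantHermitianNormSq G E N) (A : GroupLieAlgebra 𝓘(ℝ, F) G)
    (q : TotalSpace ℂ L) : (mfderiv 𝓛 𝓘(ℝ, ℝ) N q (fundamentalVector 𝓛 A q) : ℝ) = 0 := by
  have h := tangentMap_comp_at (I := 𝓘(ℝ, F)) (I' := 𝓛) (I'' := 𝓘(ℝ, ℝ))
    (⟨1, A⟩ : TangentBundle 𝓘(ℝ, F) G) (g := N) (f := fun g : G => g • q)
    (hN.smooth.mdifferentiable (by norm_num) _)
    ((contMDiff_orbit hL.smooth q).mdifferentiable (by norm_num) _)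
  have h2 : N ∘ (fun g : G => g • q) = fun _ => N q := funext fun g => hN.invariant g q
  rw [h2, tangentMap_orbit_one] at h
  refine (snd_eq_of_eq h).symm.trans ?_
  exact DFunLike.congr_fun (mfderiv_const (I := 𝓘(ℝ, F)) (I' := 𝓘(ℝ, ℝ)) (c := N q)) A

theorem IsInvariantHermitianNormSq.mfderiv_vertical {N : TotalSpace ℂ L → ℝ}
    (hN : IsInvariantHermitianNormSq G E N) (q : TotalSpace ℂ L) (c : ℂ) :
    (mfderiv 𝓛 𝓘(ℝ, ℝ) N q (vertical E q c) : ℝ) = 2 * c.re * N q := by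
  have h := tangentMap_comp_at (I := 𝓘(ℝ, ℂ)) (I' := 𝓛) (I'' := 𝓘(ℝ, ℝ))
    (⟨1, c⟩ : TangentBundle 𝓘(ℝ, ℂ) ℂ) (g := N) (f := fun w : ℂ => fiberSMul w q)
    (hN.smooth.mdifferentiable (by norm_num) _)
    ((contMDiff_fiberSMul_left q 1).mdifferentiableAt (by norm_num))
  have h2 : N ∘ (fun w : ℂ => fiberSMul w q) = fun w => ‖w‖ ^ 2 * N q :=
    funext fun w => hN.homogeneous w q
  rw [h2, tangentMap_fiberSMul_left_one] at h
  refine (snd_eq_of_eq h).symm.trans ?_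
  have hd : HasFDerivAt (𝕜 := ℝ) (fun w : ℂ => ‖w‖ ^ 2 * N q) (N q • (2 • innerSL ℝ (1 : ℂ))) 1 :=
    (hasStrictFDerivAt_norm_sq (1 : ℂ)).hasFDerivAt.mul_const (N q)
  refine (DFunLike.congr_fun (mfderiv_eq_fderiv.trans hd.fderiv) c).trans ?_
  change N q * (2 • inner ℝ (1 : ℂ) c) = 2 * c.re * N q
  rw [Complex.inner]
  simp only [map_one, mul_one, nsmul_eq_mul]
  push_cast
  ring

theorem snd_ne_zero_of_mem_circleBundle {N : TotalSpace ℂ L → ℝ}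
    (hN : IsInvariantHermitianNormSq G E N) {q : TotalSpace ℂ L} (hq : q ∈ circleBundle N) :
    q.snd ≠ 0 := by
  intro h
  have h0 : fiberSMul 0 q = q := by
    refine TotalSpace.ext rfl (heq_of_eq ?_)
    exact (zero_smul ℂ _).trans h.symm
  have h1 := hN.homogeneous 0 q
  rw [h0] at h1
  have h2 : N q = 1 := hq
  rw [h2] at h1
  norm_num at h1

variable [CompleteSpace F]

/-- An isotropic element moves `q` only inside its fibre, and there at the rate given by the weight.
-/
theorem fundamentalVector_of_mem (hL : IsEquivariantLineBundle F G E L) {q : TotalSpace ℂ L}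
    (hq : q.snd ≠ 0) (𝔱 : LieSubalgebra ℝ (GroupLieAlgebra 𝓘(ℝ, F) G))
    (h𝔱 : ∀ A ∈ 𝔱, IsIsotropic F G E q.proj A) (T : 𝔱) :
    fundamentalVector 𝓛 (T : GroupLieAlgebra 𝓘(ℝ, F) G) q = vertical E q (weight 𝔱 q T) := by
  have h1 : (fundamentalVector 𝓛 (T : GroupLieAlgebra 𝓘(ℝ, F) G) q : E × ℂ).1 = 0 :=
    (hL.fundamentalVector_fst T q).trans (h𝔱 T T.2)
  rw [eq_vertical hq h1, hL.fundamentalVector_snd]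
  congr 1
  change _ = (fiberCoord q (1 : G))⁻¹ * fiberCoordDeriv q (T : GroupLieAlgebra 𝓘(ℝ, F) G)
  rw [fiberCoord_one, div_eq_inv_mul]

/-- Some element of the Cartan subalgebra generates the circle action on the fibre. -/
theorem exists_weight_eq_I (hL : IsEquivariantLineBundle F G E L) {N : TotalSpace ℂ L → ℝ}
    (hN : IsInvariantHermitianNormSq G E N) {q : TotalSpace ℂ L} (hq : q ∈ circleBundle N)
    (𝔱 : LieSubalgebra ℝ (GroupLieAlgebra 𝓘(ℝ, F) G))
    (h𝔱 : ∀ A ∈ 𝔱, IsIsotropic F G E q.proj A) (hw : weight 𝔱 q ≠ 0) :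
    ∃ T : 𝔱, weight 𝔱 q T = Complex.I ∧
      fundT 𝓛 (T : GroupLieAlgebra 𝓘(ℝ, F) G) q = ⟨q, vertical E q Complex.I⟩ := by
  have hq0 := snd_ne_zero_of_mem_circleBundle hN hq
  obtain ⟨T, hT⟩ : ∃ T, weight 𝔱 q T ≠ 0 := by
    by_contra! h
    exact hw (LinearMap.ext h)
  -- The norm is invariant, so `0 = dN(T^#) = 2 Re λ(T) N(q)`, and `N(q) = 1`.
  have hre : (weight 𝔱 q T).re = 0 := by
    have h := hN.mfderiv_fundamentalVector hL (T : GroupLieAlgebra 𝓘(ℝ, F) G) q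
    rw [fundamentalVector_of_mem hL hq0 𝔱 h𝔱, hN.mfderiv_vertical, show N q = 1 from hq] at h
    have h' : 2 * (weight 𝔱 q T).re * (1 : ℝ) = 0 := h
    generalize (weight 𝔱 q T).re = x at h' ⊢
    linarith
  have him : (weight 𝔱 q T).im ≠ 0 := fun h => hT (Complex.ext hre h)
  have hI : weight 𝔱 q ((weight 𝔱 q T).im⁻¹ • T) = Complex.I := by
    rw [map_smul]
    apply Complex.ext
    · simp [hre]
    · simp [him]
  refine ⟨(weight 𝔱 q T).im⁻¹ • T, hI, ?_⟩
  refine congrArg (fun v => (⟨q, v⟩ : TangentBundle 𝓛 (TotalSpace ℂ L))) ?_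
  rw [fundamentalVector_of_mem hL hq0 𝔱 h𝔱, hI]

/-- Multiplication by `z` commutes with `G` and preserves `vertical`. This carries identities from
the circle bundle, where the hypotheses live, to all of `L`. -/
theorem fundT_fiberSMul_of_eq_vertical (hL : IsEquivariantLineBundle F G E L)
    {q : TotalSpace ℂ L} {A : GroupLieAlgebra 𝓘(ℝ, F) G} {c : ℂ}
    (h : fundT 𝓛 A q = ⟨q, vertical E q c⟩) (z : ℂ) :
    fundT 𝓛 A (fiberSMul z q) = ⟨fiberSMul z q, vertical E (fiberSMul z q) c⟩ := by
  rw [← hL.tangentMap_fiberSMul_fundT, h, tangentMap_fiberSMul_vertical]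

end Weight

/-! ### The adjoint representation -/

section Adjoint

variable {F : Type*} [NormedAddCommGroup F] [NormedSpace ℝ F]
  {G : Type*} [TopologicalSpace G] [ChartedSpace F G] [Group G] [LieGroup 𝓘(ℝ, F) ∞ G]

theorem Ad_one (A : GroupLieAlgebra 𝓘(ℝ, F) G) : Ad (1 : G) A = A := by
  have key : ∀ f : G → G, f = id → mfderiv 𝓘(ℝ, F) 𝓘(ℝ, F) f 1 A = A := by
    rintro f rfl; rw [mfderiv_id]; rfl
  exact key _ (funext fun g => by simp)

theorem Ad_mul (g h : G) (A : GroupLieAlgebra 𝓘(ℝ, F) G) : Ad (g * h) A = Ad g (Ad h A) := by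
  have e := tangentMap_comp_at (I' := 𝓘(ℝ, F)) (I'' := 𝓘(ℝ, F))
    (⟨1, A⟩ : TangentBundle 𝓘(ℝ, F) G)
    ((contMDiff_conj (F := F) g).mdifferentiable (by norm_num) _)
    ((contMDiff_conj (F := F) h).mdifferentiable (by norm_num) _)
  have h1 : (fun x : G => g * x * g⁻¹) ∘ (fun x : G => h * x * h⁻¹) =
      fun x : G => (g * h) * x * (g * h)⁻¹ := by
    funext x; simp [mul_assoc]
  rw [h1, tangentMap_conj, tangentMap_conj, tangentMap_conj] at e
  exact snd_eq_of_eq e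

theorem contMDiff_Ad (A : GroupLieAlgebra 𝓘(ℝ, F) G) :
    ContMDiff (M' := F) 𝓘(ℝ, F) 𝓘(ℝ, F) ∞ (fun g : G => Ad g A) := by
  have hc : ContMDiff (𝓘(ℝ, F).prod 𝓘(ℝ, F)) 𝓘(ℝ, F) ∞ (fun a : G × G => a.1 * a.2 * a.1⁻¹) :=
    (contMDiff_fst.mul contMDiff_snd).mul contMDiff_fst.inv
  have h0 : ContMDiff 𝓘(ℝ, F) 𝓘(ℝ, F).tangent ∞
      (fun g : G => (⟨g, (0 : F)⟩ : TangentBundle 𝓘(ℝ, F) G)) :=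
    contMDiff_zeroSection ℝ (TangentSpace 𝓘(ℝ, F) (M := G))
  have h1 : ContMDiff 𝓘(ℝ, F) 𝓘(ℝ, F).tangent ∞
      (fun _ : G => (⟨1, A⟩ : TangentBundle 𝓘(ℝ, F) G)) := contMDiff_const
  have h2 := (contMDiff_tangentMap hc).comp
    (contMDiffOn_univ.1 (contMDiffOn_tangentBundleProd h0.contMDiffOn h1.contMDiffOn))
  have h3 : ContMDiff 𝓘(ℝ, F) 𝓘(ℝ, F).tangent ∞
      (fun g : G => (⟨1, Ad g A⟩ : TangentBundle 𝓘(ℝ, F) G)) := by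
    refine h2.congr fun g => ?_
    refine (tangentMap_conj g A).symm.trans ?_
    have h := mfderiv_prod_eq_add_apply (p := (g, (1 : G))) (v := ((0, A) : F × F))
      (hc.mdifferentiableAt (by norm_num) (x := (g, (1 : G))))
    refine congrArg (fun v => (⟨g * 1 * g⁻¹, v⟩ : TangentBundle 𝓘(ℝ, F) G))
      (Eq.trans ?_ h.symm)
    refine (add_eq_right.2 ?_).symm
    exact (mfderiv 𝓘(ℝ, F) 𝓘(ℝ, F) (fun z : G => z * 1 * z⁻¹) g).map_zero
  intro g
  have h4 := (contMDiffAt_totalSpace.1 (h3 g)).2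
  refine ContMDiffAt.congr_of_eventuallyEq h4 (Eventually.of_forall fun m => ?_)
  simp only [TangentBundle.trivializationAt_apply]
  exact ((tangentBundleCore 𝓘(ℝ, F) G).coordChange_self (achart F (1 : G)) 1
    (mem_chart_source F 1) (Ad m A)).symm

end Adjoint

/-! ### Invariant inner products -/

section InnerProduct

variable {F : Type*} [NormedAddCommGroup F] [NormedSpace ℝ F] [FiniteDimensional ℝ F]
  {G : Type*} [TopologicalSpace G] [Group G] [IsTopologicalGroup G] [CompactSpace G] [T2Space G]

/-- A finite-dimensional representation of a compact group carries an invariant inner product,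
here in the form of an isomorphism onto the dual space. -/
theorem exists_invariant_innerProduct {ρ : G → F →ₗ[ℝ] F} (hone : ρ 1 = LinearMap.id)
    (hmul : ∀ g h A, ρ (g * h) A = ρ g (ρ h A)) (hcont : ∀ A, Continuous fun g => ρ g A) :
    ∃ e : F ≃ₗ[ℝ] Module.Dual ℝ F, (∀ g A B, e (ρ g A) (ρ g B) = e A B) ∧
      ∀ A, A ≠ 0 → 0 < e A A := by
  let _ : MeasurableSpace G := borel G
  have : BorelSpace G := ⟨rfl⟩
  let μ : Measure G := Measure.haarMeasure ⊤
  let b := Module.finBasis ℝ F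
  -- The integrand is the Euclidean product in the basis `b`, translated by `h⁻¹`.
  let f : F → F → G → ℝ := fun A B h => ∑ i, b.coord i (ρ h⁻¹ A) * b.coord i (ρ h⁻¹ B)
  have hf : ∀ A B, Continuous (f A B) := by
    intro A B
    have hco : ∀ i, Continuous (b.coord i) := fun i => LinearMap.continuous_of_finiteDimensional _
    exact continuous_finsetSum _ fun i _ =>
      ((hco i).comp ((hcont A).comp continuous_inv)).mul
        ((hco i).comp ((hcont B).comp continuous_inv))
  have hint : ∀ A B, Integrable (f A B) μ := fun A B =>
    (hf A B).integrable_of_hasCompactSupport (HasCompactSupport.of_compactSpace _)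
  let β : F →ₗ[ℝ] F →ₗ[ℝ] ℝ := LinearMap.mk₂ ℝ (fun A B => ∫ h, f A B h ∂μ)
    (fun A A' B => by
      rw [← integral_add (hint _ _) (hint _ _)]
      congr 1; funext h
      simp only [f, map_add, add_mul, Finset.sum_add_distrib])
    (fun c A B => by
      rw [smul_eq_mul, ← integral_const_mul]
      congr 1; funext h
      simp only [f, map_smul, smul_eq_mul, mul_assoc, Finset.mul_sum])
    (fun A B B' => by
      rw [← integral_add (hint _ _) (hint _ _)]
      congr 1; funext h
      simp only [f, map_add, mul_add, Finset.sum_add_distrib])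
    (fun c A B => by
      rw [smul_eq_mul, ← integral_const_mul]
      congr 1; funext h
      simp only [f, map_smul, smul_eq_mul, mul_left_comm, Finset.mul_sum])
  have hpos : ∀ A, A ≠ 0 → 0 < β A A := by
    intro A hA
    -- A continuous nonnegative function that is nonzero at `h = 1` has positive integral.
    have hnn : 0 ≤ f A A := fun h => Finset.sum_nonneg fun i _ => mul_self_nonneg _
    have hne : f A A 1 ≠ 0 := by
      intro h0
      apply hA
      have h1 := (Finset.sum_eq_zero_iff_of_nonneg fun i _ => mul_self_nonneg _).1 h0
      refine b.ext_elem fun i => ?_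
      have h2 := mul_self_eq_zero.1 (h1 i (Finset.mem_univ i))
      rw [inv_one, hone] at h2
      simpa using h2
    exact (hf A A).integral_pos_of_hasCompactSupport_nonneg_nonzero
      (HasCompactSupport.of_compactSpace _) hnn hne
  have hinj : Function.Injective β := by
    refine (injective_iff_map_eq_zero β).2 fun A hA => ?_
    by_contra hne
    have := hpos A hne
    rw [hA] at this
    exact lt_irrefl _ this
  refine ⟨LinearEquiv.ofInjectiveOfFinrankEq β hinj Subspace.dual_finrank_eq.symm,
    fun g A B => ?_, fun A hA => hpos A hA⟩
  change ∫ h, f _ _ h ∂μ = ∫ h, f A B h ∂μ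
  rw [← integral_mul_left_eq_self _ g]
  congr 1; funext h
  have hA : ∀ A : F, ρ (g * h)⁻¹ (ρ g A) = ρ h⁻¹ A := by
    intro A
    rw [← hmul]
    simp
  simp only [f, hA]

end InnerProduct

/-! ### The moment map of an invariant one-form -/

section MomentMap

variable {F : Type*} [NormedAddCommGroup F] [NormedSpace ℝ F]
  {G : Type*} [TopologicalSpace G] [ChartedSpace F G] [Group G] [LieGroup 𝓘(ℝ, F) ∞ G]
  {V H : Type*} [NormedAddCommGroup V] [NormedSpace ℂ V] [TopologicalSpace H]
  {I : ModelWithCorners ℝ V H} [I.Boundaryless]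
  {M : Type*} [TopologicalSpace M] [ChartedSpace H M] [IsManifold I ∞ M] [MulAction G M]

variable (F G) in
/-- The moment map of a 1-form: its values on the fundamental vector fields. -/
def momentMap (θ : DiffForm I M 1) (x : M) : Module.Dual ℝ F where
  toFun A := form1 θ (fundT I (G := G) A x)
  map_add' A B := (congrArg (fun v => form1 θ ⟨x, v⟩) (fundamentalVector_add (G := G) A B x)).trans
    (form1_add θ x _ _)
  map_smul' c A := (congrArg (fun v => form1 θ ⟨x, v⟩)
    (fundamentalVector_smul (G := G) c A x)).trans (form1_smul θ x c _)

theorem contMDiff_momentMap (hact : ContMDiff (𝓘(ℝ, F).prod I) I ∞ (fun a : G × M => a.1 • a.2))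
    {θ : DiffForm I M 1} (hθ : IsSmoothForm θ) (A : F) :
    ContMDiff I 𝓘(ℝ, ℝ) ∞ (fun x => momentMap F G θ x A) :=
  (form1_contMDiff hθ).comp (contMDiff_fundT (G := G) (I₁ := I) hact (C := fun _ => A) contMDiff_const contMDiff_id)

theorem momentMap_smul_Ad (hact : ContMDiff (𝓘(ℝ, F).prod I) I ∞ (fun a : G × M => a.1 • a.2))
    {θ : DiffForm I M 1} (hinv : IsInvariantForm G θ) (g : G) (x : M) (A : F) :
    momentMap F G θ (g • x) (Ad (F := F) g A : F) = momentMap F G θ x A := by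
  rw [isInvariantForm_iff] at hinv
  refine Eq.trans (congrArg (form1 θ) ?_) (hinv g (fundT I (G := G) A x))
  exact (tangentMap_smul_fundT hact g A x).symm

end MomentMap

/-! ### From the moment map to invariant vector fields; case (a) -/

section InvariantFields

variable {F : Type*} [NormedAddCommGroup F] [NormedSpace ℝ F]
  {G : Type*} [TopologicalSpace G] [ChartedSpace F G] [Group G] [LieGroup 𝓘(ℝ, F) ∞ G]
  {E : Type*} [NormedAddCommGroup E] [NormedSpace ℂ E]
  {X : Type*} [TopologicalSpace X] [ChartedSpace E X] [IsManifold 𝓘(ℂ, E) ω X] [MulAction G X]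
  {L : X → Type*} [TopologicalSpace (TotalSpace ℂ L)] [∀ x, TopologicalSpace (L x)]
  [∀ x, AddCommGroup (L x)] [∀ x, Module ℂ (L x)] [FiberBundle ℂ L] [VectorBundle ℂ ℂ L]
  [ContMDiffVectorBundle ω ℂ L 𝓘(ℂ, E)] [MulAction G (TotalSpace ℂ L)]

local notation "𝓛" => ModelWithCorners.prod 𝓘(ℝ, E) 𝓘(ℝ, ℂ)

/-- A dual of the moment map is an equivariant map to the Lie algebra, and hence an invariant
vector field. -/
theorem exists_invariantField_momentMap [FiniteDimensional ℝ F] [CompactSpace G] [T2Space G]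
    (hL : IsEquivariantLineBundle F G E L) {N : TotalSpace ℂ L → ℝ}
    (hN : IsInvariantHermitianNormSq G E N) {θ : DiffForm 𝓛 (TotalSpace ℂ L) 1}
    (hθ : IsSmoothForm θ) (hinv : IsInvariantForm G θ) (z : ℂ) :
    ∃ C : TotalSpace ℂ L → GroupLieAlgebra 𝓘(ℝ, F) G,
      IsInvariantField G (E := E) N (fun q => fundamentalVector 𝓛 (C q) q) ∧
      ∀ q, momentMap F G θ (fiberSMul z q) (C q : F) = 0 → momentMap F G θ (fiberSMul z q) = 0 := by
  have : IsTopologicalGroup G := topologicalGroup_of_lieGroup 𝓘(ℝ, F) ∞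
  obtain ⟨e, he, hpos⟩ := exists_invariant_innerProduct (G := G) (F := F)
    (ρ := fun g => (show F →L[ℝ] F from Ad (F := F) g).toLinearMap) (LinearMap.ext fun A => Ad_one (F := F) A)
    (fun g h A => Ad_mul (F := F) g h A) (fun A => (contMDiff_Ad (F := F) A).continuous)
  -- `C(q)` is the metric dual of the moment map at `zq`, so the moment map at `zq` takes the value
  -- `|C(q)|²` on `C(q)`. The factor `z` lets fields on the circle bundle control `θ` on its
  -- multiples.
  let C : TotalSpace ℂ L → F := fun q => e.symm (momentMap F G θ (fiberSMul z q))
  have hC : ContMDiff 𝓛 𝓘(ℝ, F) ∞ C := by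
    let b := Module.finBasis ℝ F
    -- Expanding in the dual basis reduces smoothness of `C` to that of the scalar functions
    -- `θ(b_i^#)`.
    have hsum : C = fun q => ∑ i, momentMap F G θ (fiberSMul z q) (b i) • e.symm (b.coord i) := by
      funext q
      simp only [C, ← map_smul, ← map_sum]
      congr 1
      refine b.ext fun j => ?_
      simp
    rw [hsum]
    refine contMDiff_finsetSum fun i _ => ?_
    exact ((contMDiff_momentMap hL.smooth hθ (b i)).comp
      (contMDiff_fiberSMul_right z)).smul contMDiff_const
  have hCg : ∀ (g : G) q, C (g • q) = (Ad (F := F) g (C q) : F) := by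
    intro g q
    apply e.injective
    refine LinearMap.ext fun A => ?_
    have h1 : A = (Ad (F := F) g (Ad (F := F) g⁻¹ A) : F) := by
      refine Eq.trans ?_ (Ad_mul (F := F) g g⁻¹ A)
      rw [mul_inv_cancel]
      exact (Ad_one (F := F) A).symm
    have h2 := he g (C q) (Ad (F := F) g⁻¹ A)
    refine Eq.trans ?_ (Eq.trans h2.symm (congrArg (e (Ad (F := F) g (C q))) h1.symm))
    simp only [C, LinearEquiv.apply_symm_apply]
    rw [← hL.smul_fiberSMul]
    refine Eq.trans (congrArg _ h1) ?_
    exact momentMap_smul_Ad hL.smooth hinv g _ _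
  refine ⟨C, ⟨fun q _ => hN.mfderiv_fundamentalVector hL (C q) q,
    (contMDiff_fundT hL.smooth hC contMDiff_id).contMDiffOn, fun g q _ => ?_⟩, fun q hq => ?_⟩
  · have h := tangentMap_smul_fundT hL.smooth g (C q) q
    refine (snd_eq_of_eq h).trans ?_
    exact congrArg (fun A : GroupLieAlgebra 𝓘(ℝ, F) G => fundamentalVector 𝓛 A (g • q))
      (hCg g q).symm
  · have h0 : C q = 0 := by
      by_contra hne
      have h := hpos (C q) hne
      simp only [C, LinearEquiv.apply_symm_apply] at h
      exact h.ne' hq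
    have h1 := congrArg e h0
    simp only [C, LinearEquiv.apply_symm_apply, map_zero] at h1
    exact h1

/-- `C(q)^#` is a multiple of `X₀` at `q`, hence also at `zq`, where `θ(X₀) = 0` forces `|C(q)|² =
0`. -/
theorem momentMap_eq_zero_of_caseA [FiniteDimensional ℝ F] [CompactSpace G] [T2Space G]
    (hL : IsEquivariantLineBundle F G E L) {N : TotalSpace ℂ L → ℝ}
    (hN : IsInvariantHermitianNormSq G E N) (hcase : CaseA G E N)
    {θ : DiffForm 𝓛 (TotalSpace ℂ L) 1} (hθ : IsSmoothForm θ) (hinv : IsInvariantForm G θ)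
    (hcirc : ∀ q, form1 θ ⟨q, vertical E q Complex.I⟩ = 0) {q : TotalSpace ℂ L}
    (hq : q ∈ circleBundle N) (z : ℂ) : momentMap F G θ (fiberSMul z q) = 0 := by
  obtain ⟨C, hC, hzero⟩ := exists_invariantField_momentMap hL hN hθ hinv z
  obtain ⟨c, hc⟩ := hcase _ hC
  refine hzero q ?_
  have h1 : fundT 𝓛 (C q) q = ⟨q, vertical E q (c * Complex.I)⟩ := by
    refine congrArg (fun v => (⟨q, v⟩ : TangentBundle 𝓛 (TotalSpace ℂ L))) ?_
    rw [hc q hq, circleField_eq, vertical_smul]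
  have h2 := fundT_fiberSMul_of_eq_vertical hL h1 z
  refine (congrArg (form1 θ) h2).trans ?_
  rw [vertical_smul, form1_smul, hcirc, mul_zero]

end InvariantFields

/-! ### An Euler equation on the half line -/

section DifferentialEquation

/-- A solution of `s f' = -k f` with `k > 0` on the positive half line that extends continuously
to `0` vanishes. -/
theorem eq_zero_of_euler_equation {f f' : ℝ → ℝ} {k : ℝ} (hk : 0 < k) (hc : ContinuousAt f 0)
    (hd : ∀ s, 0 < s → HasDerivAt f (f' s) s) (hf : ∀ s, 0 < s → s * f' s = -k * f s)
    {s : ℝ} (hs : 0 < s) : f s = 0 := by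
  -- By the equation `f(s) s^k` is constant, and it tends to `0` at `0` since `f` stays bounded
  -- there and `k > 0`.
  let g : ℝ → ℝ := fun s => f s * s ^ k
  have hg : ∀ s ∈ Ioi (0 : ℝ), HasDerivAt g 0 s := by
    intro s hs
    have hs' : s ≠ 0 := (mem_Ioi.1 hs).ne'
    have h := (hd s hs).mul (Real.hasDerivAt_rpow_const (p := k) (Or.inl hs'))
    refine h.congr_deriv ?_
    rw [Real.rpow_sub_one hs']
    have h2 := hf s hs
    field_simp
    rw [mul_comm (f' s) s, h2]; ring
  have hconst : ∀ t ∈ Ioi (0 : ℝ), g t = g s := fun t ht =>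
    isOpen_Ioi.is_const_of_deriv_eq_zero isPreconnected_Ioi
      (fun x hx => (hg x hx).differentiableAt.differentiableWithinAt)
      (fun x hx => (hg x hx).deriv) ht hs
  have hlim : Tendsto g (𝓝[>] 0) (𝓝 (f 0 * 0 ^ k)) := by
    have hr : ContinuousAt (fun s : ℝ => s ^ k) 0 := Real.continuousAt_rpow_const 0 k (Or.inr hk.le)
    exact (hc.mul hr).tendsto.mono_left nhdsWithin_le_nhds
  have hlim2 : Tendsto g (𝓝[>] 0) (𝓝 (g s)) :=
    tendsto_const_nhds.congr' (by
      filter_upwards [self_mem_nhdsWithin] with t ht using (hconst t ht).symm)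
  have h0 := tendsto_nhds_unique hlim hlim2
  rw [Real.zero_rpow hk.ne', mul_zero] at h0
  exact (mul_eq_zero.1 h0.symm).resolve_right (Real.rpow_pos_of_pos hs k).ne'

end DifferentialEquation

/-! ### Brackets with a root vector -/

section ComplexifiedBracket

variable {𝔤 : Type*} [LieRing 𝔤] [LieAlgebra ℝ 𝔤]

/-- Compare real and imaginary parts in `[T, A - iB] = -ik (A - iB) = -kB - ikA`. -/
theorem bracket_of_eigenvector {T A B : 𝔤} {k : ℝ}
    (h : ⁅(1 : ℂ) ⊗ₜ[ℝ] T, (1 : ℂ) ⊗ₜ[ℝ] A - Complex.I ⊗ₜ[ℝ] B⁆ =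
      (-(k * Complex.I)) • ((1 : ℂ) ⊗ₜ[ℝ] A - Complex.I ⊗ₜ[ℝ] B)) :
    ⁅T, A⁆ = -(k • B) ∧ ⁅T, B⁆ = k • A := by
  have e : ⁅(1 : ℂ) ⊗ₜ[ℝ] T, (1 : ℂ) ⊗ₜ[ℝ] A - Complex.I ⊗ₜ[ℝ] B⁆ =
      (1 * 1 : ℂ) ⊗ₜ[ℝ] ⁅T, A⁆ - (1 * Complex.I) ⊗ₜ[ℝ] ⁅T, B⁆ :=
    lie_sub ((1 : ℂ) ⊗ₜ[ℝ] T) ((1 : ℂ) ⊗ₜ[ℝ] A) (Complex.I ⊗ₜ[ℝ] B)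
  rw [e, smul_sub, TensorProduct.smul_tmul', TensorProduct.smul_tmul'] at h
  have hre := congrArg ((TensorProduct.lid ℝ 𝔤).toLinearMap ∘ₗ LinearMap.rTensor 𝔤 Complex.reLm) h
  have him := congrArg ((TensorProduct.lid ℝ 𝔤).toLinearMap ∘ₗ LinearMap.rTensor 𝔤 Complex.imLm) h
  simp at hre him
  constructor
  · exact hre
  · rw [← lie_skew, him, neg_neg]

end ComplexifiedBracket

/-! ### Bilinear algebra of two-forms -/

section TwoForms

variable {V H : Type*} [NormedAddCommGroup V] [NormedSpace ℂ V] [TopologicalSpace H]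
  {I : ModelWithCorners ℝ V H} {M : Type*} [TopologicalSpace M] [ChartedSpace H M]

theorem form2_swap (η : DiffForm I M 2) (x : M) (v w : TangentSpace I x) :
    η x ![v, w] = -η x ![w, v] := by
  refine Eq.trans (congrArg (η x) ?_) ((η x).map_swap ![w, v] (i := 0) (j := 1) (by decide))
  funext i; fin_cases i <;> rfl

theorem form2_self (η : DiffForm I M 2) (x : M) (v : TangentSpace I x) : η x ![v, v] = 0 :=
  (η x).map_eq_zero_of_eq ![v, v] (i := 0) (j := 1) rfl (by decide)

theorem form2_add_left (η : DiffForm I M 2) (x : M) (u v w : TangentSpace I x) :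
    η x ![v + w, u] = η x ![v, u] + η x ![w, u] :=
  (η x).vecCons_add ![u] v w

theorem form2_smul_left (η : DiffForm I M 2) (x : M) (c : ℝ) (u v : TangentSpace I x) :
    η x ![c • v, u] = c * η x ![v, u] :=
  (η x).vecCons_smul ![u] c v

theorem form2_add_right (η : DiffForm I M 2) (x : M) (u v w : TangentSpace I x) :
    η x ![u, v + w] = η x ![u, v] + η x ![u, w] := by
  rw [form2_swap, form2_add_left, form2_swap η x u, form2_swap η x u, neg_add]

theorem form2_smul_right (η : DiffForm I M 2) (x : M) (c : ℝ) (u v : TangentSpace I x) :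
    η x ![u, c • v] = c * η x ![u, v] := by
  rw [form2_swap, form2_smul_left, form2_swap η x u, mul_neg]

end TwoForms

/-! ### Radial behaviour of the moment map; case (b) -/

section CaseB

variable {F : Type*} [NormedAddCommGroup F] [NormedSpace ℝ F]
  {G : Type*} [TopologicalSpace G] [ChartedSpace F G] [Group G] [LieGroup 𝓘(ℝ, F) ∞ G]
  {E : Type*} [NormedAddCommGroup E] [NormedSpace ℂ E]
  {X : Type*} [TopologicalSpace X] [ChartedSpace E X] [IsManifold 𝓘(ℂ, E) ω X] [MulAction G X]
  {L : X → Type*} [TopologicalSpace (TotalSpace ℂ L)] [∀ x, TopologicalSpace (L x)]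
  [∀ x, AddCommGroup (L x)] [∀ x, Module ℂ (L x)] [FiberBundle ℂ L] [VectorBundle ℂ ℂ L]
  [ContMDiffVectorBundle ω ℂ L 𝓘(ℂ, E)] [MulAction G (TotalSpace ℂ L)]

local notation "𝓛" => ModelWithCorners.prod 𝓘(ℝ, E) 𝓘(ℝ, ℂ)

variable [CompleteSpace F]

theorem contMDiff_fiberSMul_ofReal (q : TotalSpace ℂ L) :
    ContMDiff 𝓘(ℝ, ℝ) 𝓛 ∞ (fun s : ℝ => fiberSMul (s : ℂ) q) :=
  (contMDiff_fiberSMul_left q).comp (f := fun s : ℝ => (s : ℂ))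
    Complex.ofRealCLM.contDiff.contMDiff

/-- For an invariant 1-form, `dθ(R, A)` at a multiple of `q` is the radial derivative of `θ(A)`. -/
theorem extD_vertical_fundamentalVector (hL : IsEquivariantLineBundle F G E L)
    {θ : DiffForm 𝓛 (TotalSpace ℂ L) 1} (hθ : IsSmoothForm θ) (hinv : IsInvariantForm G θ) (q : TotalSpace ℂ L)
    (A : GroupLieAlgebra 𝓘(ℝ, F) G) {r : ℝ} (hr : r ≠ 0) :
    extD θ (fiberSMul (r : ℂ) q) ![vertical E (fiberSMul (r : ℂ) q) 1,
        fundamentalVector 𝓛 A (fiberSMul (r : ℂ) q)] =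
      r * deriv (fun s : ℝ => form1 θ (fundT 𝓛 A (fiberSMul (s : ℂ) q))) r := by
  have hσ : ContMDiff 𝓘(ℝ, ℝ) 𝓛 ∞ (fun s : ℝ => fiberSMul (s : ℂ) q) :=
    contMDiff_fiberSMul_ofReal q
  have h := extD_curve_fundamentalVector hL.smooth hθ hinv (hσ.contMDiffAt (x := r)) A
  -- The velocity `q` of the ray at `rq` is `r⁻¹ R`, whence the factor `r` in the statement.
  have h2 : mfderiv 𝓘(ℝ, ℝ) 𝓛 (fun s : ℝ => fiberSMul (s : ℂ) q) r (1 : ℝ) =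
      r⁻¹ • vertical E (fiberSMul (r : ℂ) q) 1 := by
    have e1 := mfderiv_comp_apply (I := 𝓘(ℝ, ℝ)) (I' := 𝓘(ℝ, ℂ)) (I'' := 𝓛) r
      (g := fun w : ℂ => fiberSMul w q) (f := fun t : ℝ => (t : ℂ))
      ((contMDiff_fiberSMul_left q _).mdifferentiableAt (by norm_num))
      (Complex.ofRealCLM.differentiableAt.mdifferentiableAt) (1 : ℝ)
    have e2 : mfderiv 𝓘(ℝ, ℝ) 𝓘(ℝ, ℂ) (fun t : ℝ => (t : ℂ)) r (1 : ℝ) = (1 : ℂ) :=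
      (DFunLike.congr_fun mfderiv_eq_fderiv (1 : ℝ)).trans
        ((DFunLike.congr_fun (Complex.ofRealCLM.hasFDerivAt (x := r)).fderiv 1).trans (by simp))
    have e3 := tangentMap_fiberSMul_left' (E := E) q (Complex.ofReal_ne_zero.2 hr) 1
    refine e1.trans ((congrArg (mfderiv 𝓘(ℝ, ℂ) 𝓛 (fun w : ℂ => fiberSMul w q) (r : ℂ)) e2).trans
      ((snd_eq_of_eq e3).trans ?_))
    rw [← vertical_smul, mul_one, Complex.ofReal_inv, one_div]
  rw [h2, form2_smul_left] at h
  rw [← h, mul_inv_cancel_left₀ hr]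

/-- Vertical vectors are spanned over `ℝ` by `R` and `X₀`. Along the ray `X₀ = T^#`, so `dθ(R, X₀)`
is a multiple of the radial derivative of `θ(T^#) = θ(X₀) = 0`. -/
theorem extD_vertical_I_vertical (hL : IsEquivariantLineBundle F G E L)
    {θ : DiffForm 𝓛 (TotalSpace ℂ L) 1} (hθ : IsSmoothForm θ) (hinv : IsInvariantForm G θ)
    (hcirc : ∀ q, form1 θ ⟨q, vertical E q Complex.I⟩ = 0) {q : TotalSpace ℂ L}
    {T : GroupLieAlgebra 𝓘(ℝ, F) G} (hT : fundT 𝓛 T q = ⟨q, vertical E q Complex.I⟩)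
    {r : ℝ} (hr : r ≠ 0) (d : ℂ) :
    extD θ (fiberSMul (r : ℂ) q) ![vertical E (fiberSMul (r : ℂ) q) Complex.I,
      vertical E (fiberSMul (r : ℂ) q) d] = 0 := by
  have hTs := fun s : ℝ => fundT_fiberSMul_of_eq_vertical hL hT (s : ℂ)
  have h := extD_vertical_fundamentalVector hL hθ hinv q T hr
  have h0 : (fun s : ℝ => form1 θ (fundT 𝓛 T (fiberSMul (s : ℂ) q))) = fun _ => 0 :=
    funext fun s => (congrArg (form1 θ) (hTs s)).trans (hcirc _)
  rw [h0, deriv_const, mul_zero] at h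
  have hTr : fundamentalVector 𝓛 T (fiberSMul (r : ℂ) q) =
      vertical E (fiberSMul (r : ℂ) q) Complex.I := snd_eq_of_eq (hTs r)
  rw [hTr] at h
  have hd : vertical E (fiberSMul (r : ℂ) q) d = d.re • vertical E (fiberSMul (r : ℂ) q) 1 +
      d.im • vertical E (fiberSMul (r : ℂ) q) Complex.I := by
    rw [← vertical_smul, ← vertical_smul, ← vertical_add, mul_one, Complex.re_add_im]
  rw [hd, form2_add_right, form2_smul_right, form2_smul_right, form2_self, form2_swap, h]
  simp

theorem J_J {V H : Type*} [NormedAddCommGroup V] [NormedSpace ℂ V] [TopologicalSpace H]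
    {I : ModelWithCorners ℝ V H} {M : Type*} [TopologicalSpace M] [ChartedSpace H M] (x : M)
    (v : TangentSpace I x) : J I x (J I x v) = -v := by
  have h : ∀ w : V, Complex.I • Complex.I • w = -w := fun w => by
    rw [smul_smul, Complex.I_mul_I, neg_one_smul]
  exact h v

/-- The radial derivative of the moment map, for a form `dθ` of type `(1,1)`. -/
theorem radial_deriv_momentMap (hL : IsEquivariantLineBundle F G E L)
    {θ : DiffForm 𝓛 (TotalSpace ℂ L) 1} (hθ : IsSmoothForm θ) (hinv : IsInvariantForm G θ)
    (hcirc : ∀ q, form1 θ ⟨q, vertical E q Complex.I⟩ = 0) (hone : IsOneOne (extD θ))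
    {q : TotalSpace ℂ L} (hq : q.snd ≠ 0)
    {T : GroupLieAlgebra 𝓘(ℝ, F) G} (hT : fundT 𝓛 T q = ⟨q, vertical E q Complex.I⟩)
    {A B : GroupLieAlgebra 𝓘(ℝ, F) G}
    (hAB : J 𝓘(ℝ, E) q.proj (fundamentalVector 𝓘(ℝ, E) A q.proj) =
      fundamentalVector 𝓘(ℝ, E) B q.proj) {r : ℝ} (hr : r ≠ 0) :
    r * deriv (fun s : ℝ => form1 θ (fundT 𝓛 A (fiberSMul (s : ℂ) q))) r =
      -form1 θ (fundT 𝓛 ⁅T, B⁆ (fiberSMul (r : ℂ) q)) := by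
  set q' := fiberSMul (r : ℂ) q with hq'
  have hq'0 : q'.snd ≠ 0 := smul_ne_zero (Complex.ofReal_ne_zero.2 hr) hq
  have hTr : fundamentalVector 𝓛 T q' = vertical E q' Complex.I :=
    snd_eq_of_eq (fundT_fiberSMul_of_eq_vertical hL hT (r : ℂ))
  -- `J A = B` is known only in the base; upstairs the two sides differ by a vertical vector.
  obtain ⟨d, hd⟩ : ∃ d, J 𝓛 q' (fundamentalVector 𝓛 A q') =
      fundamentalVector 𝓛 B q' + vertical E q' d := by
    have h1 : ((J 𝓛 q' (fundamentalVector 𝓛 A q') - fundamentalVector 𝓛 B q' :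
        TangentSpace 𝓛 q') : E × ℂ).1 = 0 := by
      have hA := hL.fundamentalVector_fst A q'
      have hB := hL.fundamentalVector_fst B q'
      change Complex.I • (fundamentalVector 𝓛 A q' : E × ℂ).1 -
        (fundamentalVector 𝓛 B q' : E × ℂ).1 = 0
      rw [hA, hB]
      exact sub_eq_zero.2 hAB
    exact ⟨_, (sub_eq_iff_eq_add'.1 (eq_vertical hq'0 h1))⟩
  -- `dθ(R, A) = dθ(JR, JA) = dθ(X₀, B + vertical) = dθ(T, B)`, and the last is `-θ([T, B])`.
  rw [← extD_vertical_fundamentalVector hL hθ hinv q A hr, ← hone, J_vertical, hd, mul_one,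
    form2_add_right, extD_vertical_I_vertical hL hθ hinv hcirc hT hr, add_zero, ← hTr]
  exact extD_fundamentalVector_fundamentalVector hL.smooth hθ hinv q' T B

/-- The function `f(s) = θ_{sq}(A^#)` satisfies `s f' = -k f` with `k > 0` and is continuous at `s =
0` because `θ` is smooth across the zero section; hence it vanishes. -/
theorem momentMap_rootVector_eq_zero (hL : IsEquivariantLineBundle F G E L)
    {θ : DiffForm 𝓛 (TotalSpace ℂ L) 1} (hθ : IsSmoothForm θ) (hinv : IsInvariantForm G θ)
    (hcirc : ∀ q, form1 θ ⟨q, vertical E q Complex.I⟩ = 0) (hone : IsOneOne (extD θ))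
    {q : TotalSpace ℂ L} (hq : q.snd ≠ 0)
    {T : GroupLieAlgebra 𝓘(ℝ, F) G} (hT : fundT 𝓛 T q = ⟨q, vertical E q Complex.I⟩)
    {A B : GroupLieAlgebra 𝓘(ℝ, F) G}
    (hAB : J 𝓘(ℝ, E) q.proj (fundamentalVector 𝓘(ℝ, E) A q.proj) =
      fundamentalVector 𝓘(ℝ, E) B q.proj) {k : ℝ} (hk : 0 < k) (hTB : ⁅T, B⁆ = k • A)
    {r : ℝ} (hr : 0 < r) : form1 θ (fundT 𝓛 A (fiberSMul (r : ℂ) q)) = 0 := by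
  have hσ : ContMDiff 𝓘(ℝ, ℝ) 𝓛 ∞ (fun s : ℝ => fiberSMul (s : ℂ) q) :=
    contMDiff_fiberSMul_ofReal q
  have hf : ContMDiff 𝓘(ℝ, ℝ) 𝓘(ℝ, ℝ) ∞
      (fun s : ℝ => form1 θ (fundT 𝓛 A (fiberSMul (s : ℂ) q))) :=
    (contMDiff_momentMap hL.smooth hθ A).comp hσ
  refine eq_zero_of_euler_equation (f := fun s : ℝ => form1 θ (fundT 𝓛 A (fiberSMul (s : ℂ) q)))
    hk hf.continuous.continuousAt
    (fun s _ => (hf.contDiff.differentiable (by norm_num) s).hasDerivAt) (fun s hs => ?_) hr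
  rw [radial_deriv_momentMap hL hθ hinv hcirc hone hq hT hAB hs.ne', hTB, neg_mul, neg_inj]
  exact (momentMap F G θ (fiberSMul (s : ℂ) q)).map_smul k A

/-- As in case (a), except that `C(q)^#` may also have components along `A` and `B`; `θ` vanishes on
these by the Euler equation. -/
theorem momentMap_eq_zero_of_caseB [FiniteDimensional ℝ F] [CompactSpace G] [T2Space G]
    (hL : IsEquivariantLineBundle F G E L) {N : TotalSpace ℂ L → ℝ}
    (hN : IsInvariantHermitianNormSq G E N) {q : TotalSpace ℂ L} (hq : q ∈ circleBundle N)
    (𝔱 : LieSubalgebra ℝ (GroupLieAlgebra 𝓘(ℝ, F) G))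
    (h𝔱 : ∀ A ∈ 𝔱, IsIsotropic F G E q.proj A) (hw : weight 𝔱 q ≠ 0)
    {α : 𝔱 →ₗ[ℝ] ℂ} (hcase : CaseB E N 𝔱 q α) {l : ℝ} (hl : 0 < l)
    (hα : weight 𝔱 q = -(l • α))
    {θ : DiffForm 𝓛 (TotalSpace ℂ L) 1} (hθ : IsSmoothForm θ) (hinv : IsInvariantForm G θ)
    (hcirc : ∀ q, form1 θ ⟨q, vertical E q Complex.I⟩ = 0) (hone : IsOneOne (extD θ))
    {z : ℂ} (hz : z ≠ 0) : momentMap F G θ (fiberSMul z q) = 0 := by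
  obtain ⟨A, B, hroot, vA, vB, hvA, hvB, hvAq, hvBq, hspan⟩ := hcase
  obtain ⟨T, hTw, hT⟩ := exists_weight_eq_I hL hN hq 𝔱 h𝔱 hw
  have hq0 := snd_ne_zero_of_mem_circleBundle hN hq
  -- From `λ(T) = i` and `λ = -lα`. The constant in the Euler equation is therefore `l⁻¹ > 0`.
  have hαT : α T = -((l⁻¹ : ℝ) * Complex.I) := by
    have h1 : Complex.I = -((l : ℂ) * α T) := by
      rw [← hTw, hα]; simp
    have hl' : (l : ℂ) ≠ 0 := Complex.ofReal_ne_zero.2 hl.ne'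
    rw [h1]; push_cast; field_simp
  have hbr := bracket_of_eigenvector ((hroot.eigenvector T).trans (by rw [hαT]))
  have hz0 : (fiberSMul z q).snd ≠ 0 := smul_ne_zero hz hq0
  have hTz := fundT_fiberSMul_of_eq_vertical hL hT z
  -- The ray is taken through `zq` and evaluated at `r = 1`.
  have hA := momentMap_rootVector_eq_zero hL hθ hinv hcirc hone hz0 hTz hroot.holomorphic
    (inv_pos.2 hl) hbr.2 one_pos
  rw [Complex.ofReal_one, fiberSMul_one] at hA
  -- The pair `(B, -A)` satisfies the same relations as `(A, B)`: `JB = -A` and `[T, -A] = l⁻¹ B`.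
  have hBA : J 𝓘(ℝ, E) q.proj (fundamentalVector 𝓘(ℝ, E) B q.proj) =
      fundamentalVector 𝓘(ℝ, E) (-A) q.proj := by
    rw [← hroot.holomorphic, J_J]
    exact ((mfderiv 𝓘(ℝ, F) 𝓘(ℝ, E) (fun g : G => g • q.proj) (1 : G)).map_neg A).symm
  have hB := momentMap_rootVector_eq_zero hL hθ hinv hcirc hone hz0 hTz hBA
    (inv_pos.2 hl) (by rw [lie_neg, hbr.1, neg_neg]) one_pos
  rw [Complex.ofReal_one, fiberSMul_one] at hB
  obtain ⟨C, hC, hzero⟩ := exists_invariantField_momentMap hL hN hθ hinv z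
  obtain ⟨a, b, c, habc⟩ := hspan _ hC
  refine hzero q ?_
  have h1 : fundT 𝓛 (C q - b • A - c • B) q = ⟨q, vertical E q (a * Complex.I)⟩ := by
    refine congrArg (fun v => (⟨q, v⟩ : TangentBundle 𝓛 (TotalSpace ℂ L))) ?_
    have h2 := habc q hq
    rw [hvAq, hvBq, circleField_eq, ← vertical_smul] at h2
    have h3 : fundamentalVector 𝓛 (C q - b • A - c • B) q = fundamentalVector 𝓛 (C q) q -
        b • fundamentalVector 𝓛 A q - c • fundamentalVector 𝓛 B q := by
      have key : ∀ (D : F →L[ℝ] E × ℂ) (x y z : F),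
          D (x - b • y - c • z) = D x - b • D y - c • D z := fun D x y z => by
        simp only [map_sub, map_smul]
      exact key (mfderiv 𝓘(ℝ, F) 𝓛 (fun g : G => g • q) (1 : G)) (C q) A B
    rw [h3, h2]
    abel
  have h2 := fundT_fiberSMul_of_eq_vertical hL h1 z
  have h3 : momentMap F G θ (fiberSMul z q) ((C q : F) - b • (A : F) - c • (B : F)) = 0 := by
    refine (congrArg (form1 θ) h2).trans ?_
    rw [vertical_smul, form1_smul, hcirc, mul_zero]
  have h4 : momentMap F G θ (fiberSMul z q) ((C q : F) - b • (A : F) - c • (B : F)) =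
    momentMap F G θ (fiberSMul z q) (C q : F) -
      b * momentMap F G θ (fiberSMul z q) (A : F) -
      c * momentMap F G θ (fiberSMul z q) (B : F) := by
    have key : ∀ (D : F →ₗ[ℝ] ℝ) (x y z : F),
        D (x - b • y - c • z) = D x - b * D y - c * D z := fun D x y z => by
      simp only [map_sub, map_smul, smul_eq_mul]
    exact key (momentMap F G θ (fiberSMul z q)) (C q) A B
  rw [h3, show momentMap F G θ (fiberSMul z q) (A : F) = 0 from hA,
    show momentMap F G θ (fiberSMul z q) (B : F) = 0 from hB] at h4
  linarith

end CaseB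

/-! ### Maps of locally maximal rank -/

section ConstantRank

variable {F E : Type*} [NormedAddCommGroup F] [NormedSpace ℝ F] [FiniteDimensional ℝ F]
  [NormedAddCommGroup E] [NormedSpace ℝ E] [FiniteDimensional ℝ E]

/-- Near a point where the rank of the derivative is maximal, a map is determined by a linear
projection onto the range of its derivative. -/
theorem eventually_eq_of_rank_le {ψ : F → E} {y₀ : F} (hψ : ContDiffAt ℝ 1 ψ y₀)
    {D : F →ₗ[ℝ] E} (hD : D = (fderiv ℝ ψ y₀).toLinearMap)
    (hrank : ∀ᶠ y in 𝓝 y₀, Module.finrank ℝ (LinearMap.range (fderiv ℝ ψ y).toLinearMap) ≤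
      Module.finrank ℝ (LinearMap.range D))
    {P : E →ₗ[ℝ] LinearMap.range D} (hP : ∀ w, P w.1 = w) :
    ∀ᶠ y in 𝓝 y₀, P (ψ y) = P (ψ y₀) → ψ y = ψ y₀ := by
  let W := LinearMap.range D
  let K := LinearMap.ker D
  obtain ⟨Q, hQ⟩ := K.subtype.exists_leftInverse_of_injective K.ker_subtype
  let P' : E →L[ℝ] W := P.toContinuousLinearMap
  let Q' : F →L[ℝ] K := Q.toContinuousLinearMap
  -- With `Q` a projection onto the kernel of `D`, the map `Ψ = (P ∘ ψ, Q)` is a local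
  -- diffeomorphism. Its inverse `χ` provides coordinates in which `P ∘ ψ` is the first projection.
  let Ψ : F → W × K := fun y => (P' (ψ y), Q' y)
  let Λ : F →ₗ[ℝ] W × K := (P ∘ₗ D).prod Q
  have hΛ : Function.Injective Λ := by
    refine (injective_iff_map_eq_zero Λ).2 fun v hv => ?_
    have h1 : P (D v) = 0 := congrArg Prod.fst hv
    have h2 : Q v = 0 := congrArg Prod.snd hv
    have h3 : D v = 0 := by
      have := hP ⟨D v, LinearMap.mem_range_self D v⟩
      rw [h1] at this
      exact (congrArg Subtype.val this).symm
    have h4 : Q v = ⟨v, h3⟩ := DFunLike.congr_fun hQ ⟨v, h3⟩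
    rw [h2] at h4
    exact (congrArg Subtype.val h4).symm
  let Λe : F ≃L[ℝ] W × K := (LinearEquiv.ofInjectiveOfFinrankEq Λ hΛ (by
    rw [Module.finrank_prod]; exact (LinearMap.finrank_range_add_finrank_ker D).symm)).toContinuousLinearEquiv
  have hψd : HasFDerivAt ψ (fderiv ℝ ψ y₀) y₀ := (hψ.differentiableAt (by norm_num)).hasFDerivAt
  have hΨd : HasFDerivAt Ψ (Λe : F →L[ℝ] W × K) y₀ := by
    refine ((P'.hasFDerivAt.comp y₀ hψd).prodMk Q'.hasFDerivAt).congr_fderiv ?_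
    subst hD
    ext v <;> rfl
  have hΨ : ContDiffAt ℝ 1 Ψ y₀ :=
    (P'.contDiff.contDiffAt.comp y₀ hψ).prodMk Q'.contDiff.contDiffAt
  let χ := hΨ.localInverse hΨd (by norm_num)
  have hχ : ContDiffAt ℝ 1 χ (Ψ y₀) := hΨ.to_localInverse hΨd (by norm_num)
  have hχ0 : χ (Ψ y₀) = y₀ := hΨ.localInverse_apply_image hΨd (by norm_num)
  have hleft : ∀ᶠ y in 𝓝 y₀, χ (Ψ y) = y :=
    (hΨ.hasStrictFDerivAt' hΨd (by norm_num)).eventually_left_inverse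
  have hright : ∀ᶠ z in 𝓝 (Ψ y₀), Ψ (χ z) = z :=
    (hΨ.hasStrictFDerivAt' hΨd (by norm_num)).eventually_right_inverse
  have hχc : Tendsto χ (𝓝 (Ψ y₀)) (𝓝 y₀) := by
    have := hχ.continuousAt
    rwa [ContinuousAt, hχ0] at this
  have hψn : ∀ᶠ y in 𝓝 y₀, DifferentiableAt ℝ ψ y := by
    filter_upwards [hψ.eventually (by simp)] with y hy using hy.differentiableAt (by norm_num)
  have hχn : ∀ᶠ z in 𝓝 (Ψ y₀), DifferentiableAt ℝ χ z := by
    filter_upwards [hχ.eventually (by simp)] with y hy using hy.differentiableAt (by norm_num)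
  -- Near `Ψ y₀` the projection `P` maps the range of the derivative of `ψ` onto `W`; by the rank
  -- bound it does so injectively. As `P ∘ ψ ∘ χ` does not depend on the `K` variable, neither does
  -- `ψ ∘ χ`.
  have hzero : ∀ᶠ z in 𝓝 (Ψ y₀), DifferentiableAt ℝ (ψ ∘ χ) z ∧
      ∀ k : K, fderiv ℝ (ψ ∘ χ) z (0, k) = 0 := by
    filter_upwards [hχn, hχc.eventually hψn, hχc.eventually hrank, hright.eventually_nhds]
      with z h1 h2 h3 h4
    refine ⟨h2.comp z h1, fun k => ?_⟩
    have hc := h2.hasFDerivAt.comp z h1.hasFDerivAt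
    rw [hc.fderiv]
    have hPid : ∀ u : W × K, P (fderiv ℝ ψ (χ z) (fderiv ℝ χ z u)) = u.1 := by
      intro u
      have e1 := (P'.hasFDerivAt.comp z hc)
      have e2 : (P' ∘ (ψ ∘ χ)) =ᶠ[𝓝 z] fun z => z.1 := by
        filter_upwards [h4] with z hz
        exact congrArg Prod.fst hz
      have e3 := (hasFDerivAt_fst (𝕜 := ℝ) (p := z)).congr_of_eventuallyEq e2
      exact DFunLike.congr_fun (e1.unique e3) u
    set D' := (fderiv ℝ ψ (χ z)).toLinearMap
    have hsurj : Function.Surjective (P.domRestrict (LinearMap.range D')) := fun w =>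
      ⟨⟨D' (fderiv ℝ χ z (w, 0)), LinearMap.mem_range_self _ _⟩, hPid (w, 0)⟩
    have hinj : Function.Injective (P.domRestrict (LinearMap.range D')) := by
      refine (LinearMap.injective_iff_surjective_of_finrank_eq_finrank ?_).2 hsurj
      refine le_antisymm h3 ?_
      exact LinearMap.finrank_le_finrank_of_surjective hsurj
    have h5 : P.domRestrict (LinearMap.range D')
        ⟨D' (fderiv ℝ χ z (0, k)), LinearMap.mem_range_self _ _⟩ = 0 := hPid (0, k)
    exact congrArg Subtype.val ((map_eq_zero_iff _ hinj).1 h5)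
  obtain ⟨ε, hε, hball⟩ := Metric.eventually_nhds_iff_ball.1 hzero
  have hΨc : ∀ᶠ y in 𝓝 y₀, Ψ y ∈ Metric.ball (Ψ y₀) ε :=
    hΨ.continuousAt.eventually (Metric.ball_mem_nhds _ hε)
  filter_upwards [hleft, hΨc] with y h1 h2 h3
  have hg : ∀ k ∈ Metric.ball (Ψ y₀).2 ε, HasFDerivAt (fun k => (ψ ∘ χ) ((Ψ y₀).1, k))
      (0 : K →L[ℝ] E) k := by
    intro k hk
    have hmem : ((Ψ y₀).1, k) ∈ Metric.ball (Ψ y₀) ε := by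
      rw [Metric.mem_ball, Prod.dist_eq]
      simpa [hε] using hk
    obtain ⟨h4, h5⟩ := hball _ hmem
    refine (h4.hasFDerivAt.comp k (hasFDerivAt_prodMk_right (Ψ y₀).1 k)).congr_fderiv ?_
    ext v
    exact h5 v
  have hk : (Ψ y).2 ∈ Metric.ball (Ψ y₀).2 ε := by
    rw [Metric.mem_ball] at h2 ⊢
    exact (le_max_right _ _).trans_lt (by rwa [Prod.dist_eq] at h2)
  have hconst := (convex_ball (Ψ y₀).2 ε).is_const_of_fderivWithin_eq_zero (𝕜 := ℝ)
    (f := fun k => (ψ ∘ χ) ((Ψ y₀).1, k))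
    (fun k hk => (hg k hk).differentiableAt.differentiableWithinAt)
    (fun k hk => by rw [fderivWithin_of_isOpen Metric.isOpen_ball hk, (hg k hk).fderiv])
    hk (Metric.mem_ball_self hε)
  have hy : ((Ψ y₀).1, (Ψ y).2) = Ψ y := Prod.ext h3.symm rfl
  have hy0 : ((Ψ y₀).1, (Ψ y₀).2) = Ψ y₀ := rfl
  simp only [hy, hy0, Function.comp_apply, h1, hχ0] at hconst
  exact hconst

/-- A map whose derivative has locally maximal rank and which is open at a point is a submersion
there. -/
theorem range_fderiv_eq_top_of_open {ψ : F → E} {y₀ : F} (hψ : ContDiffAt ℝ 1 ψ y₀)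
    (hrank : ∀ᶠ y in 𝓝 y₀, Module.finrank ℝ (LinearMap.range (fderiv ℝ ψ y).toLinearMap) ≤
      Module.finrank ℝ (LinearMap.range (fderiv ℝ ψ y₀).toLinearMap))
    (hopen : 𝓝 (ψ y₀) ≤ map ψ (𝓝 y₀)) :
    LinearMap.range (fderiv ℝ ψ y₀).toLinearMap = ⊤ := by
  set W := LinearMap.range (fderiv ℝ ψ y₀).toLinearMap
  obtain ⟨P, hP⟩ := W.subtype.exists_leftInverse_of_injective W.ker_subtype
  have hPw : ∀ w : W, P w.1 = w := fun w => DFunLike.congr_fun hP w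
  by_contra hW
  obtain ⟨x, hx⟩ : ∃ x, x ∉ W := by
    by_contra! h
    exact hW (Submodule.eq_top_iff'.2 h)
  -- A nonzero vector in the kernel of `P`: the points `ψ y₀ + t v` have the same projection as `ψ
  -- y₀`. For small `t` openness puts them in the image, so they would equal `ψ y₀`.
  set v := x - P x with hv
  have hv0 : v ≠ 0 := fun h => hx (by rw [sub_eq_zero.1 h]; exact (P x).2)
  have hPv : P v = 0 := by rw [hv, map_sub, hPw, sub_self]
  have hev := eventually_eq_of_rank_le hψ rfl hrank hPw
  have h1 : ∀ᶠ e in 𝓝 (ψ y₀), P e = P (ψ y₀) → e = ψ y₀ := by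
    refine hopen ?_
    exact hev
  have h2 : Tendsto (fun t : ℝ => ψ y₀ + t • v) (𝓝[≠] 0) (𝓝 (ψ y₀)) := by
    have : Continuous fun t : ℝ => ψ y₀ + t • v := by fun_prop
    have h := this.tendsto 0
    rw [zero_smul, add_zero] at h
    exact h.mono_left nhdsWithin_le_nhds
  obtain ⟨t, ht, ht0⟩ := ((h2.eventually h1).and self_mem_nhdsWithin).exists
  have h3 := ht (by rw [map_add, map_smul, hPv, smul_zero, add_zero])
  rw [add_eq_left, smul_eq_zero] at h3
  exact h3.elim ht0 hv0

end ConstantRank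

/-! ### Infinitesimal transitivity -/

section Spanning

variable {F : Type*} [NormedAddCommGroup F] [NormedSpace ℝ F] [FiniteDimensional ℝ F]
  {G : Type*} [TopologicalSpace G] [ChartedSpace F G] [Group G] [LieGroup 𝓘(ℝ, F) ∞ G]
  [T2Space G] [CompactSpace G]
  {V H : Type*} [NormedAddCommGroup V] [NormedSpace ℂ V] [FiniteDimensional ℂ V]
  [TopologicalSpace H] {I : ModelWithCorners ℝ V H} [I.Boundaryless]
  {M : Type*} [TopologicalSpace M] [ChartedSpace H M] [IsManifold I ∞ M] [MulAction G M]

theorem exists_mulInvariantVectorField_eq (g : G) (w : TangentSpace 𝓘(ℝ, F) g) :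
    ∃ A : GroupLieAlgebra 𝓘(ℝ, F) G, mulInvariantVectorField A g = w := by
  have hd : ∀ g : G, MDifferentiable 𝓘(ℝ, F) 𝓘(ℝ, F) (fun h : G => g * h) := fun g =>
    (contMDiff_mul_left (I := 𝓘(ℝ, F)) (n := ∞)).mdifferentiable (by norm_num)
  let A : F := mfderiv 𝓘(ℝ, F) 𝓘(ℝ, F) (fun h : G => g⁻¹ * h) g w
  have h1 : tangentMap 𝓘(ℝ, F) 𝓘(ℝ, F) (fun h : G => g⁻¹ * h) ⟨g, w⟩ = ⟨1, A⟩ :=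
    mk_eq_mk (I := 𝓘(ℝ, F)) (inv_mul_cancel g) A
  have h2 := tangentMap_comp_at (I' := 𝓘(ℝ, F)) (I'' := 𝓘(ℝ, F))
    (⟨g, w⟩ : TangentBundle 𝓘(ℝ, F) G) (hd g _) (hd g⁻¹ _)
  have h3 : (fun h : G => g * h) ∘ (fun h : G => g⁻¹ * h) = id := funext fun h => by simp
  rw [h3, tangentMap_id, h1] at h2
  exact ⟨A, (snd_eq_of_eq h2).symm⟩

/-- The fundamental vector fields of a transitive action span the tangent spaces. -/
theorem exists_fundamentalVector_eq [T2Space M] [CompactSpace M]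
    (hact : ContMDiff (𝓘(ℝ, F).prod I) I ∞ (fun a : G × M => a.1 • a.2))
    (htrans : ∀ x y : M, ∃ g : G, g • x = y) (p : M) (v : TangentSpace I p) :
    ∃ A : GroupLieAlgebra 𝓘(ℝ, F) G, fundamentalVector I A p = v := by
  have : FiniteDimensional ℝ V := FiniteDimensional.complexToReal V
  have : IsManifold I 1 M := .of_le (n := ∞) (by norm_num)
  have : IsTopologicalGroup G := topologicalGroup_of_lieGroup 𝓘(ℝ, F) ∞
  have : ContinuousSMul G M := ⟨hact.continuous⟩
  have : MulAction.IsPretransitive G M := ⟨htrans⟩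
  set e := extChartAt 𝓘(ℝ, F) (1 : G)
  have he1 : e.symm (e 1) = 1 := extChartAt_to_inv _
  let γ : F → M := fun y => e.symm y • p
  have hγ : ContMDiffAt 𝓘(ℝ, F) I ∞ γ (e 1) :=
    ContMDiffAt.comp (e 1) (contMDiff_orbit hact p).contMDiffAt contMDiffAt_chart_symm_one
  let c := extChartAt I (γ (e 1))
  let ψ : F → V := c ∘ γ
  have hψ : ContDiffAt ℝ ∞ ψ (e 1) := contDiffAt_extChartAt_comp hγ
  have hγe : ∀ u : F, mfderiv 𝓘(ℝ, F) I γ (e 1) u = (fundamentalVector I (G := G) u p : V) :=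
    fun u => snd_eq_of_eq (tangentMap_chart_orbit_one hact p u)
  let D : F →L[ℝ] V := mfderiv 𝓘(ℝ, F) I γ (e 1)
  have hD : fderiv ℝ ψ (e 1) = D := by
    refine ContinuousLinearMap.ext fun u => ?_
    refine Eq.trans ?_
      (mfderiv_eq_mfderiv_extChartAt_comp (hγ.mdifferentiableAt (by norm_num)) u).symm
    exact (DFunLike.congr_fun mfderiv_eq_fderiv u).symm
  have ht : e.target ∈ 𝓝 (e 1) :=
    (isOpen_extChartAt_target (1 : G)).mem_nhds (mem_extChartAt_target (1 : G))
  have hc : ∀ᶠ y in 𝓝 (e 1), γ y ∈ c.source :=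
    hγ.continuousAt.preimage_mem_nhds (extChartAt_source_mem_nhds (I := I) (γ (e 1)))
  have hγ1 : ∀ᶠ y in 𝓝 (e 1), MDifferentiableAt 𝓘(ℝ, F) I γ y := by
    filter_upwards [(contMDiffAt_iff_contMDiffAt_nhds (n := 1) (by norm_num)).1
      (hγ.of_le (by norm_num))] with a ha using ha.mdifferentiableAt (by norm_num)
  have hrank : ∀ᶠ y in 𝓝 (e 1), Module.finrank ℝ (LinearMap.range (fderiv ℝ ψ y).toLinearMap) ≤
      Module.finrank ℝ (LinearMap.range (fderiv ℝ ψ (e 1)).toLinearMap) := by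
    filter_upwards [ht, hc, hγ1] with y hy hcy hdy
    have hdc : MDifferentiableAt I 𝓘(ℝ, V) c (γ y) :=
      mdifferentiableAt_extChartAt (by rwa [← extChartAt_source I])
    -- By equivariance the derivative of the orbit map at `g` factors through the one at `1`,
    -- followed by translation by `g`, so the rank is largest at `1`.
    let B : V →L[ℝ] V := (show V →L[ℝ] V from mfderiv I 𝓘(ℝ, V) c (γ y)).comp
      (show V →L[ℝ] V from mfderiv I I (fun x : M => e.symm y • x) p)
    have hle : LinearMap.range (fderiv ℝ ψ y).toLinearMap ≤
        (LinearMap.range D.toLinearMap).map B.toLinearMap := by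
      rintro _ ⟨u, rfl⟩
      obtain ⟨A, hA⟩ := exists_mulInvariantVectorField_eq (e.symm y)
        (mfderiv 𝓘(ℝ, F) 𝓘(ℝ, F) e.symm y u)
      refine ⟨D A, ⟨A, rfl⟩, ?_⟩
      have h1 : tangentMap 𝓘(ℝ, F) I γ ⟨y, u⟩ =
          tangentMap I I (fun x : M => e.symm y • x) (fundT I A p) := by
        refine (tangentMap_chart_orbit hact p hy u).trans
          (Eq.trans ?_ (tangentMap_orbit hact A (e.symm y) p))
        exact congrArg (fun w => tangentMap 𝓘(ℝ, F) I (fun g : G => g • p) ⟨e.symm y, w⟩) hA.symm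
      have h2 : mfderiv 𝓘(ℝ, F) I γ y u = mfderiv I I (fun x : M => e.symm y • x) p (D A) :=
        (snd_eq_of_eq h1).trans (congrArg (mfderiv I I (fun x : M => e.symm y • x) p) (hγe A).symm)
      have h3 := mfderiv_comp_apply (I := 𝓘(ℝ, F)) (I' := I) (I'' := 𝓘(ℝ, V)) y hdc hdy u
      refine Eq.trans ?_ ((DFunLike.congr_fun mfderiv_eq_fderiv u).symm.trans h3).symm
      exact (congrArg (mfderiv I 𝓘(ℝ, V) c (γ y)) h2).symm
    rw [hD]
    exact (Submodule.finrank_mono hle).trans (Submodule.finrank_map_le _ _)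
  -- The orbit map of a transitive continuous action of a compact group on a compact Hausdorff space
  -- is open.
  have hopen : 𝓝 (ψ (e 1)) ≤ map ψ (𝓝 (e 1)) := by
    have h1 : map e.symm (𝓝 (e 1)) = 𝓝 (1 : G) := by
      have := map_extChartAt_symm_nhdsWithin_range (I := 𝓘(ℝ, F)) (1 : G)
      simp only [modelWithCornersSelf_coe, range_id, nhdsWithin_univ] at this
      exact this
    have h2 : 𝓝 ((1 : G) • p) ≤ map (fun g : G => g • p) (𝓝 1) :=
      (isOpenMap_smul_of_sigmaCompact p).nhds_le 1
    have h3 : map c (𝓝 (γ (e 1))) = 𝓝 (ψ (e 1)) := map_extChartAt_nhds_of_boundaryless _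
    have h4 : map ψ (𝓝 (e 1)) = map c (map (fun g : G => g • p) (map e.symm (𝓝 (e 1)))) := by
      rw [Filter.map_map, Filter.map_map]; rfl
    rw [← h3, h4, h1]
    refine Filter.map_mono ?_
    change 𝓝 (e.symm (e 1) • p) ≤ _
    rw [he1]
    exact h2
  have htop := range_fderiv_eq_top_of_open (hψ.of_le (by norm_num)) hrank hopen
  obtain ⟨A, hA⟩ := LinearMap.range_eq_top.1 htop v
  refine ⟨A, ?_⟩
  rw [hD] at hA
  exact (hγe A).symm.trans hA

end Spanning

/-! ### Orbits off the zero section and vanishing of `dθ` -/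

section Orbits

variable {F : Type*} [NormedAddCommGroup F] [NormedSpace ℝ F]
  {G : Type*} [TopologicalSpace G] [ChartedSpace F G] [Group G] [LieGroup 𝓘(ℝ, F) ∞ G]
  {E : Type*} [NormedAddCommGroup E] [NormedSpace ℂ E]
  {X : Type*} [TopologicalSpace X] [ChartedSpace E X] [IsManifold 𝓘(ℂ, E) ω X] [MulAction G X]
  {L : X → Type*} [TopologicalSpace (TotalSpace ℂ L)] [∀ x, TopologicalSpace (L x)]
  [∀ x, AddCommGroup (L x)] [∀ x, Module ℂ (L x)] [FiberBundle ℂ L] [VectorBundle ℂ ℂ L]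
  [ContMDiffVectorBundle ω ℂ L 𝓘(ℂ, E)] [MulAction G (TotalSpace ℂ L)]

local notation "𝓛" => ModelWithCorners.prod 𝓘(ℝ, E) 𝓘(ℝ, ℂ)


theorem exists_fiberSMul_eq {p q : TotalSpace ℂ L} (h : p.proj = q.proj) (hp : p.snd ≠ 0) :
    ∃ z : ℂ, q = fiberSMul z p := by
  obtain ⟨x, v⟩ := p
  obtain ⟨y, w⟩ := q
  obtain rfl : x = y := h
  let e := (trivializationAt ℂ L x).continuousLinearEquivAt ℂ x
    (FiberBundle.mem_baseSet_trivializationAt' x)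
  have hv : e v ≠ 0 := fun h => hp ((e.map_eq_zero_iff (x := v)).1 h)
  refine ⟨e w / e v, TotalSpace.ext rfl (heq_of_eq (e.injective ?_))⟩
  refine Eq.trans ?_ (e.map_smul (e w / e v) v).symm
  rw [smul_eq_mul, div_mul_cancel₀ _ hv]

/-- The action and the multiplication by complex numbers are jointly transitive. -/
theorem exists_eq_smul_fiberSMul (htrans : ∀ x y : X, ∃ g : G, g • x = y)
    (hL : IsEquivariantLineBundle F G E L) {p : TotalSpace ℂ L} (hp : p.snd ≠ 0)
    (q : TotalSpace ℂ L) : ∃ (g : G) (z : ℂ), q = g • fiberSMul z p := by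
  obtain ⟨g, hg⟩ := htrans p.proj q.proj
  have h1 : p.proj = (g⁻¹ • q).proj := by rw [hL.proj_smul, ← hg, inv_smul_smul]
  obtain ⟨z, hz⟩ := exists_fiberSMul_eq h1 hp
  exact ⟨g, z, by rw [← hz, smul_inv_smul]⟩

theorem IsEquivariantLineBundle.snd_smul_fiberSMul_eq_zero (hL : IsEquivariantLineBundle F G E L)
    (g : G) (p : TotalSpace ℂ L) : (g • fiberSMul 0 p).snd = 0 := by
  rw [hL.smul_fiberSMul]
  exact zero_smul ℂ _

theorem momentMap_smul_eq_zero (hL : IsEquivariantLineBundle F G E L)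
    {θ : DiffForm 𝓛 (TotalSpace ℂ L) 1} (hinv : IsInvariantForm G θ) (g : G) {q : TotalSpace ℂ L}
    (h : momentMap F G θ q = 0) : momentMap F G θ (g • q) = 0 := by
  refine LinearMap.ext fun A => ?_
  have h1 : A = (Ad (F := F) g (Ad (F := F) g⁻¹ A) : F) := by
    refine Eq.trans ?_ (Ad_mul (F := F) g g⁻¹ A)
    rw [mul_inv_cancel]
    exact (Ad_one (F := F) A).symm
  refine (congrArg (momentMap F G θ (g • q)) h1).trans ?_
  refine (momentMap_smul_Ad hL.smooth hinv g q _).trans ?_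
  rw [h]; rfl

theorem IsEquivariantLineBundle.fundT_smul_eq_vertical (hL : IsEquivariantLineBundle F G E L)
    {q : TotalSpace ℂ L} {A : GroupLieAlgebra 𝓘(ℝ, F) G} {c : ℂ}
    (h : fundT 𝓛 A q = ⟨q, vertical E q c⟩) (g : G) :
    fundT 𝓛 (Ad g A) (g • q) = ⟨g • q, vertical E (g • q) c⟩ := by
  have h1 := hL.tangentMap_smul_vertical g q 1 c
  rw [tangentMap_fiberSMul_left_one, tangentMap_fiberSMul_left_one, ← h] at h1
  exact (tangentMap_smul_fundT hL.smooth g A q).symm.trans h1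

variable [CompleteSpace F] [FiniteDimensional ℝ F] [FiniteDimensional ℂ E]
  [T2Space G] [CompactSpace G] [T2Space X] [CompactSpace X]

/-- The exterior derivative vanishes off the zero section if the moment map does. -/
theorem extD_eq_zero_of_momentMap (hX : IsHolomorphicTransitiveAction F G E X)
    (hL : IsEquivariantLineBundle F G E L) {θ : DiffForm 𝓛 (TotalSpace ℂ L) 1}
    (hθ : IsSmoothForm θ) (hinv : IsInvariantForm G θ)
    (hm : ∀ q : TotalSpace ℂ L, q.snd ≠ 0 → momentMap F G θ q = 0) {q : TotalSpace ℂ L}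
    (hq : q.snd ≠ 0) {T : GroupLieAlgebra 𝓘(ℝ, F) G}
    (hT : fundT 𝓛 T q = ⟨q, vertical E q Complex.I⟩) : extD θ q = 0 := by
  -- Transitivity on `X` matches the horizontal part of `v` by a fundamental vector. The remainder
  -- is vertical: its `X₀` component is a multiple of `T^#`, and the rest is a multiple of `R`.
  have hdec : ∀ v : TangentSpace 𝓛 q, ∃ (A : GroupLieAlgebra 𝓘(ℝ, F) G) (r : ℝ),
      v = fundamentalVector 𝓛 A q + r • vertical E q 1 := by
    intro v
    obtain ⟨A, hA⟩ := exists_fundamentalVector_eq (G := G) (F := F) hX.smooth hX.transitive q.proj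
      (show TangentSpace 𝓘(ℝ, E) q.proj from (v : E × ℂ).1)
    have h1 : ((v - fundamentalVector 𝓛 A q : TangentSpace 𝓛 q) : E × ℂ).1 = 0 := by
      refine sub_eq_zero.2 ?_
      exact (hL.fundamentalVector_fst A q |>.trans hA).symm
    obtain ⟨d, hd⟩ : ∃ d, v - fundamentalVector 𝓛 A q = vertical E q d := ⟨_, eq_vertical hq h1⟩
    have hTq : fundamentalVector 𝓛 T q = vertical E q Complex.I := snd_eq_of_eq hT
    refine ⟨A + d.im • T, d.re, ?_⟩
    have h2 : fundamentalVector 𝓛 (A + d.im • T) q =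
        fundamentalVector 𝓛 A q + d.im • fundamentalVector 𝓛 T q :=
      (fundamentalVector_add (G := G) A (d.im • T : F) q).trans
        (congrArg (fundamentalVector 𝓛 A q + ·) (fundamentalVector_smul (G := G) d.im T q))
    rw [sub_eq_iff_eq_add'.1 hd, h2, hTq, ← vertical_smul, ← vertical_smul, add_assoc,
      ← vertical_add, mul_one, add_comm (_ * Complex.I), Complex.re_add_im]
  have hff : ∀ A B : GroupLieAlgebra 𝓘(ℝ, F) G,
      extD θ q ![fundamentalVector 𝓛 A q, fundamentalVector 𝓛 B q] = 0 := by
    intro A B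
    rw [extD_fundamentalVector_fundamentalVector hL.smooth hθ hinv q A B, neg_eq_zero]
    exact LinearMap.congr_fun (hm q hq) (⁅A, B⁆ : GroupLieAlgebra 𝓘(ℝ, F) G)
  have hvf : ∀ A : GroupLieAlgebra 𝓘(ℝ, F) G,
      extD θ q ![vertical E q 1, fundamentalVector 𝓛 A q] = 0 := by
    intro A
    have h := extD_vertical_fundamentalVector hL hθ hinv q A one_ne_zero
    rw [Complex.ofReal_one, fiberSMul_one, one_mul] at h
    rw [h]
    have h0 : (fun s : ℝ => form1 θ (fundT 𝓛 A (fiberSMul (s : ℂ) q))) =ᶠ[𝓝 1] fun _ => 0 := by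
      filter_upwards [isOpen_ne.mem_nhds (one_ne_zero (α := ℝ))] with s hs
      exact LinearMap.congr_fun (hm _ (smul_ne_zero (Complex.ofReal_ne_zero.2 hs) hq)) A
    rw [h0.deriv_eq, deriv_const]
  refine twoForm_ext (W := E × ℂ) fun u w => ?_
  obtain ⟨A, r, hu⟩ := hdec u
  obtain ⟨B, s, hw⟩ := hdec w
  rw [hu, hw]
  have : extD θ q ![fundamentalVector 𝓛 A q + r • vertical E q 1,
      fundamentalVector 𝓛 B q + s • vertical E q 1] = 0 := by
    rw [form2_add_left, form2_add_right, form2_add_right, form2_smul_left, form2_smul_right,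
      form2_smul_left, form2_smul_right, hff, hvf, form2_self,
      form2_swap _ _ (fundamentalVector 𝓛 A q), hvf]
    simp
  exact this

end Orbits

/-! ### Extension across the zero section by continuity -/

section ZeroSection

variable {F : Type*} [NormedAddCommGroup F] [NormedSpace ℝ F]
  {G : Type*} [TopologicalSpace G] [ChartedSpace F G] [Group G] [LieGroup 𝓘(ℝ, F) ∞ G]
  {E : Type*} [NormedAddCommGroup E] [NormedSpace ℂ E]
  {X : Type*} [TopologicalSpace X] [ChartedSpace E X] [IsManifold 𝓘(ℂ, E) ω X] [MulAction G X]
  {L : X → Type*} [TopologicalSpace (TotalSpace ℂ L)] [∀ x, TopologicalSpace (L x)]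
  [∀ x, AddCommGroup (L x)] [∀ x, Module ℂ (L x)] [FiberBundle ℂ L] [VectorBundle ℂ ℂ L]
  [ContMDiffVectorBundle ω ℂ L 𝓘(ℂ, E)] [MulAction G (TotalSpace ℂ L)]

local notation "𝓛" => ModelWithCorners.prod 𝓘(ℝ, E) 𝓘(ℝ, ℂ)


/-- A form whose exterior derivative vanishes off the zero section is closed. -/
theorem extD_eq_zero_of_snd_ne_zero {k : ℕ} {θ : DiffForm 𝓛 (TotalSpace ℂ L) k}
    (hθ : IsSmoothForm θ) (h : ∀ q : TotalSpace ℂ L, q.snd ≠ 0 → extD θ q = 0)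
    {p : TotalSpace ℂ L} (hp : p.snd ≠ 0) : extD θ (fiberSMul 0 p) = 0 := by
  set q := fiberSMul 0 p with hq
  have hc : ContinuousAt (fun s : ℝ => extChartAt 𝓛 q (fiberSMul (s : ℂ) p)) 0 := by
    have h1 : ContinuousAt (extChartAt 𝓛 q) (fiberSMul ((0 : ℝ) : ℂ) p) := by
      rw [Complex.ofReal_zero]; exact continuousAt_extChartAt q
    exact ContinuousAt.comp (f := fun s : ℝ => fiberSMul (s : ℂ) p) h1
      (contMDiff_fiberSMul_ofReal (E := E) p).continuous.continuousAt
  have h0 : (extChartAt 𝓛 q (fiberSMul ((0 : ℝ) : ℂ) p) : E × ℂ) = extChartAt 𝓛 q q := by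
    rw [Complex.ofReal_zero]
  have hsrc : ∀ᶠ s : ℝ in 𝓝 0, fiberSMul (s : ℂ) p ∈ (extChartAt 𝓛 q).source := by
    refine (contMDiff_fiberSMul_ofReal (E := E) p).continuous.continuousAt.preimage_mem_nhds ?_
    rw [Complex.ofReal_zero]
    exact extChartAt_source_mem_nhds q
  -- All values along the ray are read in the single chart centred on the zero section, where `dθ`
  -- has continuous coefficients.
  have hd : ContinuousAt (extDeriv (inChart θ q)) (extChartAt 𝓛 q q) := by
    have h1 := (inChart_contDiffAt hθ (mem_extChartAt_target q)).continuousAt_fderiv (by norm_num)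
    exact (ContinuousAlternatingMap.alternatizeUncurryFinCLM ℝ (E × ℂ) ℝ).continuous.continuousAt.comp
      h1
  have hlim : Tendsto (fun s : ℝ => extDeriv (inChart θ q) (extChartAt 𝓛 q (fiberSMul (s : ℂ) p)))
      (𝓝[≠] 0) (𝓝 (extDeriv (inChart θ q) (extChartAt 𝓛 q q))) := by
    rw [← h0] at hd ⊢
    exact (ContinuousAt.comp (f := fun s : ℝ => (extChartAt 𝓛 q (fiberSMul (s : ℂ) p) : E × ℂ))
      hd hc).tendsto.mono_left nhdsWithin_le_nhds
  have hzero : (fun s : ℝ => extDeriv (inChart θ q) (extChartAt 𝓛 q (fiberSMul (s : ℂ) p)))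
      =ᶠ[𝓝[≠] 0] fun _ => 0 := by
    filter_upwards [nhdsWithin_le_nhds hsrc, self_mem_nhdsWithin] with s hs hs0
    rw [← inChart_extD hθ ((extChartAt 𝓛 q).map_source hs), inChart, (extChartAt 𝓛 q).left_inv hs,
      h _ (smul_ne_zero (Complex.ofReal_ne_zero.2 hs0) hp)]
    rfl
  have hz := tendsto_nhds_unique (hlim.congr' hzero) tendsto_const_nhds
  refine form_eq_of_inChart (η' := 0) ?_
  rw [inChart_extD hθ (mem_extChartAt_target q), hz]
  rfl

end ZeroSection

end InvariantDDC

end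

/-! ### Assembly of the proof -/

theorem mainTheorem3
    {F : Type*} [NormedAddCommGroup F] [NormedSpace ℝ F] [FiniteDimensional ℝ F] [CompleteSpace F]
    {G : Type*} [TopologicalSpace G] [ChartedSpace F G] [Group G] [LieGroup 𝓘(ℝ, F) ∞ G]
    [T2Space G] [CompactSpace G] [SimplyConnectedSpace G]
    [LieAlgebra.IsSemisimple ℝ (GroupLieAlgebra 𝓘(ℝ, F) G)]
    {E : Type*} [NormedAddCommGroup E] [NormedSpace ℂ E] [FiniteDimensional ℂ E]
    {X : Type*} [TopologicalSpace X] [ChartedSpace E X] [IsManifold 𝓘(ℂ, E) ω X]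
    [T2Space X] [CompactSpace X] [MulAction G X]
    (hX : InvariantDDC.IsHolomorphicTransitiveAction F G E X)
    (hK : ∃ κ : InvariantDDC.DiffForm 𝓘(ℝ, E) X 2, InvariantDDC.IsKahlerForm κ)
    (L : X → Type*) [TopologicalSpace (TotalSpace ℂ L)] [∀ x, TopologicalSpace (L x)]
    [∀ x, AddCommGroup (L x)] [∀ x, Module ℂ (L x)] [FiberBundle ℂ L] [VectorBundle ℂ ℂ L]
    [ContMDiffVectorBundle ω ℂ L 𝓘(ℂ, E)] [MulAction G (TotalSpace ℂ L)]
    (hL : InvariantDDC.IsEquivariantLineBundle F G E L)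
    (N : TotalSpace ℂ L → ℝ) (hN : InvariantDDC.IsInvariantHermitianNormSq G E N)
    (q₀ : TotalSpace ℂ L) (hq₀ : q₀ ∈ InvariantDDC.circleBundle N)
    (𝔱 : LieSubalgebra ℝ (GroupLieAlgebra 𝓘(ℝ, F) G)) [𝔱.IsCartanSubalgebra]
    (h𝔱 : ∀ A ∈ 𝔱, InvariantDDC.IsIsotropic F G E q₀.proj A)
    (hweight : InvariantDDC.weight 𝔱 q₀ ≠ 0)
    (hcase : InvariantDDC.CaseA G E N ∨
      ∃ α : 𝔱 →ₗ[ℝ] ℂ, InvariantDDC.CaseB E N 𝔱 q₀ α ∧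
        ∃ l : ℝ, 0 < l ∧ InvariantDDC.weight 𝔱 q₀ = -(l • α))
    (η : InvariantDDC.DiffForm (𝓘(ℝ, E).prod 𝓘(ℝ, ℂ)) (TotalSpace ℂ L) 2)
    (hη_smooth : InvariantDDC.IsSmoothForm η)
    (hη_invariant : InvariantDDC.IsInvariantForm G η)
    (hη_closed : InvariantDDC.extD η = 0)
    (hη_oneOne : InvariantDDC.IsOneOne η)
    (hη_exact : ∃ θ : InvariantDDC.DiffForm (𝓘(ℝ, E).prod 𝓘(ℝ, ℂ)) (TotalSpace ℂ L) 1,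
      InvariantDDC.IsSmoothForm θ ∧ InvariantDDC.extD θ = η) :
    ∃ Φ : TotalSpace ℂ L → ℝ,
      ContMDiff (𝓘(ℝ, E).prod 𝓘(ℝ, ℂ)) 𝓘(ℝ, ℝ) ∞ Φ ∧
      (∀ (g : G) (q : TotalSpace ℂ L), Φ (g • q) = Φ q) ∧
      η = InvariantDDC.ddc (𝓘(ℝ, E).prod 𝓘(ℝ, ℂ)) Φ := by
  obtain ⟨θ₀, hθ₀, rfl⟩ := hη_exact
  obtain ⟨θ₁, hθ₁, hinv₁, hd₁⟩ :=
    InvariantDDC.exists_invariant_primitive hL.smooth hθ₀ hη_invariant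
  obtain ⟨Φ, θ, hΦ, hΦinv, hθ, hinv, hcirc, hd⟩ :=
    InvariantDDC.exists_primitive_sub_dc hL hθ₁ hinv₁
  refine ⟨Φ, hΦ, hΦinv, ?_⟩
  rw [hd₁] at hd
  have hq := InvariantDDC.snd_ne_zero_of_mem_circleBundle hN hq₀
  -- `dθ` is the difference of `ω` and `dd^c Φ`, both of type `(1,1)`.
  have hone : InvariantDDC.IsOneOne (InvariantDDC.extD θ) := by
    have : IsManifold (𝓘(ℂ, E).prod 𝓘(ℂ, ℂ)) 1 (TotalSpace ℂ L) := .of_le (n := ω) le_top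
    have h := InvariantDDC.isOneOne_ddc (IC := 𝓘(ℂ, E).prod 𝓘(ℂ, ℂ)) rfl rfl hΦ
    intro q v w
    rw [hd]
    exact congrArg₂ (· - ·) (hη_oneOne q v w) (h q v w)
  have hm₀ : ∀ z : ℂ, z ≠ 0 →
      InvariantDDC.momentMap F G θ (InvariantDDC.fiberSMul z q₀) = 0 := by
    intro z hz
    obtain hA | ⟨α, hB, l, hl, hα⟩ := hcase
    · exact InvariantDDC.momentMap_eq_zero_of_caseA hL hN hA hθ hinv hcirc hq₀ z
    · exact InvariantDDC.momentMap_eq_zero_of_caseB hL hN hq₀ 𝔱 h𝔱 hweight hB hl hα hθ hinv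
        hcirc hone hz
  -- Off the zero section, `G` and `ℂˣ` together act transitively, so the ray data at `q₀` suffice.
  have horbit : ∀ q : TotalSpace ℂ L, q.snd ≠ 0 → ∃ (g : G) (z : ℂ), z ≠ 0 ∧
      q = g • InvariantDDC.fiberSMul z q₀ := by
    intro q hq'
    obtain ⟨g, z, rfl⟩ := InvariantDDC.exists_eq_smul_fiberSMul hX.transitive hL hq q
    refine ⟨g, z, ?_, rfl⟩
    rintro rfl
    exact hq' (hL.snd_smul_fiberSMul_eq_zero g q₀)
  obtain ⟨T, -, hT⟩ := InvariantDDC.exists_weight_eq_I hL hN hq₀ 𝔱 h𝔱 hweight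
  have hm : ∀ q : TotalSpace ℂ L, q.snd ≠ 0 → InvariantDDC.momentMap F G θ q = 0 := by
    intro q hq'
    obtain ⟨g, z, hz, rfl⟩ := horbit q hq'
    exact InvariantDDC.momentMap_smul_eq_zero hL hinv g (hm₀ z hz)
  have hoff : ∀ q : TotalSpace ℂ L, q.snd ≠ 0 → InvariantDDC.extD θ q = 0 := by
    intro q hq'
    obtain ⟨g, z, hz, rfl⟩ := horbit q hq'
    exact InvariantDDC.extD_eq_zero_of_momentMap hX hL hθ hinv hm hq'
      (hL.fundT_smul_eq_vertical (InvariantDDC.fundT_fiberSMul_of_eq_vertical hL hT z) g)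
  have hzero : ∀ q : TotalSpace ℂ L, InvariantDDC.extD θ q = 0 := by
    intro q
    by_cases hq' : q.snd = 0
    · obtain ⟨g, hg⟩ := hX.transitive q₀.proj q.proj
      -- A point of the zero section is the end of a ray through a translate of `q₀`, along which
      -- `dθ` vanishes.
      have hz : q = InvariantDDC.fiberSMul 0 (g • q₀) := by
        have hp : (g • q₀).proj = q.proj := (hL.proj_smul g q₀).trans hg
        obtain ⟨z, hz⟩ := InvariantDDC.exists_fiberSMul_eq hp
          (hL.smul_snd_ne_zero g hq)
        have : z = 0 := by
          by_contra hz0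
          rw [hz] at hq'
          exact smul_ne_zero hz0 (hL.smul_snd_ne_zero g hq) hq'
        rw [hz, this]
      rw [hz]
      exact InvariantDDC.extD_eq_zero_of_snd_ne_zero hθ hoff (hL.smul_snd_ne_zero g hq)
    · exact hoff q hq'
  funext q
  exact sub_eq_zero.1 ((congrFun hd q).symm.trans (hzero q))
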